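/- Let $M$ be a complete (smooth) Riemannian manifold of dimension $n$ with sectional curvature $\ge 1$, let $\alpha\in[0,\pi)$, and let $\gamma:[\alpha,\pi]\to M$ be a unit speed geodesic. Let $\Lambda$ be an $(n-1)$-dimensional real vector space of Jacobi fields along $\gamma$ that are orthogonal to $\dot\gamma$, and suppose that its Riccati operator $S$, given by $S(J(t))=J'(t)$ for $J\in\Lambda$, is self-adjoint, that is, $$\langle J'(t),K(t)\rangle=\langle J(t),K'(t)\rangle\qquad\text{for all }J,K\in\Lambda,\ t\in[\alpha,\pi].$$ If $\alpha>0$, suppose moreover that the Riccati operator is defined at $\alpha$, i.e. there is a linear map $S(\alpha):\dot\gamma(\alpha)^{\perp}\to\dot\gamma(\alpha)^{\perp}$ with $S(\alpha)J(\alpha)=J'(\alpha)$ for all $J\in\Lambda$, and that all its eigenvalues are $\le\cot\alpha$. (For $\alpha=0$ the bound reads $\cot 0=\infty$ and nothing is assumed.) Put $$Z=\operatorname{span}\{J\in\Lambda : J(t)=0\text{ for some }t\in(\alpha,\pi)\},\qquad P=\{J\in\Lambda : J(t)=\sin(t)\,E(t)\text{ on }[\alpha,\pi]\text{ for some parallel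 field }E\text{ along }\gamma\}.$$ Then $P$ is a linear subspace of $\Lambda$, $\Lambda=Z\oplus P$, and the sum is orthogonal: $\langle J(t),K(t)\rangle=0$ for all $J\in Z$, $K\in P$ and $t\in[\alpha,\pi]$. -/

import Mathlib

open Bundle FiberBundle VectorField
open scoped Manifold ContDiff Topology

noncomputable section
namespace JacobiSplitting
variable {E : Type*} [NormedAddCommGroup E] [NormedSpace ℝ E]
  {H : Type*} [TopologicalSpace H] {I : ModelWithCorners ℝ E H}
  {M : Type*} [TopologicalSpace M] [ChartedSpace H M]
  [RiemannianBundle (fun x : M ↦ TangentSpace I x)]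

/-- The Koszul expression, whose value is `⟨∇_X Y, Z⟩` at `x`. -/
def koszul (X Y Z : Π x : M, TangentSpace I x) (x : M) : ℝ :=
  (1 / 2 : ℝ) *
    (d% (fun y ↦ inner ℝ (Y y) (Z y)) x (X x)
      + d% (fun y ↦ inner ℝ (X y) (Z y)) x (Y x)
      - d% (fun y ↦ inner ℝ (X y) (Y y)) x (Z x)
      + inner ℝ (mlieBracket I X Y x) (Z x)
      - inner ℝ (mlieBracket I X Z x) (Y x)
      - inner ℝ (mlieBracket I Y Z x) (X x))

set_option linter.unusedSectionVars false

variable [FiniteDimensional ℝ E] [CompleteSpace E] [IsManifold I ∞ M]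
  [IsContMDiffRiemannianBundle I ∞ E (fun x : M ↦ TangentSpace I x)]

theorem mdiff_inner {X Y : Π x : M, TangentSpace I x} {x : M}
    (hX : MDiffAt (T% X) x) (hY : MDiffAt (T% Y) x) :
    MDiffAt (fun y ↦ inner ℝ (X y) (Y y)) x :=
  MDifferentiableAt.inner_bundle (IB := I) (F := E) (E := fun x : M ↦ TangentSpace I x)
    (b := fun y ↦ y) hX hY

theorem koszul_tensorial_left {Y Z : Π x : M, TangentSpace I x} {x : M}
    (hY : MDiffAt (T% Y) x) (hZ : MDiffAt (T% Z) x) :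
    TensorialAt I E (koszul · Y Z x) x where
  smul {f X} hf hX := by
    simp [koszul, mvfderiv_fun_mul hf (mdiff_inner hX hZ),
      mvfderiv_fun_mul hf (mdiff_inner hX hY), inner_add_left, inner_smul_left,
      inner_smul_right, mlieBracket_smul_left hf hX]
    ring
  add {X X'} hX hX' := by
    simp [koszul, mvfderiv_fun_add (mdiff_inner hX hZ) (mdiff_inner hX' hZ),
      mvfderiv_fun_add (mdiff_inner hX hY) (mdiff_inner hX' hY), inner_add_left,
      inner_add_right, mlieBracket_add_left hX hX']
    ring

theorem koszul_tensorial_right {X Y : Π x : M, TangentSpace I x} {x : M}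
    (hX : MDiffAt (T% X) x) (hY : MDiffAt (T% Y) x) :
    TensorialAt I E (koszul X Y · x) x where
  smul {f Z} hf hZ := by
    simp [koszul, mvfderiv_fun_mul hf (mdiff_inner hX hZ),
      mvfderiv_fun_mul hf (mdiff_inner hY hZ), inner_add_left, inner_smul_left,
      inner_smul_right, mlieBracket_smul_right hf hZ, real_inner_comm]
    ring
  add {Z Z'} hZ hZ' := by
    simp [koszul, mvfderiv_fun_add (mdiff_inner hX hZ) (mdiff_inner hX hZ'),
      mvfderiv_fun_add (mdiff_inner hY hZ) (mdiff_inner hY hZ'), inner_add_left,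
      inner_add_right, mlieBracket_add_right hZ hZ']
    ring

theorem koszul_add_middle {X Y Y' Z : Π x : M, TangentSpace I x} {x : M}
    (hX : MDiffAt (T% X) x) (hY : MDiffAt (T% Y) x) (hY' : MDiffAt (T% Y') x)
    (hZ : MDiffAt (T% Z) x) :
    koszul X (Y + Y') Z x = koszul X Y Z x + koszul X Y' Z x := by
  simp [koszul, mvfderiv_fun_add (mdiff_inner hX hY) (mdiff_inner hX hY'),
      mvfderiv_fun_add (mdiff_inner hY hZ) (mdiff_inner hY' hZ), inner_add_left,
      inner_add_right, mlieBracket_add_right hY hY', mlieBracket_add_left hY hY']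
  ring

theorem koszul_smul_middle {X Y Z : Π x : M, TangentSpace I x} {f : M → ℝ} {x : M}
    (hX : MDiffAt (T% X) x) (hY : MDiffAt (T% Y) x) (hf : MDiffAt f x)
    (hZ : MDiffAt (T% Z) x) :
    koszul X (f • Y) Z x = f x * koszul X Y Z x + d% f x (X x) * inner ℝ (Y x) (Z x) := by
  simp [koszul, mvfderiv_fun_mul hf (mdiff_inner hX hY),
      mvfderiv_fun_mul hf (mdiff_inner hY hZ), inner_add_left, inner_smul_left,
      inner_smul_right, mlieBracket_smul_right hf hY, mlieBracket_smul_left hf hY, real_inner_comm]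
  ring

theorem extend_mdiff {x : M} (v : TangentSpace I x) : MDiffAt (T% (extend E v)) x :=
  mdifferentiableAt_extend ..

instance finiteDimensional_tangentSpace (x : M) : FiniteDimensional ℝ (TangentSpace I x) :=
  inferInstanceAs (FiniteDimensional ℝ E)

instance completeSpace_tangentSpace (x : M) : CompleteSpace (TangentSpace I x) :=
  FiniteDimensional.complete ℝ (TangentSpace I x)

open scoped Classical in
/-- `leviCivitaFun Y x v` is `∇_v Y` at `x`: the vector dual to the linear form given by the
Koszul expression. Where `Y` is not differentiable the value is irrelevant and set to `0`. -/
def leviCivitaFun (Y : Π x : M, TangentSpace I x) (x : M) :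
    TangentSpace I x →L[ℝ] TangentSpace I x :=
  if hY : MDiffAt (T% Y) x then
    LinearMap.toContinuousLinearMap
      { toFun := fun v ↦ (InnerProductSpace.toDual ℝ (TangentSpace I x)).symm
          (TensorialAt.mkHom₂ (fun X Z ↦ koszul X Y Z x) x
            (fun _ hZ ↦ koszul_tensorial_left hY hZ)
            (fun _ hX ↦ koszul_tensorial_right hX hY) v)
        map_add' := fun v w ↦ by simp
        map_smul' := fun c v ↦ by simp }
  else 0

theorem inner_leviCivitaFun {Y : Π x : M, TangentSpace I x} {x : M} (hY : MDiffAt (T% Y) x)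
    (v w : TangentSpace I x) :
    inner ℝ (leviCivitaFun Y x v) w = koszul (extend E v) Y (extend E w) x := by
  simp [leviCivitaFun, hY, TensorialAt.mkHom₂_apply_eq_extend]

/-- The Levi-Civita connection: `leviCivita Y x v` is `∇_v Y` at `x`. -/
def leviCivita : CovariantDerivative I E (TangentSpace I : M → Type _) where
  toFun := leviCivitaFun
  isCovariantDerivativeOnUniv :=
    { add := fun {Y Y' x} hY hY' _ ↦ by
        ext1 v
        refine ext_inner_right ℝ fun w ↦ ?_
        have hYY' : MDiffAt (T% (Y + Y')) x := mdifferentiableAt_add_section hY hY'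
        rw [inner_leviCivitaFun hYY', add_apply, inner_add_left,
          inner_leviCivitaFun hY, inner_leviCivitaFun hY',
          koszul_add_middle (extend_mdiff v) hY hY' (extend_mdiff w)]
      leibniz := fun {Y f x} hY hf _ ↦ by
        ext1 v
        refine ext_inner_right ℝ fun w ↦ ?_
        have hfY : MDiffAt (T% (f • Y)) x := hf.smul_section hY
        rw [inner_leviCivitaFun hfY, koszul_smul_middle (extend_mdiff v) hY hf (extend_mdiff w)]
        simp [inner_add_left, inner_smul_left, inner_leviCivitaFun hY] }

theorem koszul_add_koszul_swap {X Y Z : Π x : M, TangentSpace I x} {x : M} :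
    koszul X Y Z x + koszul X Z Y x = d% (fun y ↦ inner ℝ (Y y) (Z y)) x (X x) := by
  have h : (fun y ↦ (inner ℝ (Z y) (Y y) : ℝ)) = (fun y ↦ inner ℝ (Y y) (Z y)) := by
    ext; rw [real_inner_comm]
  simp only [koszul, h, mlieBracket_swap_apply (V := Z) (W := Y), inner_neg_left]
  ring

theorem inner_leviCivita {X Y Z : Π x : M, TangentSpace I x} {x : M} (hX : MDiffAt (T% X) x)
    (hY : MDiffAt (T% Y) x) (hZ : MDiffAt (T% Z) x) :
    inner ℝ (leviCivita Y x (X x)) (Z x) = koszul X Y Z x := by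
  change inner ℝ (leviCivitaFun Y x (X x)) (Z x) = koszul X Y Z x
  rw [inner_leviCivitaFun hY]
  exact TensorialAt.pointwise₂ (I := I) (F := E) (F' := E) (Φ := fun X Z ↦ koszul X Y Z x)
      (fun _ hZ ↦ koszul_tensorial_left hY hZ) (fun _ hX ↦ koszul_tensorial_right hX hY)
      (extend_mdiff _) hX (extend_mdiff _) hZ (by simp) (by simp)

/-- The Levi-Civita connection is compatible with the metric. -/
theorem leviCivita_metric {X Y Z : Π x : M, TangentSpace I x} {x : M} (hX : MDiffAt (T% X) x)
    (hY : MDiffAt (T% Y) x) (hZ : MDiffAt (T% Z) x) :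
    d% (fun y ↦ inner ℝ (Y y) (Z y)) x (X x) = inner ℝ (leviCivita Y x (X x)) (Z x)
     + inner ℝ (Y x) (leviCivita Z x (X x)) := by
  rw [inner_leviCivita hX hY hZ, real_inner_comm, inner_leviCivita hX hZ hY, koszul_add_koszul_swap]

/-- The Levi-Civita connection is torsion free. -/
theorem leviCivita_torsion : (leviCivita (I := I) (M := M)).torsion = 0 := by
  rw [CovariantDerivative.torsion_eq_zero_iff]
  intro X Y x hX hY
  refine ext_inner_right ℝ fun w ↦ ?_
  have := inner_leviCivita hX hY (extend_mdiff w)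
  have h2 := inner_leviCivita hY hX (extend_mdiff w)
  rw [extend_apply_self] at this h2
  rw [inner_sub_left, this, h2]
  have h : (fun y ↦ (inner ℝ (Y y) (X y) : ℝ)) = (fun y ↦ inner ℝ (X y) (Y y)) := by
    ext; rw [real_inner_comm]
  simp only [koszul, h, mlieBracket_swap_apply (V := Y) (W := X), inner_neg_left, extend_apply_self]
  ring

/-- The curvature tensor `R(u,v)w = ∇_u ∇_v w - ∇_v ∇_u w - ∇_[u,v] w`, computed with the
extensions of `u`, `v`, `w` to vector fields with constant coefficients in a chart around `x`. -/
def curvature {x : M} (u v w : TangentSpace I x) : TangentSpace I x :=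
  leviCivita (fun y ↦ leviCivita (extend E w) y (extend E v y)) x u
    - leviCivita (fun y ↦ leviCivita (extend E w) y (extend E u y)) x v
    - leviCivita (extend E w) x (mlieBracket I (extend E u) (extend E v) x)

/-- The sectional curvature of the plane spanned by `u` and `v`. -/
def sectionalCurvature {x : M} (u v : TangentSpace I x) : ℝ :=
  inner ℝ (curvature u v v) u / (‖u‖ ^ 2 * ‖v‖ ^ 2 - (inner ℝ u v) ^ 2)

variable (I) in
/-- Vector fields along the restriction of the curve `γ` to the parameter set `s`. -/
abbrev FieldAlong (γ : ℝ → M) (s : Set ℝ) : Type _ :=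
  (t : s) → TangentSpace I (γ t)

variable {γ : ℝ → M} {s : Set ℝ}

open scoped Classical in
/-- A field along `γ` on `s`, as a map into the tangent bundle; only its values on `s` matter. -/
def FieldAlong.lift (V : FieldAlong I γ s) (r : ℝ) : TangentBundle I M :=
  ⟨γ r, if h : r ∈ s then V ⟨r, h⟩ else 0⟩

/-- Smoothness of a vector field along `γ` on `s`. -/
def FieldAlong.IsSmooth (V : FieldAlong I γ s) : Prop :=
  ContMDiffOn 𝓘(ℝ, ℝ) I.tangent ∞ V.lift s

variable (I) in
/-- The velocity field of `γ` on `s`. -/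
def velocity (γ : ℝ → M) (s : Set ℝ) : FieldAlong I γ s :=
  fun t ↦ mfderivWithin 𝓘(ℝ, ℝ) I γ s t (1 : ℝ)

/-- The covariant derivative `V'` of a vector field `V` along `γ`. If `e₁, …, eₙ` is the frame of
coordinate fields around `γ t` and `V = ∑ vⁱ eᵢ`, then `V' = ∑ (dvⁱ/dt) eᵢ + ∑ vⁱ ∇_γ' eᵢ`
at the parameter `t`. The extension of `V t` used below has constant coefficients in this frame. -/
def FieldAlong.covDeriv (V : FieldAlong I γ s) : FieldAlong I γ s :=
  fun t ↦
    (trivializationAt E (TangentSpace I) (γ t)).symm (γ t)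
        (derivWithin (fun r ↦ (trivializationAt E (TangentSpace I) (γ t) (V.lift r)).2) s t)
      + leviCivita (extend E (V t)) (γ t) (velocity I γ s t)

variable (I) in
/-- `γ` is a geodesic on `s`. -/
def IsGeodesicOn (γ : ℝ → M) (s : Set ℝ) : Prop :=
  ContMDiffOn 𝓘(ℝ, ℝ) I ∞ γ s ∧ (velocity I γ s).covDeriv = 0

/-- Parallel vector fields along `γ`. -/
def FieldAlong.IsParallel (V : FieldAlong I γ s) : Prop :=
  V.IsSmooth ∧ V.covDeriv = 0

/-- Jacobi fields along `γ`: `J'' + R(J, γ')γ' = 0`. -/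
def FieldAlong.IsJacobi (J : FieldAlong I γ s) : Prop :=
  J.IsSmooth ∧
    ∀ t : s, J.covDeriv.covDeriv t + curvature (J t) (velocity I γ s t) (velocity I γ s t) = 0

/-- Vector fields along `γ` that are orthogonal to `γ`. -/
def FieldAlong.IsNormal (V : FieldAlong I γ s) : Prop :=
  ∀ t : s, inner ℝ (V t) (velocity I γ s t) = 0

variable (I) in
/-- The orthogonal complement of `γ'(t)`. -/
def normalSpace (γ : ℝ → M) (s : Set ℝ) (t : s) : Submodule ℝ (TangentSpace I (γ t)) :=
  (Submodule.span ℝ {velocity I γ s t})ᗮ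

/-- `S` is the Riccati operator of the family `Λ` at the parameter `t`: the endomorphism of
`γ'(t)^⊥` with `S (J t) = J' t` for all `J ∈ Λ`. For an `(n-1)`-dimensional space of normal Jacobi
fields it exists if and only if no nonzero `J ∈ Λ` vanishes at `t`, and it is then unique. -/
def IsRiccatiOperator (Λ : Submodule ℝ (FieldAlong I γ s)) (t : s)
    (S : Module.End ℝ (normalSpace I γ s t)) : Prop :=
  ∀ J ∈ Λ, ∀ v : normalSpace I γ s t,
    (v : TangentSpace I (γ t)) = J t → (S v : TangentSpace I (γ t)) = J.covDeriv t

/-- The Riccati operator `S J = J'` of the family `Λ` is self-adjoint: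
`⟨S J, K⟩ = ⟨J, S K⟩` for all `J, K ∈ Λ`, at every parameter. -/
def RiccatiSelfAdjoint (Λ : Submodule ℝ (FieldAlong I γ s)) : Prop :=
  ∀ J ∈ Λ, ∀ K ∈ Λ, ∀ t : s, inner ℝ (J.covDeriv t) (K t) = inner ℝ (J t) (K.covDeriv t)

end JacobiSplitting

end

noncomputable section

namespace JacobiSplitting

/-! The main point is that `Z` and `P` span `Λ`. If they did not, some nonzero linear form `lam` on
`Λ` would vanish on both. Let `φ t` be the least norm of `J t` among the fields with `lam J = 1`
(`minNorm`). A field vanishing at an interior `t` lies in `Z` and is killed by `lam`, so the minimum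
is attained and positive at every `t` in `(α, π)`, even where the Riccati operator is singular.
Geometrically `φ` is the length of a transverse Jacobi field, the class of `J` modulo the values of
the fields in `ker lam`. Splitting the derivative of a minimizer as `J' = a J + K` with `lam K = 0`,
and using `J - 2 (r - t) K` as a competitor near `t`, gives `φ φ'' ≤ -⟨R(J, γ')γ', J⟩ - 3 ‖K‖ ^ 2 ≤
-φ ^ 2` in the barrier sense (`exists_barrier`). The term `3 ‖K‖ ^ 2` is the O'Neill term of the
transverse equation.

Sturm comparison now leaves no room. A positive function on `(0, π)` with `φ'' + φ ≤ 0` is a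
multiple of the sine. On `(α, π)` with `0 < α` the same holds once its logarithmic derivative at `α`
is at most `cot α` (`eq_const_mul_sin_of_barrier`). In the equality case `K` vanishes at `t` and `a
= cot t`, so each `t` has a minimizer with `J' = cot t • J` at that one parameter
(`exists_isRigidAt`). This minimizer does not depend on `t`: a Grönwall estimate makes it locally
constant where evaluation is injective, the remaining parameters are isolated, and rigidity passes
to limits (`exists_cot`). The resulting field satisfies `J' = cot • J` throughout, hence is the sine
times a parallel field and belongs to `P` (`exists_parallel_of_cot`). This contradicts `lam J = 1`.

Orthogonality is elementary. For `K = sin • F` with `F` parallel, self-adjointness says that `⟨J, F⟩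
/ sin` is constant, so it vanishes if `J` has an interior zero (`inner_eq_zero_of_parallel`). The
intersection of `Z` and `P` is then trivial.

The analysis is carried out for an abstract `IsRiccatiFamily`. The geometric lemmas show that `Λ` is
one (`isRiccatiFamily`). They rest on the calculus of covariant derivatives along a curve, on
uniqueness of Jacobi fields, which needs a local bound on the curvature and therefore its
tensoriality, and on a dimension count in `γ'^⊥`. -/

/-! ### Calculus in one variable -/

/-- Necessary conditions of first and second order at a local minimum. -/
theorem deriv_eq_zero_and_second_deriv_nonneg {h h' : ℝ → ℝ} {t d : ℝ}
    (hh : ∀ᶠ r in 𝓝 t, HasDerivAt h (h' r) r) (hh' : HasDerivAt h' d t) (hmin : IsLocalMin h t) :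
    h' t = 0 ∧ 0 ≤ d := by
  have h0 : h' t = 0 := hmin.hasDerivAt_eq_zero hh.self_of_nhds
  refine ⟨h0, ?_⟩
  by_contra! hd
  have hderiv : deriv h =ᶠ[𝓝 t] h' := hh.mono fun r hr ↦ hr.deriv
  have h2 : deriv (deriv h) t = d := by rw [hderiv.deriv_eq, hh'.deriv]
  -- A negative second derivative makes `t` a local maximum as well, so `h` is constant near `t`,
  -- which forces `d = 0`.
  have hmax : IsLocalMax h t := isLocalMax_of_deriv_deriv_neg (by rw [h2]; exact hd)
    (by rw [hderiv.eq_of_nhds, h0]) hh.self_of_nhds.continuousAt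
  have hconst : h =ᶠ[𝓝 t] fun _ ↦ h t := by
    filter_upwards [hmin, hmax] with r h1 h2 using le_antisymm h2 h1
  have h3 : deriv h =ᶠ[𝓝 t] fun _ ↦ 0 := by
    have := hconst.deriv
    simpa using this
  have h4 : deriv (deriv h) t = 0 := by rw [h3.deriv_eq]; simp
  linarith

/-- If `η ^ 2` touches `g` from below at `t`, the derivatives of `η` and `g` compare at `t`. -/
theorem sq_touches_from_below {g g' η η' : ℝ → ℝ} {t d e : ℝ}
    (hle : ∀ᶠ r in 𝓝 t, η r ^ 2 ≤ g r) (heq : g t = η t ^ 2)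
    (hg : ∀ᶠ r in 𝓝 t, HasDerivAt g (g' r) r) (hg' : HasDerivAt g' d t)
    (hη : ∀ᶠ r in 𝓝 t, HasDerivAt η (η' r) r) (hη' : HasDerivAt η' e t) :
    g' t = 2 * η t * η' t ∧ 2 * η' t ^ 2 + 2 * η t * e ≤ d := by
  have h1 : ∀ᶠ r in 𝓝 t, HasDerivAt (fun r ↦ g r - η r ^ 2) (g' r - 2 * η r * η' r) r := by
    filter_upwards [hg, hη] with r h1 h2
    exact (h1.sub (h2.pow 2)).congr_deriv (by simp)
  have h2 : HasDerivAt (fun r ↦ g' r - 2 * η r * η' r) (d - (2 * η' t ^ 2 + 2 * η t * e)) t := by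
    exact (hg'.sub ((hη.self_of_nhds.const_mul 2).mul hη')).congr_deriv (by ring)
  have h3 : IsLocalMin (fun r ↦ g r - η r ^ 2) t := by
    filter_upwards [hle] with r hr
    rw [heq]; linarith
  obtain ⟨h4, h5⟩ := deriv_eq_zero_and_second_deriv_nonneg h1 h2 h3
  exact ⟨by linarith, by linarith⟩

/-- `φ ^ 2` has an upper barrier at `t` which forces `φ'' + φ ≤ 0` at `t` in the weak sense. -/
def HasSineBarrierAt (φ : ℝ → ℝ) (t : ℝ) : Prop :=
  ∃ g g' : ℝ → ℝ, ∃ k d : ℝ, (∀ᶠ r in 𝓝 t, φ r ^ 2 ≤ g r) ∧ g t = φ t ^ 2 ∧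
    (∀ᶠ r in 𝓝 t, HasDerivAt g (g' r) r) ∧ HasDerivAt g' d t ∧ g' t = 2 * k * φ t ^ 2 ∧
    d ≤ 2 * k ^ 2 * φ t ^ 2 - 2 * φ t ^ 2

theorem HasSineBarrierAt.second_deriv_le {φ η η' : ℝ → ℝ} {t e : ℝ} (hφ : HasSineBarrierAt φ t)
    (hle : ∀ᶠ r in 𝓝 t, η r ^ 2 ≤ φ r ^ 2) (heq : η t = φ t) (hpos : 0 < φ t)
    (hη : ∀ᶠ r in 𝓝 t, HasDerivAt η (η' r) r) (hη' : HasDerivAt η' e t) : e ≤ -η t := by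
  obtain ⟨g, g', k, d, hg1, hg2, hg3, hg4, hg5, hg6⟩ := hφ
  rw [← heq] at hg2 hg5 hg6 hpos
  obtain ⟨h1, h2⟩ := sq_touches_from_below (hle.and hg1 |>.mono fun r hr ↦ hr.1.trans hr.2)
    hg2 hg3 hg4 hη hη'
  rw [hg5] at h1
  have h3 : η' t = k * η t := by
    have : 2 * η t * η' t = 2 * η t * (k * η t) := by rw [← h1]; ring
    exact mul_left_cancel₀ (by positivity) this
  rw [h3] at h2
  have h4 : η t * e ≤ η t * (- η t) := by linarith
  exact le_of_mul_le_mul_left h4 hpos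

/-- Supplies a strict comparison function: `σ = cos (κ (r - m))` has `σ'' + σ = (1 - κ ^ 2) σ < 0`
because `1 < κ`. Choosing `κ < π / (b - a)` and `m` the midpoint keeps the argument inside `(-π/2,
π/2)`. -/
theorem exists_cos_pos_on_Icc {a b : ℝ} (hab : a < b) (hπ : b - a < Real.pi) :
    ∃ κ m : ℝ, 1 < κ ∧ ∀ r ∈ Set.Icc a b, 0 < Real.cos (κ * (r - m)) := by
  have hba : 0 < b - a := by linarith
  have hq : 1 < Real.pi / (b - a) := by rw [lt_div_iff₀ hba]; linarith
  obtain ⟨κ, h1, h2⟩ := exists_between hq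
  rw [lt_div_iff₀ hba] at h2
  refine ⟨κ, (a + b) / 2, h1, fun r hr ↦ Real.cos_pos_of_mem_Ioo ⟨?_, ?_⟩⟩
  · have : κ * ((a + b) / 2 - r) ≤ κ * ((b - a) / 2) :=
      mul_le_mul_of_nonneg_left (by linarith [hr.1]) (by linarith)
    linarith
  · have : κ * (r - (a + b) / 2) ≤ κ * ((b - a) / 2) :=
      mul_le_mul_of_nonneg_left (by linarith [hr.2]) (by linarith)
    linarith

/-- A minimum principle: a function with `φ'' + φ ≤ 0` in the barrier sense lies above a solution
of `u'' + u = 0` if it does so at the end points. -/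
theorem le_of_sineBarrier {φ u u' : ℝ → ℝ} {a b : ℝ} (hab : a < b) (hπ : b - a < Real.pi)
    (hc : ContinuousOn φ (Set.Icc a b)) (hpos : ∀ t ∈ Set.Ioo a b, 0 < φ t)
    (hbar : ∀ t ∈ Set.Ioo a b, HasSineBarrierAt φ t) (hu : ∀ r, HasDerivAt u (u' r) r)
    (hu' : ∀ r, HasDerivAt u' (-u r) r) (ha : u a ≤ φ a) (hb : u b ≤ φ b) {t : ℝ}
    (ht : t ∈ Set.Icc a b) : u t ≤ φ t := by
  obtain ⟨κ, m, hκ, hσpos⟩ := exists_cos_pos_on_Icc hab hπ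
  have hcont : ContinuousOn (fun r ↦ (φ r - u r) / Real.cos (κ * (r - m))) (Set.Icc a b) := by
    apply ContinuousOn.div
    · exact hc.sub fun r _ ↦ (hu r).continuousAt.continuousWithinAt
    · fun_prop
    · exact fun r hr ↦ (hσpos r hr).ne'
  -- With `c` the minimum of `(φ - u) / σ`, the function `u + c σ` touches `φ` from below at `t₁`.
  -- If `c < 0` the point is interior, and the barrier there gives `-u - c κ ^ 2 σ ≤ -(u + c σ)`,
  -- contrary to `1 < κ`.
  obtain ⟨t₁, ht₁, hmin⟩ := isCompact_Icc.exists_isMinOn (Set.nonempty_Icc.2 hab.le) hcont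
  obtain ⟨c, hcdef⟩ : ∃ c, c = (φ t₁ - u t₁) / Real.cos (κ * (t₁ - m)) := ⟨_, rfl⟩
  have hφt₁ : φ t₁ = u t₁ + c * Real.cos (κ * (t₁ - m)) := by
    rw [hcdef, div_mul_cancel₀ _ (hσpos t₁ ht₁).ne']; ring
  have hle : ∀ r ∈ Set.Icc a b, u r + c * Real.cos (κ * (r - m)) ≤ φ r := by
    intro r hr
    have h3 : c ≤ (φ r - u r) / Real.cos (κ * (r - m)) := hcdef ▸ hmin hr
    rw [le_div_iff₀ (hσpos r hr)] at h3
    linarith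
  rcases le_or_gt 0 c with hc0 | hc0
  · have := hle t ht
    have := mul_nonneg hc0 (hσpos t ht).le
    linarith
  exfalso
  have ht₁' : t₁ ∈ Set.Ioo a b := by
    have hneg : φ t₁ < u t₁ := by
      have := mul_neg_of_neg_of_pos hc0 (hσpos t₁ ht₁)
      linarith
    refine ⟨lt_of_le_of_ne ht₁.1 ?_, lt_of_le_of_ne ht₁.2 ?_⟩
    · rintro rfl; linarith
    · rintro rfl; linarith
  have hd1 : ∀ r, HasDerivAt (fun r ↦ u r + c * Real.cos (κ * (r - m)))
      (u' r - c * κ * Real.sin (κ * (r - m))) r := by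
    intro r
    have e3 : HasDerivAt (fun r ↦ Real.cos (κ * (r - m))) (-Real.sin (κ * (r - m)) * (κ * 1)) r :=
      (((hasDerivAt_id r).sub_const m).const_mul κ).cos
    exact ((hu r).add (e3.const_mul c)).congr_deriv (by ring)
  have hd2 : HasDerivAt (fun r ↦ u' r - c * κ * Real.sin (κ * (r - m)))
      (-u t₁ - c * κ ^ 2 * Real.cos (κ * (t₁ - m))) t₁ := by
    have e3 : HasDerivAt (fun r ↦ Real.sin (κ * (r - m))) (Real.cos (κ * (t₁ - m)) * (κ * 1)) t₁ :=
      (((hasDerivAt_id t₁).sub_const m).const_mul κ).sin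
    exact ((hu' t₁).sub (e3.const_mul (c * κ))).congr_deriv (by ring)
  have hsq : ∀ᶠ r in 𝓝 t₁, (u r + c * Real.cos (κ * (r - m))) ^ 2 ≤ φ r ^ 2 := by
    have hpos' : 0 < u t₁ + c * Real.cos (κ * (t₁ - m)) := hφt₁ ▸ hpos t₁ ht₁'
    filter_upwards [(hd1 t₁).continuousAt.eventually (lt_mem_nhds hpos'),
      Icc_mem_nhds ht₁'.1 ht₁'.2] with r h1 h2
    exact pow_le_pow_left₀ h1.le (hle r h2) 2
  have h5 := (hbar t₁ ht₁').second_deriv_le hsq hφt₁.symm (hpos t₁ ht₁')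
    (Filter.Eventually.of_forall hd1) hd2
  have h7 : 0 < -c * (κ ^ 2 - 1) * Real.cos (κ * (t₁ - m)) :=
    mul_pos (mul_pos (by linarith) (by nlinarith)) (hσpos t₁ ht₁)
  linarith

/-- A function with `φ'' + φ ≤ 0` in the barrier sense lies above the solution of `u'' + u = 0`
with the same boundary values. -/
theorem sine_concave_of_barrier {φ : ℝ → ℝ} {a b : ℝ} (hab : a < b) (hπ : b - a < Real.pi)
    (hc : ContinuousOn φ (Set.Icc a b)) (hpos : ∀ t ∈ Set.Ioo a b, 0 < φ t)
    (hbar : ∀ t ∈ Set.Ioo a b, HasSineBarrierAt φ t) {t : ℝ} (ht : t ∈ Set.Icc a b) :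
    φ a * Real.sin (b - t) + φ b * Real.sin (t - a) ≤ φ t * Real.sin (b - a) := by
  have hs : 0 < Real.sin (b - a) := Real.sin_pos_of_pos_of_lt_pi (by linarith) hπ
  have h := le_of_sineBarrier (φ := φ)
    (u := fun r ↦ (φ a * Real.sin (b - r) + φ b * Real.sin (r - a)) / Real.sin (b - a))
    (u' := fun r ↦ (-φ a * Real.cos (b - r) + φ b * Real.cos (r - a)) / Real.sin (b - a))
    hab hπ hc hpos hbar (fun r ↦ ?_) (fun r ↦ ?_) (by simp [hs.ne']) (by simp [hs.ne']) ht
  · rwa [div_le_iff₀ hs] at h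
  · have e1 : HasDerivAt (fun r ↦ Real.sin (b - r)) (Real.cos (b - r) * (-1)) r :=
      ((hasDerivAt_id r).const_sub b).sin
    have e2 : HasDerivAt (fun r ↦ Real.sin (r - a)) (Real.cos (r - a) * 1) r :=
      ((hasDerivAt_id r).sub_const a).sin
    exact (((e1.const_mul (φ a)).add (e2.const_mul (φ b))).div_const _).congr_deriv (by ring)
  · have e1 : HasDerivAt (fun r ↦ Real.cos (b - r)) (-Real.sin (b - r) * (-1)) r :=
      ((hasDerivAt_id r).const_sub b).cos
    have e2 : HasDerivAt (fun r ↦ Real.cos (r - a)) (-Real.sin (r - a) * 1) r :=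
      ((hasDerivAt_id r).sub_const a).cos
    exact (((e1.const_mul (-φ a)).add (e2.const_mul (φ b))).div_const _).congr_deriv (by ring)

/-! ### Convergence of quadratic forms -/

/-- A family of symmetric bilinear forms on a finite-dimensional space that converges to a positive
definite one is eventually bounded below by any smaller multiple of it. -/
theorem eventually_le_of_tendsto_posDef {Λ ι : Type*} [AddCommGroup Λ] [Module ℝ Λ]
    [FiniteDimensional ℝ Λ] {l : Filter ι} {Q : ι → LinearMap.BilinForm ℝ Λ}
    {Q₀ : LinearMap.BilinForm ℝ Λ} (hQ : ∀ i x y, Q i x y = Q i y x) (hQ₀ : ∀ x y, Q₀ x y = Q₀ y x)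
    (hlim : ∀ x, Filter.Tendsto (fun i ↦ Q i x x) l (𝓝 (Q₀ x x)))
    (hpos : ∀ x, x ≠ 0 → 0 < Q₀ x x) {θ : ℝ} (hθ : θ < 1) :
    ∀ᶠ i in l, ∀ x, θ * Q₀ x x ≤ Q i x x := by
  set n := Module.finrank ℝ Λ with hn
  obtain ⟨b, hb⟩ : ∃ b : Module.Basis (Fin n) ℝ Λ, LinearMap.IsOrthoᵢ Q₀ b :=
    LinearMap.BilinForm.exists_orthogonal_basis (B := Q₀) ⟨hQ₀⟩
  have hlim2 : ∀ x y, Filter.Tendsto (fun i ↦ Q i x y) l (𝓝 (Q₀ x y)) := by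
    intro x y
    have key : ∀ B : LinearMap.BilinForm ℝ Λ, (∀ x y, B x y = B y x) →
        B x y = (B (x + y) (x + y) - B x x - B y y) / 2 := by
      intro B hB
      have := hB x y
      simp only [map_add, LinearMap.add_apply]
      linarith
    simp_rw [fun i ↦ key (Q i) (hQ i), key Q₀ hQ₀]
    exact (((hlim (x + y)).sub (hlim x)).sub (hlim y)).div_const 2
  have hd : ∀ i, 0 < Q₀ (b i) (b i) := fun i ↦ hpos _ (b.ne_zero i)
  -- In coordinates normalized by `Q₀` every matrix entry is off by at most `(1 - θ) / (n + 1)`. The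
  -- double sum then contributes at most `(1 - θ) n / (n + 1)` times `Q₀ x x`. The `n + 1` also
  -- covers the zero space.
  have hclose : ∀ᶠ r in l, ∀ i j, |Q r (b i) (b j) - Q₀ (b i) (b j)|
      ≤ (1 - θ) / (n + 1) * (√(Q₀ (b i) (b i)) * √(Q₀ (b j) (b j))) := by
    rw [Filter.eventually_all]; intro i
    rw [Filter.eventually_all]; intro j
    have hp : 0 < (1 - θ) / (n + 1) * (√(Q₀ (b i) (b i)) * √(Q₀ (b j) (b j))) := by
      have := Real.sqrt_pos.2 (hd i)
      have := Real.sqrt_pos.2 (hd j)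
      have : 0 < 1 - θ := by linarith
      positivity
    filter_upwards [(hlim2 (b i) (b j)).eventually (Metric.closedBall_mem_nhds _ hp)] with r hr
    simpa [Real.dist_eq] using hr
  filter_upwards [hclose] with r hr x
  have hexp : ∀ B : LinearMap.BilinForm ℝ Λ, B x x =
      ∑ i, ∑ j, b.repr x i * (b.repr x j * B (b i) (b j)) := by
    intro B
    rw [← LinearMap.sum_repr_mul_repr_mul (B := B) b b x x]
    rw [Finsupp.sum_fintype _ _ (by simp)]
    refine Finset.sum_congr rfl fun i _ ↦ ?_
    rw [Finsupp.sum_fintype _ _ (by simp)]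
    simp
  have hQ₀x : Q₀ x x = ∑ i, (b.repr x i * √(Q₀ (b i) (b i))) ^ 2 := by
    rw [hexp]
    refine Finset.sum_congr rfl fun i _ ↦ ?_
    rw [Finset.sum_eq_single i]
    · rw [mul_pow, Real.sq_sqrt (hd i).le]; ring
    · intro j _ hji
      have : Q₀ (b i) (b j) = 0 := hb hji.symm
      simp [this]
    · simp
  set z : Fin n → ℝ := fun i ↦ b.repr x i * √(Q₀ (b i) (b i)) with hz
  have hdiff : |Q r x x - Q₀ x x| ≤ (1 - θ) * ∑ i, z i ^ 2 := by
    have h1 : Q r x x - Q₀ x x = ∑ i, ∑ j, b.repr x i * b.repr x j *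
        (Q r (b i) (b j) - Q₀ (b i) (b j)) := by
      rw [hexp (Q r), hexp Q₀, ← Finset.sum_sub_distrib]
      refine Finset.sum_congr rfl fun i _ ↦ ?_
      rw [← Finset.sum_sub_distrib]
      exact Finset.sum_congr rfl fun j _ ↦ by ring
    have h2 : ∀ i j, |b.repr x i * b.repr x j * (Q r (b i) (b j) - Q₀ (b i) (b j))|
        ≤ (1 - θ) / (n + 1) * ((z i ^ 2 + z j ^ 2) / 2) := by
      intro i j
      rw [abs_mul]
      calc _ ≤ |b.repr x i * b.repr x j| *
            ((1 - θ) / (n + 1) * (√(Q₀ (b i) (b i)) * √(Q₀ (b j) (b j)))) :=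
            mul_le_mul_of_nonneg_left (hr i j) (abs_nonneg _)
        _ = (1 - θ) / (n + 1) * |z i * z j| := by
            simp only [hz, abs_mul, abs_of_nonneg (Real.sqrt_nonneg _)]; ring
        _ ≤ _ := by
            have h0 : 0 ≤ (1 - θ) / (n + 1) := div_nonneg (by linarith) (by positivity)
            apply mul_le_mul_of_nonneg_left _ h0
            rw [abs_mul]
            nlinarith [sq_nonneg (|z i| - |z j|), sq_abs (z i), sq_abs (z j)]
    rw [h1]
    calc _ ≤ ∑ i, ∑ j, (1 - θ) / (n + 1) * ((z i ^ 2 + z j ^ 2) / 2) := by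
          refine (Finset.abs_sum_le_sum_abs _ _).trans (Finset.sum_le_sum fun i _ ↦ ?_)
          exact (Finset.abs_sum_le_sum_abs _ _).trans (Finset.sum_le_sum fun j _ ↦ h2 i j)
      _ = (1 - θ) * (n / (n + 1)) * ∑ i, z i ^ 2 := by
          simp only [← Finset.mul_sum, ← Finset.sum_div, Finset.sum_add_distrib, Finset.sum_const,
            Finset.card_univ, Fintype.card_fin, nsmul_eq_mul]
          ring
      _ ≤ _ := by
          apply mul_le_mul_of_nonneg_right _ (Finset.sum_nonneg fun i _ ↦ sq_nonneg _)
          have : (n : ℝ) / (n + 1) ≤ 1 := by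
            rw [div_le_one (by positivity)]; linarith
          nlinarith
  rw [← hQ₀x] at hdiff
  have := (abs_le.1 hdiff).1
  linarith

/-! ### Rigidity in the Sturm comparison with the sine -/

/-- Rigidity of the sine comparison on `(α, π)`: a positive function with `φ'' + φ ≤ 0` in the
barrier sense is a multiple of the sine, provided its logarithmic derivative at `α` is at most
`cot α` if `0 < α`. -/
theorem eq_const_mul_sin_of_barrier {φ : ℝ → ℝ} {α : ℝ} (hα : α ∈ Set.Ico 0 Real.pi)
    (hc : ContinuousOn φ (Set.Ioo α Real.pi)) (hpos : ∀ t ∈ Set.Ioo α Real.pi, 0 < φ t)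
    (hbar : ∀ t ∈ Set.Ioo α Real.pi, HasSineBarrierAt φ t)
    (hleft : 0 < α → ContinuousWithinAt φ (Set.Icc α Real.pi) α ∧ ∃ (g : ℝ → ℝ) (k : ℝ),
      (∀ r ∈ Set.Icc α Real.pi, φ r ≤ g r) ∧ g α = φ α ∧
      HasDerivWithinAt g k (Set.Icc α Real.pi) α ∧ k ≤ Real.cot α * φ α) :
    ∃ c : ℝ, ∀ t ∈ Set.Ioo α Real.pi, φ t = c * Real.sin t := by
  have hsin : ∀ t ∈ Set.Ioo α Real.pi, 0 < Real.sin t := fun t ht ↦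
    Real.sin_pos_of_pos_of_lt_pi (hα.1.trans_lt ht.1) ht.2
  -- concavity on compact subintervals, whose left end point may be `α` if `0 < α`
  have hconc : ∀ a b t, α ≤ a → (0 < α ∨ α < a) → a < b → b < Real.pi → t ∈ Set.Icc a b →
      φ a * Real.sin (b - t) + φ b * Real.sin (t - a) ≤ φ t * Real.sin (b - a) := by
    intro a b t ha hor hab hb ht
    have hsub : Set.Ioo a b ⊆ Set.Ioo α Real.pi := fun r hr ↦ ⟨ha.trans_lt hr.1, hr.2.trans hb⟩
    refine sine_concave_of_barrier hab (by linarith [hα.1]) ?_ (fun r hr ↦ hpos r (hsub hr))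
      (fun r hr ↦ hbar r (hsub hr)) ht
    intro r hr
    rcases eq_or_lt_of_le (ha.trans hr.1) with rfl | hlt
    · have h0 : 0 < α := by
        rcases hor with h | h
        · exact h
        · exact absurd hr.1 (not_le.2 h)
      exact (hleft h0).1.mono (Set.Icc_subset_Icc ha hb.le)
    · exact ((hc.continuousAt (Ioo_mem_nhds hlt (hr.2.trans_lt hb)))).continuousWithinAt
  -- `φ / sin` is nondecreasing: drop the nonnegative term with `φ b` in the concavity inequality
  -- and let `b` tend to `π`.
  have hmono : ∀ t₀ t, α ≤ t₀ → (0 < α ∨ α < t₀) → 0 ≤ φ t₀ → t₀ < t → t < Real.pi →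
      φ t₀ * Real.sin t ≤ φ t * Real.sin t₀ := by
    intro t₀ t h0 hor hφ0 hlt htπ
    have h1 : Filter.Tendsto (fun b ↦ φ t₀ * Real.sin (b - t)) (𝓝[<] Real.pi)
        (𝓝 (φ t₀ * Real.sin (Real.pi - t))) :=
      (Continuous.tendsto (by fun_prop) _).mono_left nhdsWithin_le_nhds
    have h2 : Filter.Tendsto (fun b ↦ φ t * Real.sin (b - t₀)) (𝓝[<] Real.pi)
        (𝓝 (φ t * Real.sin (Real.pi - t₀))) :=
      (Continuous.tendsto (by fun_prop) _).mono_left nhdsWithin_le_nhds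
    rw [Real.sin_pi_sub] at h1 h2
    refine le_of_tendsto_of_tendsto h1 h2 ?_
    filter_upwards [Ioo_mem_nhdsLT htπ] with b hb
    have h3 := hconc t₀ b t h0 hor (hlt.trans hb.1) hb.2 ⟨hlt.le, hb.1.le⟩
    have h4 : 0 ≤ φ b * Real.sin (t - t₀) :=
      mul_nonneg (hpos b ⟨(h0.trans_lt hlt).trans hb.1, hb.2⟩).le
        (Real.sin_nonneg_of_nonneg_of_le_pi (by linarith) (by linarith [hα.1]))
    linarith
  rcases eq_or_lt_of_le hα.1 with h0 | h0
  · subst h0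
    -- The mirror image, with `a` tending to `0`: `φ / sin` is nonincreasing as well, hence
    -- constant. For `0 < α` this half is replaced by the slope condition at `α`.
    have hanti : ∀ t t₀, 0 < t → t < t₀ → t₀ < Real.pi → φ t₀ * Real.sin t ≤ φ t * Real.sin t₀ := by
      intro t t₀ ht hlt hπ
      have h1 : Filter.Tendsto (fun a ↦ φ t₀ * Real.sin (t - a)) (𝓝[>] 0)
          (𝓝 (φ t₀ * Real.sin (t - 0))) :=
        (Continuous.tendsto (by fun_prop) _).mono_left nhdsWithin_le_nhds
      have h2 : Filter.Tendsto (fun a ↦ φ t * Real.sin (t₀ - a)) (𝓝[>] 0)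
          (𝓝 (φ t * Real.sin (t₀ - 0))) :=
        (Continuous.tendsto (by fun_prop) _).mono_left nhdsWithin_le_nhds
      rw [sub_zero] at h1 h2
      refine le_of_tendsto_of_tendsto h1 h2 ?_
      filter_upwards [Ioo_mem_nhdsGT ht] with a ha
      have h3 := hconc a t₀ t ha.1.le (Or.inr ha.1) (ha.2.trans hlt) hπ ⟨ha.2.le, hlt.le⟩
      have h4 : 0 ≤ φ a * Real.sin (t₀ - t) :=
        mul_nonneg (hpos a ⟨ha.1, ha.2.trans (hlt.trans hπ)⟩).le
          (Real.sin_nonneg_of_nonneg_of_le_pi (by linarith) (by linarith))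
      linarith
    have hm : Real.pi / 2 ∈ Set.Ioo 0 Real.pi := ⟨by positivity, by linarith [Real.pi_pos]⟩
    refine ⟨φ (Real.pi / 2), fun t ht ↦ ?_⟩
    rcases lt_trichotomy t (Real.pi / 2) with h | h | h
    · have h1 := hanti t _ ht.1 h hm.2
      have h2 := hmono t _ ht.1.le (Or.inr ht.1) (hpos t ht).le h hm.2
      rw [Real.sin_pi_div_two] at h1 h2
      linarith
    · rw [h, Real.sin_pi_div_two, mul_one]
    · have h1 := hanti _ t hm.1 h ht.2
      have h2 := hmono _ t hm.1.le (Or.inr hm.1) (hpos _ hm).le h ht.2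
      rw [Real.sin_pi_div_two] at h1 h2
      linarith
  · obtain ⟨hcα, g, k, hg1, hg2, hg3, hg4⟩ := hleft h0
    have hsα : 0 < Real.sin α := Real.sin_pos_of_pos_of_lt_pi h0 hα.2
    have hIoo : Set.Ioo α Real.pi ∈ 𝓝[>] α := Ioo_mem_nhdsGT hα.2
    have hφα : 0 ≤ φ α := by
      have h1 : Filter.Tendsto φ (𝓝[>] α) (𝓝 (φ α)) := by
        refine hcα.mono_left ?_
        rw [nhdsWithin_le_iff]
        exact Filter.mem_of_superset hIoo Set.Ioo_subset_Icc_self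
      refine ge_of_tendsto h1 ?_
      filter_upwards [hIoo] with r hr using (hpos r hr).le
    refine ⟨φ α / Real.sin α, fun b hb ↦ ?_⟩
    have h1 := hmono α b le_rfl (Or.inl h0) hφα hb.1 hb.2
    have h2 : φ b ≤ k * Real.sin (b - α) + φ α * Real.cos (b - α) := by
      -- compare derivatives at `α` in the concavity inequality
      have hd1 : HasDerivWithinAt (fun t ↦ g t * Real.sin (b - α) - φ α * Real.sin (b - t)
          - φ b * Real.sin (t - α))
          (k * Real.sin (b - α) + φ α * Real.cos (b - α) - φ b) (Set.Icc α Real.pi) α := by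
        have e1 : HasDerivAt (fun r ↦ Real.sin (b - r)) (Real.cos (b - α) * (-1)) α :=
          ((hasDerivAt_id α).const_sub b).sin
        have e2 : HasDerivAt (fun r ↦ Real.sin (r - α)) (Real.cos (α - α) * 1) α :=
          ((hasDerivAt_id α).sub_const α).sin
        exact (((hg3.mul_const _).sub (e1.hasDerivWithinAt.const_mul _)).sub
          (e2.hasDerivWithinAt.const_mul _)).congr_deriv (by simp)
      rw [hasDerivWithinAt_iff_tendsto_slope] at hd1
      have hset : Set.Icc α Real.pi \ {α} = Set.Ioc α Real.pi := Set.Icc_sdiff_left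
      have hne : (𝓝[Set.Icc α Real.pi \ {α}] α).NeBot := by
        rw [hset, nhdsWithin_Ioc_eq_nhdsGT hα.2]; infer_instance
      have hnn : 0 ≤ k * Real.sin (b - α) + φ α * Real.cos (b - α) - φ b := by
        refine ge_of_tendsto hd1 ?_
        rw [hset, nhdsWithin_Ioc_eq_nhdsGT hα.2]
        filter_upwards [Ioo_mem_nhdsGT hb.1] with t ht
        have h3 := hconc α b t le_rfl (Or.inl h0) hb.1 hb.2 ⟨ht.1.le, ht.2.le⟩
        have h4 := hg1 t ⟨ht.1.le, (ht.2.trans hb.2).le⟩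
        have h5 : 0 ≤ Real.sin (b - α) :=
          Real.sin_nonneg_of_nonneg_of_le_pi (by linarith [hb.1]) (by linarith [hb.2])
        rw [slope_def_field]
        apply div_nonneg _ (by linarith [ht.1])
        have h6 := mul_le_mul_of_nonneg_right h4 h5
        simp only [hg2, sub_self, Real.sin_zero]
        linarith
      linarith
    have h3 : 0 ≤ Real.sin (b - α) :=
      Real.sin_nonneg_of_nonneg_of_le_pi (by linarith [hb.1]) (by linarith [hb.2])
    have h4 := mul_le_mul_of_nonneg_right hg4 h3
    have h5 : φ b ≤ φ α / Real.sin α * Real.sin b := by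
      have : Real.cot α * φ α * Real.sin (b - α) + φ α * Real.cos (b - α)
          = φ α / Real.sin α * Real.sin b := by
        rw [Real.cot_eq_cos_div_sin]
        have : Real.sin b = Real.sin (b - α) * Real.cos α + Real.cos (b - α) * Real.sin α := by
          rw [← Real.sin_add]; simp
        rw [this]; field_simp
      linarith
    refine le_antisymm h5 ?_
    rw [div_mul_eq_mul_div, div_le_iff₀ hsα]
    exact h1

/-! ### Self-adjoint families of solutions of a Jacobi equation -/

section Family

variable {Λ : Type*} [AddCommGroup Λ] [Module ℝ Λ] {V : ℝ → Type*}
  [∀ t, NormedAddCommGroup (V t)] [∀ t, InnerProductSpace ℝ (V t)]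

/-- A linear family of fields `t ↦ ev t J` along the interval `[α, π]`, with derivatives
`t ↦ ev' t J`, that solve a Jacobi equation with curvature form `ρ` bounded below by `1`, and whose
Riccati operator is self-adjoint and defined on the whole space wherever this is possible. -/
structure IsRiccatiFamily (α : ℝ) (ev ev' : ∀ t, Λ →ₗ[ℝ] V t) (ρ : ℝ → Λ → Λ → ℝ) : Prop where
  selfAdjoint : ∀ t ∈ Set.Icc α Real.pi, ∀ J K,
    inner ℝ (ev' t J) (ev t K) = inner ℝ (ev t J) (ev' t K)
  hasDeriv_inner : ∀ t ∈ Set.Icc α Real.pi, ∀ J K,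
    HasDerivWithinAt (fun r ↦ inner ℝ (ev r J) (ev r K)) (2 * inner ℝ (ev' t J) (ev t K))
      (Set.Icc α Real.pi) t
  hasDeriv_inner' : ∀ t ∈ Set.Icc α Real.pi, ∀ J K,
    HasDerivWithinAt (fun r ↦ inner ℝ (ev' r J) (ev r K)) (inner ℝ (ev' t J) (ev' t K) - ρ t J K)
      (Set.Icc α Real.pi) t
  continuous_norm' : ∀ J, ContinuousOn (fun r ↦ ‖ev' r J‖ ^ 2) (Set.Icc α Real.pi)
  le_curv : ∀ t ∈ Set.Icc α Real.pi, ∀ J, ‖ev t J‖ ^ 2 ≤ ρ t J J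
  curv_zero : ∀ t ∈ Set.Icc α Real.pi, ∀ J, ev t J = 0 → ρ t J J = 0
  eq_zero : ∀ t ∈ Set.Icc α Real.pi, ∀ J, ev t J = 0 → ev' t J = 0 → J = 0
  -- Where `ev t` has a kernel this replaces the Riccati operator. The correction `N` vanishes at
  -- `t`, so subtracting it from `J` changes neither the value at `t` nor a linear form that kills
  -- such fields.
  exists_decomp : ∀ t ∈ Set.Icc α Real.pi, ∀ J, ∃ L N, ev t N = 0 ∧ ev' t J = ev t L + ev' t N

/-! ### The minimal norm on an affine hyperplane and its barrier -/

/-- `J` minimizes `‖ev t J‖` on the affine hyperplane `lam = 1`. -/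
def IsMinimizer (ev : ∀ t, Λ →ₗ[ℝ] V t) (lam : Λ →ₗ[ℝ] ℝ) (t : ℝ) (J : Λ) : Prop :=
  lam J = 1 ∧ ∀ L, lam L = 0 → inner ℝ (ev t J) (ev t L) = 0

/-- The minimum of `‖ev t J‖` on the affine hyperplane `lam = 1`. -/
def minNorm (ev : ∀ t, Λ →ₗ[ℝ] V t) (lam : Λ →ₗ[ℝ] ℝ) (t : ℝ) : ℝ :=
  sInf ((fun J ↦ ‖ev t J‖) '' {J | lam J = 1})

variable {α : ℝ} {ev ev' : ∀ t, Λ →ₗ[ℝ] V t} {ρ : ℝ → Λ → Λ → ℝ} {lam : Λ →ₗ[ℝ] ℝ} {t : ℝ}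

theorem minNorm_le {J : Λ} (hJ : lam J = 1) : minNorm ev lam t ≤ ‖ev t J‖ :=
  csInf_le ⟨0, by rintro _ ⟨K, _, rfl⟩; exact norm_nonneg _⟩ ⟨J, hJ, rfl⟩

theorem minNorm_nonneg : 0 ≤ minNorm ev lam t :=
  Real.sInf_nonneg (by rintro _ ⟨K, _, rfl⟩; exact norm_nonneg _)

theorem IsMinimizer.norm_sq {J K : Λ} (hJ : IsMinimizer ev lam t J) (hK : lam K = 1) :
    ‖ev t K‖ ^ 2 = ‖ev t J‖ ^ 2 + ‖ev t (K - J)‖ ^ 2 := by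
  have h := hJ.2 (K - J) (by simp [hJ.1, hK])
  have : ev t K = ev t J + ev t (K - J) := by simp
  rw [this, norm_add_sq_real, h]; ring

theorem IsMinimizer.minNorm_eq {J : Λ} (hJ : IsMinimizer ev lam t J) :
    minNorm ev lam t = ‖ev t J‖ := by
  refine le_antisymm (minNorm_le hJ.1) (le_csInf ⟨_, J, hJ.1, rfl⟩ ?_)
  rintro _ ⟨K, hK, rfl⟩
  have := hJ.norm_sq hK
  exact le_of_sq_le_sq (by nlinarith [sq_nonneg ‖ev t (K - J)‖]) (norm_nonneg _)

theorem IsMinimizer.minNorm_pos {J : Λ} (hJ : IsMinimizer ev lam t J)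
    (hker : ∀ J, ev t J = 0 → lam J = 0) : 0 < minNorm ev lam t := by
  rw [hJ.minNorm_eq, norm_pos_iff]
  intro h0
  have := hker J h0
  rw [hJ.1] at this
  exact one_ne_zero this

theorem IsMinimizer.ev_eq {J K : Λ} (hJ : IsMinimizer ev lam t J) (hK : IsMinimizer ev lam t K) :
    ev t J = ev t K := by
  have h1 := hJ.norm_sq hK.1
  rw [← hJ.minNorm_eq, ← hK.minNorm_eq] at h1
  have h2 : ev t (K - J) = 0 := by
    rw [← norm_eq_zero]; nlinarith
  rw [map_sub, sub_eq_zero] at h2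
  exact h2.symm

theorem exists_apply_eq_one (hlam : lam ≠ 0) : ∃ J, lam J = 1 := by
  obtain ⟨J, hJ⟩ : ∃ J, lam J ≠ 0 := by
    by_contra! h
    exact hlam (LinearMap.ext h)
  exact ⟨(lam J)⁻¹ • J, by simp [hJ]⟩

/-- Any field with `lam = 1` becomes a minimizer after subtracting a field of `ker lam` whose value
is its orthogonal projection to the values of `ker lam`. A minimizer is determined only up to fields
vanishing at `t`. This freedom removes the part of its derivative outside the range of `ev t`, and
what remains, `ev t L`, is split along `J` with coefficient `a = lam L`. -/
theorem IsRiccatiFamily.exists_minimizer [FiniteDimensional ℝ Λ]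
    (h : IsRiccatiFamily α ev ev' ρ) (hlam : lam ≠ 0)
    (ht : t ∈ Set.Icc α Real.pi) (hker : ∀ J, ev t J = 0 → lam J = 0) :
    ∃ (J K : Λ) (a : ℝ), IsMinimizer ev lam t J ∧ lam K = 0 ∧ ev' t J = a • ev t J + ev t K := by
  obtain ⟨J₀, hJ₀⟩ := exists_apply_eq_one hlam
  set W : Submodule ℝ (V t) := (LinearMap.ker lam).map (ev t)
  obtain ⟨L₀, hL₀, hL₀'⟩ : ∃ L₀, lam L₀ = 0 ∧ ev t L₀ = W.starProjection (ev t J₀) := by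
    have := W.starProjection_apply_mem (ev t J₀)
    obtain ⟨L₀, h1, h2⟩ := this
    exact ⟨L₀, h1, h2⟩
  obtain ⟨L, N, hN, hL⟩ := h.exists_decomp t ht (J₀ - L₀)
  have hlN := hker N hN
  have hev : ev t (J₀ - L₀ - N) = ev t J₀ - W.starProjection (ev t J₀) := by
    simp [hN, hL₀']
  have hl1 : lam (J₀ - L₀ - N) = 1 := by simp [hJ₀, hL₀, hlN]
  refine ⟨J₀ - L₀ - N, L - lam L • (J₀ - L₀ - N), lam L, ⟨hl1, ?_⟩, ?_, ?_⟩
  · intro K hK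
    rw [hev]
    exact W.starProjection_inner_eq_zero (ev t J₀) (ev t K) ⟨K, hK, rfl⟩
  · rw [map_sub, map_smul, hl1]; simp
  · rw [map_sub (ev' t), hL]
    simp only [map_sub (ev t) L, map_smul]
    abel

theorem IsRiccatiFamily.hasDerivAt_inner (h : IsRiccatiFamily α ev ev' ρ)
    (ht : t ∈ Set.Ioo α Real.pi) (J K : Λ) :
    HasDerivAt (fun r ↦ inner ℝ (ev r J) (ev r K)) (2 * inner ℝ (ev' t J) (ev t K)) t :=
  (h.hasDeriv_inner t (Set.Ioo_subset_Icc_self ht) J K).hasDerivAt (Icc_mem_nhds ht.1 ht.2)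

theorem IsRiccatiFamily.hasDerivAt_inner' (h : IsRiccatiFamily α ev ev' ρ)
    (ht : t ∈ Set.Ioo α Real.pi) (J K : Λ) :
    HasDerivAt (fun r ↦ inner ℝ (ev' r J) (ev r K)) (inner ℝ (ev' t J) (ev' t K) - ρ t J K) t :=
  (h.hasDeriv_inner' t (Set.Ioo_subset_Icc_self ht) J K).hasDerivAt (Icc_mem_nhds ht.1 ht.2)

/-- The barrier for `minNorm ^ 2` obtained from the variation `J - 2 (r - t) K`. -/
theorem IsRiccatiFamily.exists_barrier (h : IsRiccatiFamily α ev ev' ρ)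
    (ht : t ∈ Set.Ioo α Real.pi) {J K : Λ} {a : ℝ} (hJ : IsMinimizer ev lam t J) (hK : lam K = 0)
    (ha : ev' t J = a • ev t J + ev t K) :
    ∃ g g' : ℝ → ℝ, (∀ r, minNorm ev lam r ^ 2 ≤ g r) ∧ g t = minNorm ev lam t ^ 2 ∧
      (∀ᶠ r in 𝓝 t, HasDerivAt g (g' r) r) ∧
      HasDerivAt g' (2 * a ^ 2 * minNorm ev lam t ^ 2 - 6 * ‖ev t K‖ ^ 2 - 2 * ρ t J J) t ∧
      g' t = 2 * a * minNorm ev lam t ^ 2 := by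
  have hJK : inner ℝ (ev t J) (ev t K) = 0 := hJ.2 K hK
  have hJJ : inner ℝ (ev t J) (ev t J) = minNorm ev lam t ^ 2 := by
    rw [real_inner_self_eq_norm_sq, hJ.minNorm_eq]
  have hKK : inner ℝ (ev t K) (ev t K) = ‖ev t K‖ ^ 2 := real_inner_self_eq_norm_sq _
  have hKJ : inner ℝ (ev t K) (ev t J) = 0 := by rw [real_inner_comm, hJK]
  have hA1 : inner ℝ (ev' t J) (ev t J) = a * minNorm ev lam t ^ 2 := by
    rw [ha, inner_add_left, inner_smul_left, hJJ, hKJ]; simp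
  have hA2 : inner ℝ (ev' t J) (ev t K) = ‖ev t K‖ ^ 2 := by
    rw [ha, inner_add_left, inner_smul_left, hJK, hKK]; simp
  have hC : inner ℝ (ev' t J) (ev' t J) = a ^ 2 * minNorm ev lam t ^ 2 + ‖ev t K‖ ^ 2 := by
    rw [ha]
    simp only [inner_add_left, inner_add_right, inner_smul_left, inner_smul_right, hJJ, hKK, hJK,
      hKJ]
    simp; ring
  -- For the competitor `J - c (r - t) K` the second derivative of the squared norm at `t` contains
  -- `(2 - 8 c + 2 c ^ 2) ‖K‖ ^ 2`. It is smallest for `c = 2`, with coefficient `-6`.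
  refine ⟨fun r ↦ inner ℝ (ev r J) (ev r J) - 4 * ((r - t) * inner ℝ (ev r J) (ev r K))
      + 4 * ((r - t) ^ 2 * inner ℝ (ev r K) (ev r K)),
    fun r ↦ 2 * inner ℝ (ev' r J) (ev r J) - 4 * (inner ℝ (ev r J) (ev r K)
      + (r - t) * (2 * inner ℝ (ev' r J) (ev r K)))
      + 4 * (2 * (r - t) * inner ℝ (ev r K) (ev r K)
      + (r - t) ^ 2 * (2 * inner ℝ (ev' r K) (ev r K))), ?_, ?_, ?_, ?_, ?_⟩
  · intro r
    have h1 : minNorm ev lam r ≤ ‖ev r (J - (2 * (r - t)) • K)‖ :=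
      minNorm_le (by simp [hJ.1, hK])
    refine (pow_le_pow_left₀ minNorm_nonneg h1 2).trans (le_of_eq ?_)
    beta_reduce
    rw [map_sub, map_smul, norm_sub_sq_real, norm_smul, mul_pow, inner_smul_right,
      real_inner_self_eq_norm_sq, real_inner_self_eq_norm_sq, Real.norm_eq_abs, sq_abs]
    ring
  · simp [← hJJ]
  · filter_upwards [Ioo_mem_nhds ht.1 ht.2] with r hr
    have e1 : HasDerivAt (fun r ↦ r - t) 1 r := (hasDerivAt_id r).sub_const t
    have e2 : HasDerivAt (fun r ↦ (r - t) ^ 2) (2 * (r - t)) r :=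
      (e1.pow 2).congr_deriv (by simp)
    exact (((h.hasDerivAt_inner hr J J).sub
      ((e1.mul (h.hasDerivAt_inner hr J K)).const_mul 4)).add
      ((e2.mul (h.hasDerivAt_inner hr K K)).const_mul 4)).congr_deriv (by ring)
  · have e1 : HasDerivAt (fun r ↦ r - t) 1 t := (hasDerivAt_id t).sub_const t
    have e2 : HasDerivAt (fun r ↦ (r - t) ^ 2) (2 * (t - t)) t :=
      (e1.pow 2).congr_deriv (by simp)
    refine ((((h.hasDerivAt_inner' ht J J).const_mul 2).sub (((h.hasDerivAt_inner ht J K).add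
      (e1.mul ((h.hasDerivAt_inner' ht J K).const_mul 2))).const_mul 4)).add
      ((((e1.const_mul 2).mul (h.hasDerivAt_inner ht K K)).add
      (e2.mul ((h.hasDerivAt_inner' ht K K).const_mul 2))).const_mul 4)).congr_deriv ?_
    simp only [hC, hA2, hKK]
    ring
  · simp only [hA1, hJK]; ring

/-- The symmetric bilinear form `⟪ev t J, ev t K⟫`. -/
def gramForm (ev : ∀ t, Λ →ₗ[ℝ] V t) (t : ℝ) : LinearMap.BilinForm ℝ Λ :=
  (innerₗ (V t)).compl₁₂ (ev t) (ev t)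

theorem gramForm_apply (J K : Λ) : gramForm ev t J K = inner ℝ (ev t J) (ev t K) := by
  simp [gramForm]

theorem gramForm_symm (J K : Λ) : gramForm ev t J K = gramForm ev t K J := by
  rw [gramForm_apply, gramForm_apply, real_inner_comm]

theorem gramForm_self (J : Λ) : gramForm ev t J J = ‖ev t J‖ ^ 2 := by
  rw [gramForm_apply, real_inner_self_eq_norm_sq]

end Family

/-! ### Zeros of the fields and continuity of the minimal norm -/

section Family

variable {Λ : Type*} [AddCommGroup Λ] [Module ℝ Λ] {V : ℝ → Type*}
  [∀ t, NormedAddCommGroup (V t)] [∀ t, InnerProductSpace ℝ (V t)]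
  {α : ℝ} {ev ev' : ∀ t, Λ →ₗ[ℝ] V t} {ρ : ℝ → Λ → Λ → ℝ} {lam : Λ →ₗ[ℝ] ℝ} {t : ℝ}

theorem IsRiccatiFamily.continuousOn_inner (h : IsRiccatiFamily α ev ev' ρ) (J K : Λ) :
    ContinuousOn (fun r ↦ inner ℝ (ev r J) (ev r K)) (Set.Icc α Real.pi) :=
  fun r hr ↦ (h.hasDeriv_inner r hr J K).continuousWithinAt

theorem IsRiccatiFamily.continuousOn_inner' (h : IsRiccatiFamily α ev ev' ρ) (J K : Λ) :
    ContinuousOn (fun r ↦ inner ℝ (ev' r J) (ev r K)) (Set.Icc α Real.pi) :=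
  fun r hr ↦ (h.hasDeriv_inner' r hr J K).continuousWithinAt

theorem nhdsWithin_Icc_diff_eq_nhdsNE {a b t : ℝ} (ht : t ∈ Set.Ioo a b) :
    𝓝[Set.Icc a b \ {t}] t = 𝓝[≠] t := by
  rw [Set.sdiff_eq_compl_inter]
  exact nhdsWithin_inter_of_mem' (mem_nhdsWithin_of_mem_nhds (Icc_mem_nhds ht.1 ht.2))

/-- A field vanishing at `t` vanishes to first order there. -/
theorem IsRiccatiFamily.tendsto_norm_sq_div (h : IsRiccatiFamily α ev ev' ρ)
    (ht : t ∈ Set.Ioo α Real.pi) {J : Λ} (hJ : ev t J = 0) :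
    Filter.Tendsto (fun r ↦ inner ℝ (ev r J) (ev r J) / (r - t) ^ 2) (𝓝[≠] t)
      (𝓝 (‖ev' t J‖ ^ 2)) := by
  have hnear : ∀ᶠ r in 𝓝[≠] t, r ∈ Set.Ioo α Real.pi :=
    mem_nhdsWithin_of_mem_nhds (Ioo_mem_nhds ht.1 ht.2)
  have hA := h.hasDerivAt_inner' ht J J
  rw [h.curv_zero t (Set.Ioo_subset_Icc_self ht) J hJ, sub_zero, real_inner_self_eq_norm_sq,
    hasDerivAt_iff_tendsto_slope] at hA
  -- The values lie in varying spaces `V r`, so the limit is taken on scalars. The quotient of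
  -- derivatives is the difference quotient of `⟨J', J⟩`, whose derivative at `t` is `‖J'‖ ^ 2`
  -- because the curvature term vanishes with `J`.
  refine HasDerivAt.lhopital_zero_nhdsNE (f' := fun r ↦ 2 * inner ℝ (ev' r J) (ev r J))
    (g' := fun r ↦ 2 * (r - t)) ?_ ?_ ?_ ?_ ?_ ?_
  · exact hnear.mono fun r hr ↦ h.hasDerivAt_inner hr J J
  · refine Filter.Eventually.of_forall fun r ↦ ?_
    exact (((hasDerivAt_id r).sub_const t).pow 2).congr_deriv (by simp)
  · filter_upwards [self_mem_nhdsWithin] with r hr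
    exact mul_ne_zero two_ne_zero (sub_ne_zero.2 hr)
  · have := (h.hasDerivAt_inner ht J J).continuousAt.tendsto
    simp only [hJ, inner_zero_right] at this
    exact this.mono_left nhdsWithin_le_nhds
  · have : Filter.Tendsto (fun r ↦ (r - t) ^ 2) (𝓝 t) (𝓝 ((t - t) ^ 2)) :=
      Continuous.tendsto (by fun_prop) _
    simp only [sub_self, ne_eq, OfNat.ofNat_ne_zero, not_false_eq_true, zero_pow] at this
    exact this.mono_left nhdsWithin_le_nhds
  · refine hA.congr fun r ↦ ?_
    rw [slope_def_field, hJ, inner_zero_right, sub_zero, mul_div_mul_left _ _ two_ne_zero]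

/-- Splitting off the fields that vanish at `t` and rescaling them, the forms `‖ev r ·‖ ^ 2` are
uniformly positive near `t`. -/
theorem IsRiccatiFamily.eventually_rescaled_le [FiniteDimensional ℝ Λ]
    (h : IsRiccatiFamily α ev ev' ρ) (ht : t ∈ Set.Icc α Real.pi)
    (ht' : t ∈ Set.Ioo α Real.pi ∨ ∀ J, ev t J = 0 → J = 0) {θ : ℝ} (hθ : θ < 1) :
    ∃ p : Λ →ₗ[ℝ] Λ, (∀ J, ev t (p J) = 0) ∧ (∀ J, ev t J = 0 → p J = J) ∧
      ∀ᶠ r in 𝓝[Set.Icc α Real.pi \ {t}] t, ∀ J,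
        θ * ((r - t) ^ 2 * ‖ev' t (p J)‖ ^ 2 + ‖ev t (J - p J)‖ ^ 2) ≤ ‖ev r J‖ ^ 2 := by
  obtain ⟨q, hq⟩ := (LinearMap.ker (ev t)).subtype.exists_leftInverse_of_injective
    (Submodule.ker_subtype _)
  set p : Λ →ₗ[ℝ] Λ := (LinearMap.ker (ev t)).subtype ∘ₗ q with hp
  have hp0 : ∀ J, ev t (p J) = 0 := fun J ↦ (q J).2
  have hp1 : ∀ J, ev t J = 0 → p J = J := by
    intro J hJ
    have := LinearMap.congr_fun hq ⟨J, hJ⟩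
    simp only [LinearMap.comp_apply, LinearMap.id_apply, Submodule.subtype_apply] at this
    simp only [hp, LinearMap.comp_apply, this, Submodule.subtype_apply]
  have hpp : ∀ J, p (p J) = p J := fun J ↦ hp1 _ (hp0 J)
  refine ⟨p, hp0, hp1, ?_⟩
  -- Fields vanishing at `t` are divided by `r - t`; the others are kept. After this rescaling the
  -- Gram forms converge to `Q₀`, which is positive definite since a field with zero value and zero
  -- derivative at `t` is zero.
  set T : ℝ → Λ →ₗ[ℝ] Λ := fun r ↦ (r - t)⁻¹ • p + (LinearMap.id - p) with hT
  set Q : ℝ → LinearMap.BilinForm ℝ Λ := fun r ↦ (gramForm ev r).compl₁₂ (T r) (T r) with hQ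
  set Q₀ : LinearMap.BilinForm ℝ Λ := (gramForm ev' t).compl₁₂ p p
    + (gramForm ev t).compl₁₂ (LinearMap.id - p) (LinearMap.id - p) with hQ₀
  have hQ₀x : ∀ x, Q₀ x x = ‖ev' t (p x)‖ ^ 2 + ‖ev t (x - p x)‖ ^ 2 := by
    intro x
    simp only [hQ₀, LinearMap.add_apply, LinearMap.compl₁₂_apply, gramForm_self,
      LinearMap.sub_apply, LinearMap.id_apply]
  have hQx : ∀ r x, Q r x x = ‖ev r (T r x)‖ ^ 2 := by
    intro r x
    simp only [hQ, LinearMap.compl₁₂_apply, gramForm_self]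
  have hev := eventually_le_of_tendsto_posDef (Q := Q) (Q₀ := Q₀)
    (l := 𝓝[Set.Icc α Real.pi \ {t}] t) (θ := θ) ?_ ?_ ?_ ?_ hθ
  · filter_upwards [hev, self_mem_nhdsWithin] with r hr hrs J
    have hrt : r - t ≠ 0 := sub_ne_zero.2 hrs.2
    have h1 := hr ((r - t) • p J + (J - p J))
    have h2 : T r ((r - t) • p J + (J - p J)) = J := by
      simp [hT, hpp, smul_smul, inv_mul_cancel₀ hrt]
    have h3 : p ((r - t) • p J + (J - p J)) = (r - t) • p J := by simp [hpp]
    rw [hQx, hQ₀x, h2, h3] at h1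
    rw [map_smul, norm_smul, mul_pow, Real.norm_eq_abs, sq_abs, add_sub_cancel_left] at h1
    exact h1
  · intro r x y
    simp only [hQ, LinearMap.compl₁₂_apply]
    rw [gramForm_symm]
  · intro x y
    simp only [hQ₀, LinearMap.add_apply, LinearMap.compl₁₂_apply]
    rw [gramForm_symm (t := t) (ev := ev'), gramForm_symm (t := t) (ev := ev)]
  · intro x
    have hsplit : ∀ r, Q r x x = inner ℝ (ev r (p x)) (ev r (p x)) / (r - t) ^ 2
        + 2 * (inner ℝ (ev r (p x)) (ev r (x - p x)) / (r - t))
        + inner ℝ (ev r (x - p x)) (ev r (x - p x)) := by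
      intro r
      have : T r x = (r - t)⁻¹ • p x + (x - p x) := by simp [hT]
      rw [hQx, this, map_add, map_smul, norm_add_sq_real, norm_smul, inner_smul_left, mul_pow,
        Real.norm_eq_abs, sq_abs, real_inner_self_eq_norm_sq, real_inner_self_eq_norm_sq]
      simp only [conj_trivial, div_eq_mul_inv, inv_pow]
      ring
    simp_rw [hsplit]
    rw [hQ₀x]
    have l1 : Filter.Tendsto (fun r ↦ inner ℝ (ev r (p x)) (ev r (p x)) / (r - t) ^ 2)
        (𝓝[Set.Icc α Real.pi \ {t}] t) (𝓝 (‖ev' t (p x)‖ ^ 2)) := by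
      rcases ht' with ht' | hinj
      · rw [nhdsWithin_Icc_diff_eq_nhdsNE ht']
        exact h.tendsto_norm_sq_div ht' (hp0 x)
      · simpa [hinj _ (hp0 x)] using tendsto_const_nhds
    -- The mixed term tends to `2 ⟨(p x)', x - p x⟩` at `t`. By self-adjointness the derivative can
    -- be moved off `p x`, which vanishes there.
    have l2 : Filter.Tendsto (fun r ↦ inner ℝ (ev r (p x)) (ev r (x - p x)) / (r - t))
        (𝓝[Set.Icc α Real.pi \ {t}] t) (𝓝 0) := by
      have hd := h.hasDeriv_inner t ht (p x) (x - p x)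
      rw [h.selfAdjoint t ht, hp0, inner_zero_left, mul_zero,
        hasDerivWithinAt_iff_tendsto_slope] at hd
      refine hd.congr fun r ↦ ?_
      rw [slope_def_field, hp0, inner_zero_left, sub_zero]
    have l3 : Filter.Tendsto (fun r ↦ inner ℝ (ev r (x - p x)) (ev r (x - p x)))
        (𝓝[Set.Icc α Real.pi \ {t}] t) (𝓝 (‖ev t (x - p x)‖ ^ 2)) := by
      rw [← real_inner_self_eq_norm_sq]
      exact (h.continuousOn_inner _ _ t ht).mono_left (nhdsWithin_mono _ Set.sdiff_subset)
    simpa using (l1.add (l2.const_mul 2)).add l3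
  · intro x hx
    rw [hQ₀x]
    by_contra! hle
    have h1 : ev' t (p x) = 0 := by
      rw [← norm_eq_zero]; nlinarith [sq_nonneg ‖ev t (x - p x)‖, sq_nonneg ‖ev' t (p x)‖]
    have h2 : ev t (x - p x) = 0 := by
      rw [← norm_eq_zero]; nlinarith [sq_nonneg ‖ev t (x - p x)‖, sq_nonneg ‖ev' t (p x)‖]
    have h3 := h.eq_zero t ht _ (hp0 x) h1
    rw [h3, sub_zero] at h2
    refine hx (h.eq_zero t ht x h2 ?_)
    rw [← hp1 x h2, h1]

/-- The parameters where some nonzero field of the family vanishes are isolated. -/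
theorem IsRiccatiFamily.eventually_injective [FiniteDimensional ℝ Λ]
    (h : IsRiccatiFamily α ev ev' ρ) (ht : t ∈ Set.Ioo α Real.pi) :
    ∀ᶠ r in 𝓝[≠] t, ∀ J, ev r J = 0 → J = 0 := by
  have ht1 := Set.Ioo_subset_Icc_self ht
  obtain ⟨p, hp0, hp1, hp⟩ := h.eventually_rescaled_le ht1 (Or.inl ht) (θ := 1 / 2) (by norm_num)
  rw [nhdsWithin_Icc_diff_eq_nhdsNE ht] at hp
  filter_upwards [hp, self_mem_nhdsWithin] with r hr hrt J hJ
  have h1 := hr J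
  rw [hJ, norm_zero] at h1
  have h2 : 0 < (r - t) ^ 2 := by
    have := sub_ne_zero.2 hrt
    positivity
  have h3 : ‖ev' t (p J)‖ ^ 2 = 0 := by
    have := mul_nonneg h2.le (sq_nonneg ‖ev' t (p J)‖)
    have : (r - t) ^ 2 * ‖ev' t (p J)‖ ^ 2 = 0 := by nlinarith [sq_nonneg ‖ev t (J - p J)‖]
    exact (mul_eq_zero.1 this).resolve_left h2.ne'
  have h4 : ‖ev t (J - p J)‖ ^ 2 = 0 := by rw [h3] at h1; nlinarith [sq_nonneg ‖ev t (J - p J)‖]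
  have h5 : p J = 0 := h.eq_zero t ht1 _ (hp0 J) (by simpa using h3)
  have h6 : ev t J = 0 := by simpa [h5] using h4
  rw [← hp1 J h6, h5]

/-- This is lower semicontinuity. For a competitor `J` at `r`, the part `p J` vanishes at `t` and is
killed by `lam`, so `J - p J` is a competitor at `t`. The rescaled estimate bounds `‖ev r J‖` below
in terms of it, uniformly in `J`. -/
theorem IsRiccatiFamily.eventually_minNorm_le [FiniteDimensional ℝ Λ]
    (h : IsRiccatiFamily α ev ev' ρ) (hlam : lam ≠ 0) (ht : t ∈ Set.Icc α Real.pi)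
    (ht' : t ∈ Set.Ioo α Real.pi ∨ ∀ J, ev t J = 0 → J = 0)
    (hker : ∀ J, ev t J = 0 → lam J = 0) {θ : ℝ} (hθ : θ < 1) (hθ0 : 0 ≤ θ) :
    ∀ᶠ r in 𝓝[Set.Icc α Real.pi] t, θ * minNorm ev lam t ^ 2 ≤ minNorm ev lam r ^ 2 := by
  obtain ⟨p, hp0, hp1, hp⟩ := h.eventually_rescaled_le ht ht' hθ
  rw [eventually_nhdsWithin_iff] at hp ⊢
  filter_upwards [hp] with r hr hrs
  rcases eq_or_ne r t with rfl | hne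
  · nlinarith [sq_nonneg (minNorm ev lam r)]
  obtain ⟨J₀, hJ₀⟩ := exists_apply_eq_one hlam
  have key : √(θ * minNorm ev lam t ^ 2) ≤ minNorm ev lam r := by
    refine le_csInf ⟨_, J₀, hJ₀, rfl⟩ ?_
    rintro _ ⟨J, hJ, rfl⟩
    rw [Real.sqrt_le_left (norm_nonneg _)]
    refine le_trans ?_ (hr ⟨hrs, hne⟩ J)
    have h1 : minNorm ev lam t ≤ ‖ev t (J - p J)‖ :=
      minNorm_le (by rw [map_sub, hker _ (hp0 J), sub_zero]; exact hJ)
    have h2 := pow_le_pow_left₀ minNorm_nonneg h1 2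
    have h3 : 0 ≤ (r - t) ^ 2 * ‖ev' t (p J)‖ ^ 2 := by positivity
    exact mul_le_mul_of_nonneg_left (by linarith) hθ0
  rwa [Real.sqrt_le_left minNorm_nonneg] at key

/-- Upper semicontinuity holds because a minimizer at `t` remains a competitor nearby. Lower
semicontinuity is `eventually_minNorm_le` with `θ` close to `1`. -/
theorem IsRiccatiFamily.continuousWithinAt_minNorm [FiniteDimensional ℝ Λ]
    (h : IsRiccatiFamily α ev ev' ρ) (hlam : lam ≠ 0) (ht : t ∈ Set.Icc α Real.pi)
    (ht' : t ∈ Set.Ioo α Real.pi ∨ ∀ J, ev t J = 0 → J = 0)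
    (hker : ∀ J, ev t J = 0 → lam J = 0) :
    ContinuousWithinAt (minNorm ev lam) (Set.Icc α Real.pi) t := by
  obtain ⟨J, K, a, hJ, -, -⟩ := h.exists_minimizer hlam ht hker
  have hpos := hJ.minNorm_pos hker
  have hsq : ContinuousWithinAt (fun r ↦ minNorm ev lam r ^ 2) (Set.Icc α Real.pi) t := by
    refine tendsto_order.2 ⟨fun y hy ↦ ?_, fun y hy ↦ ?_⟩
    · have hlt : y / minNorm ev lam t ^ 2 < 1 := by rwa [div_lt_one (by positivity)]
      obtain ⟨θ, h1, h2⟩ := exists_between (max_lt hlt one_pos)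
      have h3 : 0 ≤ θ := (le_max_right _ _).trans h1.le
      have h4 : y < θ * minNorm ev lam t ^ 2 := by
        rw [← div_lt_iff₀ (by positivity)]
        exact (le_max_left _ _).trans_lt h1
      exact (h.eventually_minNorm_le hlam ht ht' hker h2 h3).mono fun r hr ↦ h4.trans_le hr
    · have h1 := h.continuousOn_inner J J t ht
      beta_reduce at hy
      rw [hJ.minNorm_eq, ← real_inner_self_eq_norm_sq] at hy
      filter_upwards [h1.eventually (gt_mem_nhds hy)] with r hr
      rw [real_inner_self_eq_norm_sq] at hr
      exact (pow_le_pow_left₀ minNorm_nonneg (minNorm_le hJ.1) 2).trans_lt hr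
  have := hsq.sqrt
  simpa only [Real.sqrt_sq minNorm_nonneg] using this

/-- If the Riccati operator is at most `cot α` at `α`, the minimal norm is a multiple of the
sine. -/
theorem IsRiccatiFamily.minNorm_eq_const_mul_sin [FiniteDimensional ℝ Λ]
    (h : IsRiccatiFamily α ev ev' ρ) (hα : α ∈ Set.Ico 0 Real.pi)
    (hleft : 0 < α → (∀ J, ev α J = 0 → J = 0) ∧
      ∀ J, inner ℝ (ev' α J) (ev α J) ≤ Real.cot α * ‖ev α J‖ ^ 2)
    (hlam : lam ≠ 0) (hker : ∀ t ∈ Set.Ioo α Real.pi, ∀ J, ev t J = 0 → lam J = 0) :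
    ∃ c : ℝ, ∀ t ∈ Set.Ioo α Real.pi, minNorm ev lam t = c * Real.sin t := by
  have hpos : ∀ t ∈ Set.Icc α Real.pi, (∀ J, ev t J = 0 → lam J = 0) → 0 < minNorm ev lam t := by
    intro t ht hk
    obtain ⟨J, K, a, hJ, -, -⟩ := h.exists_minimizer hlam ht hk
    exact hJ.minNorm_pos hk
  refine eq_const_mul_sin_of_barrier hα ?_ ?_ ?_ ?_
  · intro t ht
    exact (h.continuousWithinAt_minNorm hlam (Set.Ioo_subset_Icc_self ht) (Or.inl ht)
      (hker t ht)).mono Set.Ioo_subset_Icc_self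
  · exact fun t ht ↦ hpos t (Set.Ioo_subset_Icc_self ht) (hker t ht)
  · intro t ht
    have ht1 := Set.Ioo_subset_Icc_self ht
    obtain ⟨J, K, a, hJ, hK, ha⟩ := h.exists_minimizer hlam ht1 (hker t ht)
    obtain ⟨g, g', h1, h2, h3, h4, h5⟩ := h.exists_barrier ht hJ hK ha
    refine ⟨g, g', a, _, Filter.Eventually.of_forall h1, h2, h3, h4, h5, ?_⟩
    have := h.le_curv t ht1 J
    rw [← hJ.minNorm_eq] at this
    nlinarith [sq_nonneg ‖ev t K‖]
  · intro h0
    obtain ⟨hinj, hcot⟩ := hleft h0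
    have hα1 : α ∈ Set.Icc α Real.pi := Set.left_mem_Icc.2 hα.2.le
    have hk : ∀ J, ev α J = 0 → lam J = 0 := fun J hJ ↦ by rw [hinj J hJ, map_zero]
    refine ⟨h.continuousWithinAt_minNorm hlam hα1 (Or.inr hinj) hk, ?_⟩
    obtain ⟨J, K, a, hJ, -, -⟩ := h.exists_minimizer hlam hα1 hk
    have hp := hpos α hα1 hk
    rw [hJ.minNorm_eq] at hp
    -- The norm of a minimizer `J` at `α` is an upper barrier. Its slope there is `⟨J', J⟩ / ‖J‖`,
    -- which the bound on the Riccati operator controls.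
    refine ⟨fun r ↦ √(inner ℝ (ev r J) (ev r J)), _, fun r _ ↦ ?_, ?_,
      (h.hasDeriv_inner α hα1 J J).sqrt ?_, ?_⟩
    · beta_reduce
      rw [real_inner_self_eq_norm_sq, Real.sqrt_sq (norm_nonneg _)]
      exact minNorm_le hJ.1
    · beta_reduce
      rw [real_inner_self_eq_norm_sq, Real.sqrt_sq (norm_nonneg _), hJ.minNorm_eq]
    · rw [real_inner_self_eq_norm_sq]; positivity
    · rw [real_inner_self_eq_norm_sq, Real.sqrt_sq (norm_nonneg _), hJ.minNorm_eq,
        div_le_iff₀ (by positivity)]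
      nlinarith [hcot J]

end Family

/-! ### The equality case: the minimizer does not depend on the parameter -/

section Family

variable {Λ : Type*} [AddCommGroup Λ] [Module ℝ Λ] {V : ℝ → Type*}
  [∀ t, NormedAddCommGroup (V t)] [∀ t, InnerProductSpace ℝ (V t)]
  {α : ℝ} {ev ev' : ∀ t, Λ →ₗ[ℝ] V t} {ρ : ℝ → Λ → Λ → ℝ} {lam : Λ →ₗ[ℝ] ℝ} {t : ℝ}

/-- Near a parameter where no nonzero field of the family vanishes, the Riccati operator is
bounded. -/
theorem IsRiccatiFamily.eventually_abs_inner_le [FiniteDimensional ℝ Λ]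
    (h : IsRiccatiFamily α ev ev' ρ) (ht : t ∈ Set.Ioo α Real.pi)
    (hinj : ∀ J, ev t J = 0 → J = 0) :
    ∃ C, ∀ᶠ r in 𝓝 t, (∀ J, |inner ℝ (ev' r J) (ev r J)| ≤ C * ‖ev r J‖ ^ 2) ∧
      ∀ J, ev r J = 0 → J = 0 := by
  have hIcc : Set.Icc α Real.pi ∈ 𝓝 t := Icc_mem_nhds ht.1 ht.2
  set A : ℝ → LinearMap.BilinForm ℝ Λ := fun r ↦ (innerₗ (V r)).compl₁₂ (ev' r) (ev r)
    + (innerₗ (V r)).compl₁₂ (ev r) (ev' r) with hA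
  have hAapply : ∀ r x y, A r x y = inner ℝ (ev' r x) (ev r y) + inner ℝ (ev r x) (ev' r y) := by
    intro r x y; simp [hA]
  have hAx : ∀ r x, A r x x = 2 * inner ℝ (ev' r x) (ev r x) := by
    intro r x
    rw [hAapply, real_inner_comm (ev' r x)]; ring
  -- The form `A` is the derivative of the Gram form. Since `Q (r, ε)` tends to a positive definite
  -- form as `(r, ε)` tends to `(t, 0)`, it is positive semidefinite for a fixed small `ε` of either
  -- sign and all `r` near `t`. This is the two-sided bound.
  set Q : ℝ × ℝ → LinearMap.BilinForm ℝ Λ := fun z ↦ gramForm ev z.1 - z.2 • A z.1 with hQ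
  have hQx : ∀ z x, Q z x x = inner ℝ (ev z.1 x) (ev z.1 x)
      - z.2 * (2 * inner ℝ (ev' z.1 x) (ev z.1 x)) := by
    intro z x
    simp [hQ, gramForm_apply, hAx]
  have hev := eventually_le_of_tendsto_posDef (Q := Q) (Q₀ := gramForm ev t)
    (l := 𝓝 t ×ˢ 𝓝 0) (θ := 1 / 2) ?_ (fun x y ↦ gramForm_symm x y) ?_ ?_ (by norm_num)
  · obtain ⟨p, hp, q, hq, hpq⟩ := Filter.eventually_prod_iff.1 hev
    obtain ⟨ε, hε, hball⟩ := Metric.eventually_nhds_iff.1 hq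
    have hq1 : q (ε / 2) := hball (by simp [abs_of_pos hε, hε])
    have hq2 : q (-(ε / 2)) := hball (by simp [abs_of_pos hε, hε])
    refine ⟨1 / ε, hp.mono fun r hr ↦ ⟨fun J ↦ ?_, fun J hJ ↦ ?_⟩⟩
    · have h1 := hpq hr hq1 J
      have h2 := hpq hr hq2 J
      rw [hQx, gramForm_self, real_inner_self_eq_norm_sq] at h1 h2
      rw [one_div, ← div_eq_inv_mul, le_div_iff₀ hε, ← abs_of_pos hε, ← abs_mul, abs_le]
      constructor <;> nlinarith [sq_nonneg ‖ev t J‖]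
    · have h1 := hpq hr hq1 J
      rw [hQx, gramForm_self, hJ] at h1
      simp only [inner_zero_right, mul_zero, sub_zero] at h1
      apply hinj
      rw [← norm_eq_zero]
      nlinarith [sq_nonneg ‖ev t J‖]
  · intro z x y
    simp only [hQ, LinearMap.sub_apply, LinearMap.smul_apply, hAapply]
    rw [gramForm_symm, real_inner_comm (ev z.1 y), real_inner_comm (ev' z.1 y)]
    ring_nf
  · intro x
    simp_rw [hQx, gramForm_apply]
    have h1 : Filter.Tendsto (fun z : ℝ × ℝ ↦ inner ℝ (ev z.1 x) (ev z.1 x)) (𝓝 t ×ˢ 𝓝 0)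
        (𝓝 (inner ℝ (ev t x) (ev t x))) :=
      ((h.continuousOn_inner x x).continuousAt hIcc).tendsto.comp Filter.tendsto_fst
    have h2 : Filter.Tendsto (fun z : ℝ × ℝ ↦ inner ℝ (ev' z.1 x) (ev z.1 x)) (𝓝 t ×ˢ 𝓝 0)
        (𝓝 (inner ℝ (ev' t x) (ev t x))) :=
      ((h.continuousOn_inner' x x).continuousAt hIcc).tendsto.comp Filter.tendsto_fst
    have h3 : Filter.Tendsto (fun z : ℝ × ℝ ↦ z.2) (𝓝 t ×ˢ 𝓝 (0 : ℝ)) (𝓝 0) :=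
      Filter.tendsto_snd
    simpa using h1.sub (h3.mul (h2.const_mul 2))
  · intro x hx
    rw [gramForm_self]
    have : ev t x ≠ 0 := fun h0 ↦ hx (hinj x h0)
    positivity

/-- `J` minimizes the norm at `t`, and its derivative there is that of `sin • E` with `E`
parallel. -/
def IsRigidAt (ev ev' : ∀ t, Λ →ₗ[ℝ] V t) (lam : Λ →ₗ[ℝ] ℝ) (t : ℝ) (J : Λ) : Prop :=
  IsMinimizer ev lam t J ∧ ev' t J = Real.cot t • ev t J

/-- Minimizers have the same value at `t`, and rigidity then fixes the derivative. No injectivity of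
`ev t` is needed. -/
theorem IsRiccatiFamily.isRigidAt_unique (h : IsRiccatiFamily α ev ev' ρ)
    (ht : t ∈ Set.Icc α Real.pi) {J K : Λ} (hJ : IsRigidAt ev ev' lam t J)
    (hK : IsRigidAt ev ev' lam t K) : J = K := by
  have h1 := hJ.1.ev_eq hK.1
  rw [← sub_eq_zero]
  refine h.eq_zero t ht _ (by rw [map_sub, h1, sub_self]) ?_
  rw [map_sub, hJ.2, hK.2, h1, sub_self]

/-- Equality in the barrier estimate. Since `minNorm` equals `c * sin`, the square of the latter
touches the barrier from below. The first derivatives give `a = cot t`. The second leave no room for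
the term `-6 ‖K‖ ^ 2`, so `K` vanishes at `t`. -/
theorem IsRiccatiFamily.exists_isRigidAt [FiniteDimensional ℝ Λ]
    (h : IsRiccatiFamily α ev ev' ρ) (hα : 0 ≤ α) (hlam : lam ≠ 0)
    (hker : ∀ t ∈ Set.Ioo α Real.pi, ∀ J, ev t J = 0 → lam J = 0) {c : ℝ}
    (hc : ∀ t ∈ Set.Ioo α Real.pi, minNorm ev lam t = c * Real.sin t)
    (ht : t ∈ Set.Ioo α Real.pi) : ∃ J, IsRigidAt ev ev' lam t J := by
  have ht1 := Set.Ioo_subset_Icc_self ht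
  have hsin : 0 < Real.sin t := Real.sin_pos_of_pos_of_lt_pi (hα.trans_lt ht.1) ht.2
  obtain ⟨J, K, a, hJ, hK, ha⟩ := h.exists_minimizer hlam ht1 (hker t ht)
  have hpos := hJ.minNorm_pos (hker t ht)
  obtain ⟨g, g', h1, h2, h3, h4, h5⟩ := h.exists_barrier ht hJ hK ha
  have hcurv := h.le_curv t ht1 J
  rw [← hJ.minNorm_eq] at hcurv
  obtain ⟨e1, e2⟩ := sq_touches_from_below (η := fun r ↦ c * Real.sin r)
    (η' := fun r ↦ c * Real.cos r) (e := c * -Real.sin t)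
    (by
      filter_upwards [Ioo_mem_nhds ht.1 ht.2] with r hr
      rw [← hc r hr]; exact h1 r)
    (by rw [h2, hc t ht]) h3 h4
    (Filter.Eventually.of_forall fun r ↦ (Real.hasDerivAt_sin r).const_mul c)
    ((Real.hasDerivAt_cos t).const_mul c)
  rw [hc t ht] at h5 e2 hcurv hpos
  have hc0 : c ≠ 0 := by rintro rfl; simp at hpos
  have ha' : a = Real.cot t := by
    rw [h5] at e1
    rw [Real.cot_eq_cos_div_sin, eq_div_iff hsin.ne']
    have : (2 * c ^ 2 * Real.sin t) * (a * Real.sin t) = (2 * c ^ 2 * Real.sin t) * Real.cos t := by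
      linarith
    exact mul_left_cancel₀ (by positivity) this
  have has : a * Real.sin t = Real.cos t := by
    rw [ha', Real.cot_eq_cos_div_sin, div_mul_cancel₀ _ hsin.ne']
  have hK0 : ev t K = 0 := by
    rw [← norm_eq_zero]
    have h7 : a ^ 2 * (c * Real.sin t) ^ 2 = (c * Real.cos t) ^ 2 := by rw [← has]; ring
    nlinarith [sq_nonneg ‖ev t K‖]
  exact ⟨J, hJ, by rw [ha, hK0, add_zero, ha']⟩

/-- A Grönwall argument that needs no regularity of `F`. For fixed `a` the smooth function `d = ‖F
a‖ ^ 2 - (c sin) ^ 2` equals `‖F a - F r‖ ^ 2` at `r`, by Pythagoras for the minimizer `F r`.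
Rigidity and self-adjointness remove the cross terms, so with `D = F a - F r` its derivative is `2
⟨D', D⟩`, and the bounded Riccati operator gives `|d'| ≤ 2 C d`. Hence `d = 0`. -/
theorem IsRiccatiFamily.isRigidAt_eventually_of_injective [FiniteDimensional ℝ Λ]
    (h : IsRiccatiFamily α ev ev' ρ) (hα : 0 ≤ α) {c : ℝ}
    (hc : ∀ t ∈ Set.Ioo α Real.pi, minNorm ev lam t = c * Real.sin t)
    {F : ℝ → Λ} (hF : ∀ t ∈ Set.Ioo α Real.pi, IsRigidAt ev ev' lam t (F t))
    (ht : t ∈ Set.Ioo α Real.pi) (hinj : ∀ J, ev t J = 0 → J = 0) :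
    ∀ᶠ r in 𝓝 t, F r = F t := by
  obtain ⟨C, hC⟩ := h.eventually_abs_inner_le ht hinj
  obtain ⟨ε, hε, hball⟩ := Metric.eventually_nhds_iff_ball.1
    (hC.and (Ioo_mem_nhds ht.1 ht.2 : ∀ᶠ r in 𝓝 t, r ∈ Set.Ioo α Real.pi))
  -- forward uniqueness on the ball
  have hfwd : ∀ a ∈ Metric.ball t ε, ∀ b ∈ Metric.ball t ε, a ≤ b → F b = F a := by
    intro a ha b hb hab
    have hsub : Set.Icc a b ⊆ Metric.ball t ε := by
      have := (convex_ball t ε).ordConnected.out ha hb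
      exact this
    set d : ℝ → ℝ := fun r ↦ inner ℝ (ev r (F a)) (ev r (F a)) - (c * Real.sin r) ^ 2 with hd
    have hF1 : ∀ r ∈ Set.Icc a b, lam (F r) = 1 := fun r hr ↦ (hF r (hball r (hsub hr)).2).1.1
    have haa : lam (F a) = 1 := hF1 a ⟨le_rfl, hab⟩
    have hd1 : ∀ r ∈ Set.Icc a b, d r = ‖ev r (F a - F r)‖ ^ 2 := by
      intro r hr
      have hr1 := (hball r (hsub hr)).2
      have h1 := (hF r hr1).1.norm_sq haa
      rw [← (hF r hr1).1.minNorm_eq, hc r hr1] at h1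
      simp only [hd, real_inner_self_eq_norm_sq]; linarith
    have hd2 : ∀ r ∈ Set.Icc a b,
        HasDerivAt d (2 * inner ℝ (ev' r (F a - F r)) (ev r (F a - F r))) r := by
      intro r hr
      have hr1 := (hball r (hsub hr)).2
      have hsin : 0 < Real.sin r := Real.sin_pos_of_pos_of_lt_pi (hα.trans_lt hr1.1) hr1.2
      have h1 : HasDerivAt d (2 * inner ℝ (ev' r (F a)) (ev r (F a))
          - 2 * (c * Real.sin r) * (c * Real.cos r)) r :=
        ((h.hasDerivAt_inner hr1 (F a) (F a)).sub
          (((Real.hasDerivAt_sin r).const_mul c).pow 2)).congr_deriv (by simp)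
      refine h1.congr_deriv ?_
      obtain ⟨⟨hm1, hm2⟩, hm3⟩ := hF r hr1
      have horth : inner ℝ (ev r (F r)) (ev r (F a - F r)) = 0 := hm2 _ (by simp [hm1, haa])
      have hself := h.selfAdjoint r (Set.Ioo_subset_Icc_self hr1) (F a - F r) (F r)
      have hnorm : inner ℝ (ev r (F r)) (ev r (F r)) = (c * Real.sin r) ^ 2 := by
        rw [real_inner_self_eq_norm_sq, ← hc r hr1, (hF r hr1).1.minNorm_eq]
      have e1 : ev r (F a) = ev r (F r) + ev r (F a - F r) := by simp
      have e2 : ev' r (F a) = ev' r (F r) + ev' r (F a - F r) := by simp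
      have hcot : Real.cot r * (c * Real.sin r) ^ 2 = c * Real.sin r * (c * Real.cos r) := by
        rw [Real.cot_eq_cos_div_sin]; field_simp
      rw [e1, e2]
      simp only [inner_add_left, inner_add_right]
      rw [hself, hm3]
      simp only [inner_smul_left, inner_smul_right, horth, hnorm, conj_trivial]
      rw [real_inner_comm, horth, hcot]
      ring
    have hzero := eq_zero_of_abs_deriv_le_mul_abs_self_of_eq_zero_right (f := d) (K := 2 * C)
      (a := a) (b := b) (fun r hr ↦ (hd2 r hr).continuousAt.continuousWithinAt)
      (fun r hr ↦ (hd2 r (Set.Ico_subset_Icc_self hr)).hasDerivWithinAt)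
      (by rw [hd1 a ⟨le_rfl, hab⟩]; simp)
      (by
        intro r hr
        have hr' := Set.Ico_subset_Icc_self hr
        rw [hd1 r hr']
        have := (hball r (hsub hr')).1.1 (F a - F r)
        rw [Real.norm_eq_abs, Real.norm_eq_abs, abs_mul, abs_two,
          abs_of_nonneg (sq_nonneg ‖ev r (F a - F r)‖)]
        linarith) b ⟨hab, le_rfl⟩
    rw [hd1 b ⟨hab, le_rfl⟩] at hzero
    have h0 : ev b (F a - F b) = 0 := by simpa using hzero
    have := (hball b hb).1.2 _ h0
    exact (sub_eq_zero.1 this).symm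
  filter_upwards [Metric.ball_mem_nhds t hε] with r hr
  have htb := Metric.mem_ball_self (x := t) hε
  rcases le_total t r with hle | hle
  · exact hfwd t htb r hr hle
  · exact (hfwd r hr t htb hle).symm

/-- A field that is rigid at parameters accumulating at `t` is rigid at `t`. -/
theorem IsRiccatiFamily.isRigidAt_of_frequently (h : IsRiccatiFamily α ev ev' ρ) (hα : 0 ≤ α)
    (ht : t ∈ Set.Ioo α Real.pi) {J : Λ} (hJ : ∃ᶠ r in 𝓝 t, IsRigidAt ev ev' lam r J) :
    IsRigidAt ev ev' lam t J := by
  have hIcc : Set.Icc α Real.pi ∈ 𝓝 t := Icc_mem_nhds ht.1 ht.2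
  have hsin : Real.sin t ≠ 0 :=
    (Real.sin_pos_of_pos_of_lt_pi (hα.trans_lt ht.1) ht.2).ne'
  have key : ∀ f : ℝ → ℝ, ContinuousAt f t →
      (∀ r, Real.sin r ≠ 0 → IsRigidAt ev ev' lam r J → f r = 0) → f t = 0 := by
    intro f hf hfr
    by_contra hne
    obtain ⟨r, h1, h2, h3⟩ := (hJ.and_eventually ((hf.eventually_ne hne).and
      (Real.continuous_sin.continuousAt.eventually_ne hsin))).exists
    exact h2 (hfr r h3 h1)
  have hGc := fun J K ↦ (h.continuousOn_inner J K).continuousAt hIcc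
  have hAc := fun J K ↦ (h.continuousOn_inner' J K).continuousAt hIcc
  refine ⟨⟨?_, fun L hL ↦ ?_⟩, ?_⟩
  · obtain ⟨r, hr⟩ := hJ.exists
    exact hr.1.1
  · exact key _ (hGc J L) fun r _ hr ↦ hr.1.2 L hL
  -- The relation `J' = cot • J` is encoded as the vanishing of a scalar, since only norms and inner
  -- products are known to be continuous in `r`.
  · have hsub : ∀ r, ‖Real.sin r • ev' r J - Real.cos r • ev r J‖ ^ 2 =
        Real.sin r ^ 2 * ‖ev' r J‖ ^ 2 - 2 * (Real.sin r * Real.cos r * inner ℝ (ev' r J) (ev r J))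
          + Real.cos r ^ 2 * inner ℝ (ev r J) (ev r J) := by
      intro r
      rw [norm_sub_sq_real, norm_smul, norm_smul, inner_smul_left, inner_smul_right, mul_pow,
        mul_pow, Real.norm_eq_abs, Real.norm_eq_abs, sq_abs, sq_abs, real_inner_self_eq_norm_sq]
      simp only [conj_trivial]
      ring
    have h0 : ‖Real.sin t • ev' t J - Real.cos t • ev t J‖ ^ 2 = 0 := by
      rw [hsub]
      refine key (fun r ↦ Real.sin r ^ 2 * ‖ev' r J‖ ^ 2
        - 2 * (Real.sin r * Real.cos r * inner ℝ (ev' r J) (ev r J))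
          + Real.cos r ^ 2 * inner ℝ (ev r J) (ev r J)) ?_ ?_
      · have hc1 := (h.continuous_norm' J).continuousAt hIcc
        have hs := Real.continuous_sin.continuousAt (x := t)
        have hco := Real.continuous_cos.continuousAt (x := t)
        exact (((hs.pow 2).mul hc1).sub (((hs.mul hco).mul (hAc J J)).const_mul 2)).add
          ((hco.pow 2).mul (hGc J J))
      · intro r hr0 hr
        rw [← hsub, hr.2, smul_smul, Real.cot_eq_cos_div_sin, mul_div_cancel₀ _ hr0, sub_self]
        simp
    have h1 : Real.sin t • ev' t J = Real.cos t • ev t J := by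
      rw [← sub_eq_zero, ← norm_eq_zero]; simpa using h0
    rw [Real.cot_eq_cos_div_sin, div_eq_inv_mul, ← smul_smul, ← h1, smul_smul,
      inv_mul_cancel₀ hsin, one_smul]

/-- The rigidity part of the comparison: a linear form that vanishes on the fields with a zero in
`(α, π)` takes the value `1` on a field whose logarithmic derivative is the cotangent. -/
theorem IsRiccatiFamily.exists_cot [FiniteDimensional ℝ Λ]
    (h : IsRiccatiFamily α ev ev' ρ) (hα : α ∈ Set.Ico 0 Real.pi)
    (hleft : 0 < α → (∀ J, ev α J = 0 → J = 0) ∧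
      ∀ J, inner ℝ (ev' α J) (ev α J) ≤ Real.cot α * ‖ev α J‖ ^ 2)
    (hlam : lam ≠ 0) (hker : ∀ t ∈ Set.Ioo α Real.pi, ∀ J, ev t J = 0 → lam J = 0) :
    ∃ J, lam J = 1 ∧ ∀ t ∈ Set.Ioo α Real.pi, ev' t J = Real.cot t • ev t J := by
  obtain ⟨c, hc⟩ := h.minNorm_eq_const_mul_sin hα hleft hlam hker
  have hex : ∀ t, ∃ J, t ∈ Set.Ioo α Real.pi → IsRigidAt ev ev' lam t J := by
    intro t
    by_cases ht : t ∈ Set.Ioo α Real.pi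
    · obtain ⟨J, hJ⟩ := h.exists_isRigidAt hα.1 hlam hker hc ht
      exact ⟨J, fun _ ↦ hJ⟩
    · exact ⟨0, fun h ↦ absurd h ht⟩
  choose F hF using hex
  have hconst : ∀ s : Set ℝ, IsPreconnected s → (∀ t ∈ s, ∀ᶠ r in 𝓝 t, F r = F t) →
      ∀ a ∈ s, ∀ b ∈ s, F a = F b := by
    intro s hs hloc a ha b hb
    -- Local constancy is continuity into the discrete space `Λ`.
    let _ : TopologicalSpace Λ := ⊥
    have _ : DiscreteTopology Λ := ⟨rfl⟩
    refine hs.constant (f := F) (fun t ht ↦ ?_) ha hb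
    rw [ContinuousWithinAt, nhds_discrete, Filter.tendsto_pure]
    exact mem_nhdsWithin_of_mem_nhds (hloc t ht)
  have hloc : ∀ t ∈ Set.Ioo α Real.pi, ∀ᶠ r in 𝓝 t, F r = F t := by
    intro t ht
    have hnear := (h.eventually_injective ht).and
      (mem_nhdsWithin_of_mem_nhds (Ioo_mem_nhds ht.1 ht.2) : ∀ᶠ r in 𝓝[≠] t, r ∈ Set.Ioo α Real.pi)
    rw [eventually_nhdsWithin_iff] at hnear
    obtain ⟨ε, hε, hball⟩ := Metric.eventually_nhds_iff_ball.1 hnear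
    -- On either side of `t` evaluation is injective, so `F` is constant there. Its value is rigid
    -- at points accumulating at `t`, hence at `t`, and so agrees with `F t`.
    have hside : ∀ s : Set ℝ, IsPreconnected s → s ⊆ Metric.ball t ε → t ∉ s →
        (∃ᶠ r in 𝓝 t, r ∈ s) → ∀ r ∈ s, F r = F t := by
      intro s hs hsb hts hfreq r hr
      have hne : ∀ x ∈ s, x ≠ t := fun x hx h0 ↦ hts (h0 ▸ hx)
      have hcs := hconst s hs (fun x hx ↦ h.isRigidAt_eventually_of_injective hα.1 hc hF
        (hball x (hsb hx) (hne x hx)).2 (hball x (hsb hx) (hne x hx)).1)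
      have hrig : IsRigidAt ev ev' lam t (F r) := h.isRigidAt_of_frequently hα.1 ht
        (hfreq.mono fun x hx ↦ hcs x hx r hr ▸ hF x (hball x (hsb hx) (hne x hx)).2)
      exact h.isRigidAt_unique (Set.Ioo_subset_Icc_self ht) hrig (hF t ht)
    have hR := hside (Set.Ioo t (t + ε)) isPreconnected_Ioo
      (fun x hx ↦ by rw [Real.ball_eq_Ioo]; exact ⟨by linarith [hx.1], hx.2⟩) (by simp)
      (by
        have : ∀ᶠ r in 𝓝[>] t, r ∈ Set.Ioo t (t + ε) := Ioo_mem_nhdsGT (by linarith)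
        exact this.frequently.filter_mono nhdsWithin_le_nhds)
    have hL := hside (Set.Ioo (t - ε) t) isPreconnected_Ioo
      (fun x hx ↦ by rw [Real.ball_eq_Ioo]; exact ⟨hx.1, by linarith [hx.2]⟩) (by simp)
      (by
        have : ∀ᶠ r in 𝓝[<] t, r ∈ Set.Ioo (t - ε) t := Ioo_mem_nhdsLT (by linarith)
        exact this.frequently.filter_mono nhdsWithin_le_nhds)
    filter_upwards [Ioo_mem_nhds (show t - ε < t by linarith) (show t < t + ε by linarith)] with r hr
    rcases lt_trichotomy r t with h1 | h1 | h1
    · exact hL r ⟨hr.1, h1⟩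
    · rw [h1]
    · exact hR r ⟨h1, hr.2⟩
  have hall := hconst _ isPreconnected_Ioo hloc
  obtain ⟨m, hm⟩ := Set.nonempty_Ioo.2 hα.2
  exact ⟨F m, (hF m hm).1.1, fun t ht ↦ by rw [hall m hm t ht]; exact (hF t ht).2⟩

end Family

/-! ### Vector fields with constant coefficients in a chart -/

section Geometry

variable {E : Type*} [NormedAddCommGroup E] [NormedSpace ℝ E]
  {H : Type*} [TopologicalSpace H] {I : ModelWithCorners ℝ E H}
  {M : Type*} [TopologicalSpace M] [ChartedSpace H M] [IsManifold I ∞ M]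

/-- The open set on which the chart at `x₀` gives coordinates on the tangent bundle. -/
def chartDom (I : ModelWithCorners ℝ E H) [IsManifold I ∞ M] (x₀ : M) : Set M :=
  (trivializationAt E (TangentSpace I) x₀).baseSet

/-- The vector field with constant coefficients `a` in the chart at `x₀`. -/
def constField (I : ModelWithCorners ℝ E H) [IsManifold I ∞ M] (x₀ : M) (a : E) (y : M) :
    TangentSpace I y :=
  (trivializationAt E (TangentSpace I) x₀).symm y a

/-- The coefficients of a tangent vector in the chart at `x₀`. -/
def chartCoord (I : ModelWithCorners ℝ E H) [IsManifold I ∞ M] (x₀ y : M) (v : TangentSpace I y) :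
    E :=
  (trivializationAt E (TangentSpace I) x₀ ⟨y, v⟩).2

variable {x₀ x y : M}

theorem isOpen_chartDom : IsOpen (chartDom I x₀) :=
  (trivializationAt E (TangentSpace I) x₀).open_baseSet

theorem mem_chartDom_self : x₀ ∈ chartDom I x₀ :=
  FiberBundle.mem_baseSet_trivializationAt' x₀

theorem chartDom_mem_nhds (hy : y ∈ chartDom I x₀) : chartDom I x₀ ∈ 𝓝 y :=
  isOpen_chartDom.mem_nhds hy

theorem constField_eq_symmL (hy : y ∈ chartDom I x₀) (a : E) :
    constField I x₀ a y = (trivializationAt E (TangentSpace I) x₀).symmL ℝ y a :=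
  (Trivialization.symmL_apply (R := ℝ) _ hy a).symm

theorem chartCoord_eq_continuousLinearMapAt (hy : y ∈ chartDom I x₀) (v : TangentSpace I y) :
    chartCoord I x₀ y v = (trivializationAt E (TangentSpace I) x₀).continuousLinearMapAt ℝ y v := by
  rw [Trivialization.continuousLinearMapAt_apply, Trivialization.coe_linearMapAt_of_mem _ hy]
  rfl

@[simp]
theorem chartCoord_constField (hy : y ∈ chartDom I x₀) (a : E) :
    chartCoord I x₀ y (constField I x₀ a y) = a := by
  rw [constField_eq_symmL hy, chartCoord_eq_continuousLinearMapAt hy,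
    Trivialization.continuousLinearMapAt_symmL _ hy]

@[simp]
theorem constField_chartCoord (hy : y ∈ chartDom I x₀) (v : TangentSpace I y) :
    constField I x₀ (chartCoord I x₀ y v) y = v := by
  rw [constField_eq_symmL hy, chartCoord_eq_continuousLinearMapAt hy,
    Trivialization.symmL_continuousLinearMapAt _ hy]

theorem extend_eq_constField (v : TangentSpace I x) :
    extend E v = constField I x (chartCoord I x x v) := rfl

theorem constField_add (hy : y ∈ chartDom I x₀) (a b : E) :
    constField I x₀ (a + b) y = constField I x₀ a y + constField I x₀ b y := by
  simp [constField_eq_symmL hy]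

theorem constField_smul (hy : y ∈ chartDom I x₀) (c : ℝ) (a : E) :
    constField I x₀ (c • a) y = c • constField I x₀ a y := by
  simp [constField_eq_symmL hy]

theorem constField_sum {ι : Type*} (s : Finset ι) (hy : y ∈ chartDom I x₀) (a : ι → E) :
    constField I x₀ (∑ i ∈ s, a i) y = ∑ i ∈ s, constField I x₀ (a i) y := by
  simp [constField_eq_symmL hy]

theorem chartCoord_add (hy : y ∈ chartDom I x₀) (v w : TangentSpace I y) :
    chartCoord I x₀ y (v + w) = chartCoord I x₀ y v + chartCoord I x₀ y w := by
  simp [chartCoord_eq_continuousLinearMapAt hy]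

theorem chartCoord_smul (hy : y ∈ chartDom I x₀) (c : ℝ) (v : TangentSpace I y) :
    chartCoord I x₀ y (c • v) = c • chartCoord I x₀ y v := by
  simp [chartCoord_eq_continuousLinearMapAt hy]

theorem chartCoord_sum {ι : Type*} (s : Finset ι) (hy : y ∈ chartDom I x₀)
    (v : ι → TangentSpace I y) :
    chartCoord I x₀ y (∑ i ∈ s, v i) = ∑ i ∈ s, chartCoord I x₀ y (v i) := by
  simp [chartCoord_eq_continuousLinearMapAt hy]

theorem contMDiffAt_iff_chartCoord {n : ℕ∞ω} [ContMDiffVectorBundle n E (TangentSpace I : M → Type _) I]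
    (hy : y ∈ chartDom I x₀) (X : Π x : M, TangentSpace I x) :
    CMDiffAt n (T% X) y ↔ CMDiffAt n (fun z ↦ chartCoord I x₀ z (X z)) y :=
  (trivializationAt E (TangentSpace I) x₀).contMDiffAt_section_iff hy

theorem contMDiffAt_constField (hy : y ∈ chartDom I x₀) (a : E) :
    CMDiffAt ∞ (T% (constField I x₀ a)) y := by
  rw [contMDiffAt_iff_chartCoord hy]
  refine (contMDiffAt_const (c := a)).congr_of_eventuallyEq ?_
  filter_upwards [chartDom_mem_nhds hy] with z hz using chartCoord_constField hz a

theorem mdifferentiableAt_constField (hy : y ∈ chartDom I x₀) (a : E) :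
    MDiffAt (T% (constField I x₀ a)) y :=
  (contMDiffAt_constField hy a).mdifferentiableAt (by simp)

end Geometry

section Geometry

variable {E : Type*} [NormedAddCommGroup E] [NormedSpace ℝ E]
  {H : Type*} [TopologicalSpace H] {I : ModelWithCorners ℝ E H}
  {M : Type*} [TopologicalSpace M] [ChartedSpace H M]
  [RiemannianBundle (fun x : M ↦ TangentSpace I x)]
  [FiniteDimensional ℝ E] [CompleteSpace E] [IsManifold I ∞ M]
  [IsContMDiffRiemannianBundle I ∞ E (fun x : M ↦ TangentSpace I x)]
  {x₀ x y : M}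

set_option linter.unusedSectionVars false

/-! ### The Levi-Civita connection in a chart -/

theorem leviCivita_congr {Y Y' : Π x : M, TangentSpace I x} (hY : MDiffAt (T% Y) x)
    (h : ∀ᶠ y in 𝓝 x, Y y = Y' y) : leviCivita Y x = leviCivita Y' x := by
  have hY' : MDiffAt (T% Y') x := hY.congr_of_eventuallyEq (h.mono fun y hy ↦ by simp [hy])
  exact leviCivita.isCovariantDerivativeOnUniv.congr_of_eventuallyEq hY hY' Filter.univ_mem h

theorem leviCivita_add {Y Y' : Π x : M, TangentSpace I x} (hY : MDiffAt (T% Y) x)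
    (hY' : MDiffAt (T% Y') x) :
    leviCivita (Y + Y') x = leviCivita Y x + leviCivita Y' x :=
  leviCivita.isCovariantDerivativeOnUniv.add hY hY'

theorem leviCivita_smul {Y : Π x : M, TangentSpace I x} {f : M → ℝ} (hY : MDiffAt (T% Y) x)
    (hf : MDiffAt f x) (v : TangentSpace I x) :
    leviCivita (f • Y) x v = f x • leviCivita Y x v + d% f x v • Y x := by
  have := leviCivita.isCovariantDerivativeOnUniv.leibniz hY hf
  rw [this]
  simp

theorem mdifferentiableAt_sum_smul {ι : Type*} {s : Finset ι}
    {f : ι → M → ℝ} {Y : ι → Π x : M, TangentSpace I x} (hf : ∀ i, MDiffAt (f i) x)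
    (hY : ∀ i, MDiffAt (T% (Y i)) x) :
    MDiffAt (T% (∑ i ∈ s, f i • Y i)) x := by
  classical
  induction s using Finset.induction_on with
  | empty =>
    rw [Finset.sum_empty]
    exact mdifferentiableAt_zeroSection ℝ (TangentSpace I : M → Type _)
  | insert i s his ih =>
    rw [Finset.sum_insert his]
    exact mdifferentiableAt_add_section ((hf i).smul_section (hY i)) ih

theorem leviCivita_sum_smul {ι : Type*} {s : Finset ι}
    {f : ι → M → ℝ} {Y : ι → Π x : M, TangentSpace I x} (hf : ∀ i, MDiffAt (f i) x)
    (hY : ∀ i, MDiffAt (T% (Y i)) x) (v : TangentSpace I x) :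
    leviCivita (∑ i ∈ s, f i • Y i) x v =
      ∑ i ∈ s, (f i x • leviCivita (Y i) x v + d% (f i) x v • Y i x) := by
  classical
  induction s using Finset.induction_on with
  | empty => simp
  | insert i s his ih =>
    rw [Finset.sum_insert his, Finset.sum_insert his,
      leviCivita_add ((hf i).smul_section (hY i)) (mdifferentiableAt_sum_smul hf hY), ← ih,
      add_apply, leviCivita_smul (hY i) (hf i)]

theorem leviCivita_constField_sum {ι : Type*} {s : Finset ι} (hx : x ∈ chartDom I x₀)
    (c : ι → ℝ) (a : ι → E) (v : TangentSpace I x) :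
    leviCivita (constField I x₀ (∑ i ∈ s, c i • a i)) x v =
      ∑ i ∈ s, c i • leviCivita (constField I x₀ (a i)) x v := by
  have h1 : ∀ᶠ y in 𝓝 x, constField I x₀ (∑ i ∈ s, c i • a i) y =
      (∑ i ∈ s, (fun _ : M ↦ c i) • constField I x₀ (a i)) y := by
    filter_upwards [chartDom_mem_nhds hx] with y hy
    simp [constField_sum _ hy, constField_smul hy]
  rw [leviCivita_congr (mdifferentiableAt_constField hx _) h1,
    leviCivita_sum_smul (fun i ↦ mdifferentiableAt_const)
      (fun i ↦ mdifferentiableAt_constField hx _)]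
  simp [mvfderiv_const]

theorem leviCivita_constField_add (hx : x ∈ chartDom I x₀) (a b : E) (v : TangentSpace I x) :
    leviCivita (constField I x₀ (a + b)) x v =
      leviCivita (constField I x₀ a) x v + leviCivita (constField I x₀ b) x v := by
  have := leviCivita_constField_sum (s := Finset.univ) hx ![1, 1] ![a, b] v
  simpa [Fin.sum_univ_two] using this

theorem leviCivita_constField_smul (hx : x ∈ chartDom I x₀) (c : ℝ) (a : E)
    (v : TangentSpace I x) :
    leviCivita (constField I x₀ (c • a)) x v = c • leviCivita (constField I x₀ a) x v := by
  have := leviCivita_constField_sum (s := {()}) hx (fun _ ↦ c) (fun _ ↦ a) v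
  simpa using this

theorem mdifferentiableAt_chartCoord (hx : x ∈ chartDom I x₀) {Y : Π x : M, TangentSpace I x}
    (hY : MDiffAt (T% Y) x) : MDiffAt (fun y ↦ chartCoord I x₀ y (Y y)) x :=
  ((trivializationAt E (TangentSpace I) x₀).mdifferentiableAt_section_iff _ _ hx).1 hY

/-- The covariant derivative is the derivative of the coefficients plus a term that depends on the
value of the field only. -/
theorem leviCivita_eq_constField_add (hx : x ∈ chartDom I x₀) {Y : Π x : M, TangentSpace I x}
    (hY : MDiffAt (T% Y) x) (v : TangentSpace I x) :
    leviCivita Y x v = constField I x₀ (d% (fun y ↦ chartCoord I x₀ y (Y y)) x v) x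
      + leviCivita (constField I x₀ (chartCoord I x₀ x (Y x))) x v := by
  set b := Module.finBasis ℝ E
  set c : M → E := fun y ↦ chartCoord I x₀ y (Y y) with hc
  have hcd : MDiffAt c x := mdifferentiableAt_chartCoord hx hY
  set L : Fin (Module.finrank ℝ E) → E →L[ℝ] ℝ := fun i ↦ LinearMap.toContinuousLinearMap (b.coord i)
  have hLb : ∀ a : E, ∑ i, L i a • b i = a := fun a ↦ b.sum_repr a
  have hf : ∀ i, HasMFDerivAt I 𝓘(ℝ, ℝ) (fun y ↦ L i (c y)) x ((L i).comp (mfderiv I 𝓘(ℝ, E) c x)) :=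
    fun i ↦ (L i).hasMFDerivAt.comp x hcd.hasMFDerivAt
  have h1 : ∀ᶠ y in 𝓝 x, Y y = (∑ i, (fun y ↦ L i (c y)) • constField I x₀ (b i)) y := by
    filter_upwards [chartDom_mem_nhds hx] with y hy
    have : Y y = constField I x₀ (∑ i, L i (c y) • b i) y := by
      rw [hLb, hc, constField_chartCoord hy]
    rw [this, constField_sum _ hy]
    simp [constField_smul hy]
  rw [leviCivita_congr hY h1, leviCivita_sum_smul (fun i ↦ (hf i).mdifferentiableAt)
    (fun i ↦ mdifferentiableAt_constField hx _), Finset.sum_add_distrib, add_comm]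
  congr 1
  · have h2 : ∀ i, d% (fun y ↦ L i (c y)) x v = L i (d% c x v) := by
      intro i
      simp only [mvfderiv, (hf i).mfderiv]
      rfl
    simp_rw [h2]
    conv_rhs => rw [← hLb (d% c x v)]
    rw [constField_sum _ hx]
    simp [constField_smul hx]
  · conv_rhs => rw [← hLb (chartCoord I x₀ x (Y x))]
    rw [leviCivita_constField_sum hx]

/-! ### The covariant derivative along a curve in a chart -/

variable {γ : ℝ → M} {s : Set ℝ}

/-- The chain rule along a curve. -/
theorem hasDerivWithinAt_comp_curve {F : Type*} [NormedAddCommGroup F] [NormedSpace ℝ F]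
    {f : M → F} (t : s) (hf : MDiffAt f (γ t)) (hγ : MDiffAt[s] γ t) :
    HasDerivWithinAt (fun r ↦ f (γ r)) (d% f (γ t) (velocity I γ s t)) s t := by
  have h := hf.hasMFDerivAt.comp_hasMFDerivWithinAt (t : ℝ) hγ.hasMFDerivWithinAt
  rw [hasMFDerivWithinAt_iff_hasFDerivWithinAt] at h
  have h' : HasFDerivWithinAt (fun r ↦ f (γ r))
      ((d% f (γ t)).comp (mfderivWithin 𝓘(ℝ, ℝ) I γ s t) : ℝ →L[ℝ] F) s t := h
  exact h'.hasDerivWithinAt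

/-- The coefficients of a field along a curve in the chart at `x₀`. -/
def FieldAlong.coord (V : FieldAlong I γ s) (x₀ : M) (r : ℝ) : E :=
  (trivializationAt E (TangentSpace I) x₀ (V.lift r)).2

theorem FieldAlong.coord_apply (V : FieldAlong I γ s) (x₀ : M) (t : s) :
    V.coord x₀ t = chartCoord I x₀ (γ t) (V t) := by
  simp [FieldAlong.coord, FieldAlong.lift, chartCoord]

theorem FieldAlong.constField_coord (V : FieldAlong I γ s) (t : s) (ht : γ t ∈ chartDom I x₀) :
    constField I x₀ (V.coord x₀ t) (γ t) = V t := by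
  rw [V.coord_apply, constField_chartCoord ht]

/-- The covariant derivative along a curve may be computed in any chart. -/
theorem FieldAlong.covDeriv_eq (V : FieldAlong I γ s) (t : s) (hx : γ t ∈ chartDom I x₀)
    (hγ : MDiffAt[s] γ t) (hs : UniqueDiffWithinAt ℝ s t)
    (hV : DifferentiableWithinAt ℝ (V.coord x₀) s t) :
    V.covDeriv t = constField I x₀ (derivWithin (V.coord x₀) s t) (γ t)
      + leviCivita (constField I x₀ (V.coord x₀ t)) (γ t) (velocity I γ s t) := by
  set x := γ t with hxdef
  set b := Module.finBasis ℝ E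
  set L : Fin (Module.finrank ℝ E) → E →L[ℝ] ℝ := fun i ↦ LinearMap.toContinuousLinearMap (b.coord i)
  have hLb : ∀ a : E, ∑ i, L i a • b i = a := fun a ↦ b.sum_repr a
  set k : Fin (Module.finrank ℝ E) → M → E :=
    fun i y ↦ chartCoord I x y (constField I x₀ (b i) y) with hk
  have hkd : ∀ i, MDiffAt (k i) x := fun i ↦
    mdifferentiableAt_chartCoord mem_chartDom_self (mdifferentiableAt_constField hx _)
  have hnear : ∀ᶠ r in 𝓝[s] (t : ℝ), γ r ∈ chartDom I x ∧ γ r ∈ chartDom I x₀ :=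
    hγ.continuousWithinAt.eventually
      (Filter.inter_mem (chartDom_mem_nhds mem_chartDom_self) (chartDom_mem_nhds hx))
  have hexp : ∀ r ∈ s, γ r ∈ chartDom I x ∧ γ r ∈ chartDom I x₀ →
      V.coord x r = ∑ i, L i (V.coord x₀ r) • k i (γ r) := by
    intro r hr h
    have h1 := V.constField_coord (x₀ := x₀) ⟨r, hr⟩ h.2
    have h2 := V.coord_apply x ⟨r, hr⟩
    simp only at h1 h2
    rw [h2, ← h1]
    conv_lhs => rw [← hLb (V.coord x₀ r)]
    rw [constField_sum _ h.2, chartCoord_sum _ h.1]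
    simp [constField_smul h.2, chartCoord_smul h.1, hk]
  have hd : HasDerivWithinAt (V.coord x) (∑ i, (L i (V.coord x₀ t) • d% (k i) x (velocity I γ s t)
      + L i (derivWithin (V.coord x₀) s t) • k i x)) s t := by
    have h1 : HasDerivWithinAt (fun r ↦ ∑ i, L i (V.coord x₀ r) • k i (γ r))
        (∑ i, (L i (V.coord x₀ t) • d% (k i) x (velocity I γ s t)
          + L i (derivWithin (V.coord x₀) s t) • k i x)) s t := by
      refine HasDerivWithinAt.fun_sum fun i _ ↦ ?_
      have e1 := (L i).hasFDerivAt.comp_hasDerivWithinAt (t : ℝ) hV.hasDerivWithinAt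
      exact e1.smul (hasDerivWithinAt_comp_curve t (hkd i) hγ)
    refine h1.congr_of_eventuallyEq ?_ (hexp t t.2 ⟨mem_chartDom_self, hx⟩)
    filter_upwards [hnear, self_mem_nhdsWithin] with r hr hrs using hexp r hrs hr
  have hdef : V.covDeriv t = constField I x (derivWithin (V.coord x) s t) x
      + leviCivita (constField I x (V.coord x t)) x (velocity I γ s t) := by
    rw [V.coord_apply, ← extend_eq_constField]
    rfl
  rw [hdef, hd.derivWithin hs, hexp t t.2 ⟨mem_chartDom_self, hx⟩,
    leviCivita_constField_sum mem_chartDom_self, constField_sum _ mem_chartDom_self]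
  -- The transformation law of the Christoffel symbols: the derivatives of the transition
  -- coefficients `k i` produced here are exactly those from differentiating the coefficients of `V`
  -- in the other chart.
  have hterm : ∀ i, leviCivita (constField I x₀ (b i)) x (velocity I γ s t)
      = constField I x (d% (k i) x (velocity I γ s t)) x
        + leviCivita (constField I x (k i x)) x (velocity I γ s t) := fun i ↦
    leviCivita_eq_constField_add mem_chartDom_self (mdifferentiableAt_constField hx _) _
  conv_rhs => rw [← hLb (V.coord x₀ t), leviCivita_constField_sum hx,
    ← hLb (derivWithin (V.coord x₀) s t), constField_sum _ hx]
  simp_rw [hterm]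
  rw [← Finset.sum_add_distrib, ← Finset.sum_add_distrib]
  refine Finset.sum_congr rfl fun i _ ↦ ?_
  rw [constField_add mem_chartDom_self, constField_smul mem_chartDom_self,
    constField_smul mem_chartDom_self, constField_smul hx, constField_chartCoord mem_chartDom_self]
  module

end Geometry

section Geometry

variable {E : Type*} [NormedAddCommGroup E] [NormedSpace ℝ E]
  {H : Type*} [TopologicalSpace H] {I : ModelWithCorners ℝ E H}
  {M : Type*} [TopologicalSpace M] [ChartedSpace H M]
  [RiemannianBundle (fun x : M ↦ TangentSpace I x)]
  [FiniteDimensional ℝ E] [CompleteSpace E] [IsManifold I ∞ M]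
  [IsContMDiffRiemannianBundle I ∞ E (fun x : M ↦ TangentSpace I x)]
  {x₀ x y : M} {γ : ℝ → M} {s : Set ℝ}

set_option linter.unusedSectionVars false

/-! ### Algebra and metric compatibility of the covariant derivative along a curve -/

/-- The extension by zero of a field along a curve to all parameters. -/
def FieldAlong.ext (V : FieldAlong I γ s) (r : ℝ) : TangentSpace I (γ r) := (V.lift r).2

theorem FieldAlong.ext_apply (V : FieldAlong I γ s) (t : s) : V.ext t = V t := by
  simp [FieldAlong.ext, FieldAlong.lift]

theorem FieldAlong.ext_of_mem (V : FieldAlong I γ s) {r : ℝ} (hr : r ∈ s) :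
    V.ext r = V ⟨r, hr⟩ := V.ext_apply ⟨r, hr⟩

theorem FieldAlong.ext_of_notMem (V : FieldAlong I γ s) {r : ℝ} (hr : r ∉ s) :
    V.ext r = 0 := by
  simp [FieldAlong.ext, FieldAlong.lift, hr]

theorem FieldAlong.ext_add (V W : FieldAlong I γ s) (r : ℝ) : (V + W).ext r = V.ext r + W.ext r := by
  by_cases hr : r ∈ s
  · simp [FieldAlong.ext_of_mem, hr]
  · simp [FieldAlong.ext_of_notMem, hr]

theorem FieldAlong.ext_smul (c : ℝ) (V : FieldAlong I γ s) (r : ℝ) :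
    (c • V).ext r = c • V.ext r := by
  by_cases hr : r ∈ s
  · simp [FieldAlong.ext_of_mem, hr]
  · simp [FieldAlong.ext_of_notMem, hr]

/-- The product of a function of the parameter and a field along a curve. -/
def FieldAlong.mulBy (f : ℝ → ℝ) (V : FieldAlong I γ s) : FieldAlong I γ s := fun t ↦ f t • V t

theorem FieldAlong.coord_add (V W : FieldAlong I γ s) (t : s) (hx : γ t ∈ chartDom I x₀) :
    (V + W).coord x₀ t = V.coord x₀ t + W.coord x₀ t := by
  rw [FieldAlong.coord_apply, FieldAlong.coord_apply, FieldAlong.coord_apply, ← chartCoord_add hx]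
  rfl

theorem FieldAlong.coord_mulBy (f : ℝ → ℝ) (V : FieldAlong I γ s) (t : s)
    (hx : γ t ∈ chartDom I x₀) :
    (V.mulBy f).coord x₀ t = f t • V.coord x₀ t := by
  rw [FieldAlong.coord_apply, FieldAlong.coord_apply, ← chartCoord_smul hx]
  rfl

theorem FieldAlong.contMDiffWithinAt_lift_iff (hγ : ContMDiffOn 𝓘(ℝ, ℝ) I ∞ γ s)
    (V : FieldAlong I γ s) (t : s) (hx : γ t ∈ chartDom I x₀) :
    ContMDiffWithinAt 𝓘(ℝ, ℝ) I.tangent ∞ V.lift s t ↔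
      ContDiffWithinAt ℝ ∞ (V.coord x₀) s t := by
  have he : V.lift t ∈ (trivializationAt E (TangentSpace I) x₀).source := by
    rw [Trivialization.mem_source]; exact hx
  rw [← contMDiffWithinAt_iff_contDiffWithinAt]
  refine (Trivialization.contMDiffWithinAt_iff he).trans ⟨fun h ↦ h.2, fun h ↦ ⟨hγ t t.2, h⟩⟩

theorem FieldAlong.IsSmooth.contDiffWithinAt_coord (hγ : ContMDiffOn 𝓘(ℝ, ℝ) I ∞ γ s)
    {V : FieldAlong I γ s} (hV : V.IsSmooth) (t : s) (hx : γ t ∈ chartDom I x₀) :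
    ContDiffWithinAt ℝ ∞ (V.coord x₀) s t :=
  (FieldAlong.contMDiffWithinAt_lift_iff hγ V t hx).1 (hV t t.2)

theorem FieldAlong.IsSmooth.differentiableWithinAt_coord (hγ : ContMDiffOn 𝓘(ℝ, ℝ) I ∞ γ s)
    {V : FieldAlong I γ s} (hV : V.IsSmooth) (t : s) (hx : γ t ∈ chartDom I x₀) :
    DifferentiableWithinAt ℝ (V.coord x₀) s t :=
  (hV.contDiffWithinAt_coord hγ t hx).differentiableWithinAt (by simp)

theorem eventually_mem_chartDom (hγ : ContMDiffOn 𝓘(ℝ, ℝ) I ∞ γ s) (t : s)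
    (hx : γ t ∈ chartDom I x₀) : ∀ᶠ r in 𝓝[s] (t : ℝ), r ∈ s ∧ γ r ∈ chartDom I x₀ :=
  (eventually_mem_nhdsWithin).and
    ((hγ t t.2).continuousWithinAt.eventually (chartDom_mem_nhds hx))

theorem FieldAlong.IsSmooth.add (hγ : ContMDiffOn 𝓘(ℝ, ℝ) I ∞ γ s) {V W : FieldAlong I γ s}
    (hV : V.IsSmooth) (hW : W.IsSmooth) : (V + W).IsSmooth := by
  intro t ht
  rw [FieldAlong.contMDiffWithinAt_lift_iff hγ _ ⟨t, ht⟩ mem_chartDom_self]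
  refine ((hV.contDiffWithinAt_coord hγ ⟨t, ht⟩ mem_chartDom_self).add
    (hW.contDiffWithinAt_coord hγ ⟨t, ht⟩ mem_chartDom_self)).congr_of_eventuallyEq ?_
    (FieldAlong.coord_add V W ⟨t, ht⟩ mem_chartDom_self)
  filter_upwards [eventually_mem_chartDom hγ ⟨t, ht⟩ mem_chartDom_self] with r hr
  exact FieldAlong.coord_add V W ⟨r, hr.1⟩ hr.2

theorem FieldAlong.IsSmooth.mulBy (hγ : ContMDiffOn 𝓘(ℝ, ℝ) I ∞ γ s) {f : ℝ → ℝ}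
    (hf : ContDiff ℝ ∞ f) {V : FieldAlong I γ s} (hV : V.IsSmooth) : (V.mulBy f).IsSmooth := by
  intro t ht
  rw [FieldAlong.contMDiffWithinAt_lift_iff hγ _ ⟨t, ht⟩ mem_chartDom_self]
  refine (hf.contDiffWithinAt.smul
    (hV.contDiffWithinAt_coord hγ ⟨t, ht⟩ mem_chartDom_self)).congr_of_eventuallyEq ?_
    (FieldAlong.coord_mulBy f V ⟨t, ht⟩ mem_chartDom_self)
  filter_upwards [eventually_mem_chartDom hγ ⟨t, ht⟩ mem_chartDom_self] with r hr
  exact FieldAlong.coord_mulBy f V ⟨r, hr.1⟩ hr.2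

theorem FieldAlong.covDeriv_add (hγ : ContMDiffOn 𝓘(ℝ, ℝ) I ∞ γ s) (hs : UniqueDiffOn ℝ s)
    {V W : FieldAlong I γ s} (hV : V.IsSmooth) (hW : W.IsSmooth) :
    (V + W).covDeriv = V.covDeriv + W.covDeriv := by
  funext t
  have hx : γ t ∈ chartDom I (γ t) := mem_chartDom_self
  have hγt : MDiffAt[s] γ t := (hγ t t.2).mdifferentiableWithinAt (by simp)
  have hst := hs t t.2
  have hVt := hV.differentiableWithinAt_coord hγ t hx
  have hWt := hW.differentiableWithinAt_coord hγ t hx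
  have hd : HasDerivWithinAt ((V + W).coord (γ t))
      (derivWithin (V.coord (γ t)) s t + derivWithin (W.coord (γ t)) s t) s t := by
    refine (hVt.hasDerivWithinAt.add hWt.hasDerivWithinAt).congr_of_eventuallyEq ?_
      (FieldAlong.coord_add V W t hx)
    filter_upwards [eventually_mem_chartDom hγ t hx] with r hr
    exact FieldAlong.coord_add V W ⟨r, hr.1⟩ hr.2
  rw [Pi.add_apply, FieldAlong.covDeriv_eq _ t hx hγt hst hd.differentiableWithinAt,
    FieldAlong.covDeriv_eq _ t hx hγt hst hVt, FieldAlong.covDeriv_eq _ t hx hγt hst hWt,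
    hd.derivWithin hst, FieldAlong.coord_add V W t hx, constField_add hx,
    leviCivita_constField_add hx]
  abel

theorem FieldAlong.covDeriv_mulBy (hγ : ContMDiffOn 𝓘(ℝ, ℝ) I ∞ γ s) (hs : UniqueDiffOn ℝ s)
    {f f' : ℝ → ℝ} (hf : ∀ r, HasDerivAt f (f' r) r) {V : FieldAlong I γ s} (hV : V.IsSmooth) :
    (V.mulBy f).covDeriv = V.mulBy f' + V.covDeriv.mulBy f := by
  funext t
  have hx : γ t ∈ chartDom I (γ t) := mem_chartDom_self
  have hγt : MDiffAt[s] γ t := (hγ t t.2).mdifferentiableWithinAt (by simp)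
  have hst := hs t t.2
  have hVt := hV.differentiableWithinAt_coord hγ t hx
  have hd : HasDerivWithinAt ((V.mulBy f).coord (γ t))
      (f t • derivWithin (V.coord (γ t)) s t + f' t • V.coord (γ t) t) s t := by
    refine ((hf t).hasDerivWithinAt.smul hVt.hasDerivWithinAt).congr_of_eventuallyEq ?_
      (FieldAlong.coord_mulBy f V t hx)
    filter_upwards [eventually_mem_chartDom hγ t hx] with r hr
    exact FieldAlong.coord_mulBy f V ⟨r, hr.1⟩ hr.2
  rw [FieldAlong.covDeriv_eq _ t hx hγt hst hd.differentiableWithinAt, hd.derivWithin hst,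
    FieldAlong.coord_mulBy f V t hx, constField_add hx,
    leviCivita_constField_smul hx, constField_smul hx, constField_smul hx,
    FieldAlong.constField_coord V t hx]
  simp only [Pi.add_apply, FieldAlong.mulBy]
  rw [FieldAlong.covDeriv_eq _ t hx hγt hst hVt]
  module

theorem FieldAlong.mulBy_const (c : ℝ) (V : FieldAlong I γ s) : V.mulBy (fun _ ↦ c) = c • V := rfl

theorem FieldAlong.covDeriv_smul (hγ : ContMDiffOn 𝓘(ℝ, ℝ) I ∞ γ s) (hs : UniqueDiffOn ℝ s)
    (c : ℝ) {V : FieldAlong I γ s} (hV : V.IsSmooth) : (c • V).covDeriv = c • V.covDeriv := by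
  have := FieldAlong.covDeriv_mulBy hγ hs (f := fun _ ↦ c) (f' := fun _ ↦ 0)
    (fun r ↦ hasDerivAt_const r c) hV
  rwa [FieldAlong.mulBy_const, FieldAlong.mulBy_const, FieldAlong.mulBy_const, zero_smul,
    zero_add] at this

/-- The covariant derivative along a curve is compatible with the metric. -/
theorem FieldAlong.hasDerivWithinAt_inner (hγ : ContMDiffOn 𝓘(ℝ, ℝ) I ∞ γ s)
    (hs : UniqueDiffOn ℝ s) {V W : FieldAlong I γ s} (hV : V.IsSmooth) (hW : W.IsSmooth) (t : s) :
    HasDerivWithinAt (fun r ↦ inner ℝ (V.ext r) (W.ext r))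
      (inner ℝ (V.covDeriv t) (W t) + inner ℝ (V t) (W.covDeriv t)) s t := by
  set x := γ t with hxdef
  have hx : γ t ∈ chartDom I x := mem_chartDom_self
  have hγt : MDiffAt[s] γ t := (hγ t t.2).mdifferentiableWithinAt (by simp)
  have hst := hs t t.2
  have hVt := hV.differentiableWithinAt_coord hγ t hx
  have hWt := hW.differentiableWithinAt_coord hγ t hx
  set b := Module.finBasis ℝ E
  set L : Fin (Module.finrank ℝ E) → E →L[ℝ] ℝ := fun i ↦ LinearMap.toContinuousLinearMap (b.coord i)
  have hLb : ∀ a : E, ∑ i, L i a • b i = a := fun a ↦ b.sum_repr a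
  set e : Fin (Module.finrank ℝ E) → Π y : M, TangentSpace I y := fun i ↦ constField I x (b i)
  have he : ∀ i, MDiffAt (T% (e i)) x := fun i ↦ mdifferentiableAt_constField hx _
  set g : Fin (Module.finrank ℝ E) → Fin (Module.finrank ℝ E) → M → ℝ :=
    fun i j y ↦ inner ℝ (e i y) (e j y)
  have hg : ∀ i j, MDiffAt (g i j) x := fun i j ↦ mdiff_inner (he i) (he j)
  set v := velocity I γ s t
  have hdg : ∀ i j, d% (g i j) x v = inner ℝ (leviCivita (e i) x v) (e j x)
      + inner ℝ (e i x) (leviCivita (e j) x v) := by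
    intro i j
    have := leviCivita_metric (extend_mdiff v) (he i) (he j)
    rwa [extend_apply_self] at this
  have hexp : ∀ U : FieldAlong I γ s, ∀ r : s, γ r ∈ chartDom I x →
      U r = ∑ i, L i (U.coord x r) • e i (γ r) := by
    intro U r hr
    have h1 := U.constField_coord r hr
    rw [← hLb (U.coord x r), constField_sum _ hr] at h1
    rw [← h1]
    exact Finset.sum_congr rfl fun i _ ↦ constField_smul hr _ _
  have hexp' : ∀ U : FieldAlong I γ s, U.IsSmooth →
      U.covDeriv t = ∑ i, (L i (derivWithin (U.coord x) s t) • e i x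
        + L i (U.coord x t) • leviCivita (e i) x v) := by
    intro U hU
    rw [FieldAlong.covDeriv_eq U t hx hγt hst (hU.differentiableWithinAt_coord hγ t hx),
      Finset.sum_add_distrib, ← leviCivita_constField_sum hx, hLb]
    congr 1
    conv_lhs => rw [← hLb (derivWithin (U.coord x) s t)]
    rw [constField_sum _ hx]
    exact Finset.sum_congr rfl fun i _ ↦ constField_smul hx _ _
  -- In the frame `e` the inner product is bilinear in the coefficients with matrix `g`.
  -- Differentiating `g` along the curve produces the connection terms by `hdg`.
  have hmain : HasDerivWithinAt
      (fun r ↦ ∑ i, ∑ j, (L i (V.coord x r) * L j (W.coord x r)) * g i j (γ r))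
      (∑ i, ∑ j, ((L i (derivWithin (V.coord x) s t) * L j (W.coord x t)
        + L i (V.coord x t) * L j (derivWithin (W.coord x) s t)) * g i j x
        + (L i (V.coord x t) * L j (W.coord x t)) * d% (g i j) x v)) s t := by
    refine HasDerivWithinAt.fun_sum fun i _ ↦ HasDerivWithinAt.fun_sum fun j _ ↦ ?_
    have e1 := (L i).hasFDerivAt.comp_hasDerivWithinAt (t : ℝ) hVt.hasDerivWithinAt
    have e2 := (L j).hasFDerivAt.comp_hasDerivWithinAt (t : ℝ) hWt.hasDerivWithinAt
    exact (e1.mul e2).mul (hasDerivWithinAt_comp_curve t (hg i j) hγt)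
  have hinner : ∀ r : s, γ r ∈ chartDom I x → inner ℝ (V.ext r) (W.ext r)
      = ∑ i, ∑ j, (L i (V.coord x r) * L j (W.coord x r)) * g i j (γ r) := by
    intro r hr
    rw [V.ext_apply, W.ext_apply, hexp V r hr, hexp W r hr, sum_inner]
    refine Finset.sum_congr rfl fun i _ ↦ ?_
    rw [inner_sum]
    refine Finset.sum_congr rfl fun j _ ↦ ?_
    rw [inner_smul_left, inner_smul_right]
    simp only [conj_trivial, g]
    ring
  refine (hmain.congr_of_eventuallyEq ?_ (hinner t hx)).congr_deriv ?_
  · filter_upwards [eventually_mem_chartDom hγ t hx] with r hr using hinner ⟨r, hr.1⟩ hr.2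
  · rw [hexp' V hV, hexp' W hW, hexp V t hx, hexp W t hx, sum_inner, sum_inner,
      ← Finset.sum_add_distrib]
    refine Finset.sum_congr rfl fun i _ ↦ ?_
    rw [inner_sum, inner_sum, ← Finset.sum_add_distrib]
    refine Finset.sum_congr rfl fun j _ ↦ ?_
    rw [hdg]
    simp only [inner_add_left, inner_add_right, inner_smul_left, inner_smul_right, conj_trivial, g]
    ring

end Geometry

section Geometry

variable {E : Type*} [NormedAddCommGroup E] [NormedSpace ℝ E]
  {H : Type*} [TopologicalSpace H] {I : ModelWithCorners ℝ E H}
  {M : Type*} [TopologicalSpace M] [ChartedSpace H M]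
  [RiemannianBundle (fun x : M ↦ TangentSpace I x)]
  [FiniteDimensional ℝ E] [CompleteSpace E] [IsManifold I ∞ M]
  [IsContMDiffRiemannianBundle I ∞ E (fun x : M ↦ TangentSpace I x)]
  {x₀ x y : M}

set_option linter.unusedSectionVars false

/-! ### Smoothness of the Levi-Civita connection -/

theorem contMDiffAt_det {ι : Type*} [Fintype ι] [DecidableEq ι] {A : M → Matrix ι ι ℝ}
    (hA : ∀ i j, CMDiffAt ∞ (fun y ↦ A y i j) x) : CMDiffAt ∞ (fun y ↦ (A y).det) x := by
  simp only [Matrix.det_apply]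
  refine contMDiffAt_finsetSum fun σ _ ↦ ?_
  have h : CMDiffAt ∞ (fun y ↦ ((Equiv.Perm.sign σ : ℤ) : ℝ) * ∏ i, A y (σ i) i) x :=
    contMDiffAt_const.mul (contMDiffAt_finsetProd fun i _ ↦ hA _ _)
  refine h.congr_of_eventuallyEq (Filter.Eventually.of_forall fun y ↦ ?_)
  simp [Units.smul_def]

/-- The solution of a regular linear system with smooth coefficients is smooth. -/
theorem contMDiffAt_of_mulVec {ι : Type*} [Fintype ι] [DecidableEq ι] {A : M → Matrix ι ι ℝ}
    {c : M → ι → ℝ} (hA : ∀ i j, CMDiffAt ∞ (fun y ↦ A y i j) x) (hdet : (A x).det ≠ 0)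
    (hc : ∀ i, CMDiffAt ∞ (fun y ↦ (A y).mulVec (c y) i) x) (i : ι) :
    CMDiffAt ∞ (fun y ↦ c y i) x := by
  have hD := contMDiffAt_det hA
  -- Cramer's rule writes `c y i` as a quotient of determinants with smooth entries.
  have hN : CMDiffAt ∞ (fun y ↦ (A y).cramer ((A y).mulVec (c y)) i) x := by
    simp only [Matrix.cramer_apply]
    refine contMDiffAt_det fun j k ↦ ?_
    simp only [Matrix.updateCol_apply]
    split_ifs
    · exact hc j
    · exact hA j k
  refine (hN.div₀ hD hdet).congr_of_eventuallyEq ?_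
  filter_upwards [hD.continuousAt.eventually_ne hdet] with y hy
  rw [Pi.div_apply, eq_div_iff hy, Matrix.cramer_eq_adjugate_mulVec, Matrix.mulVec_mulVec,
    Matrix.adjugate_mul]
  simp [Matrix.smul_mulVec, mul_comm]

theorem contMDiffAt_inner {X Y : Π x : M, TangentSpace I x} (hX : CMDiffAt ∞ (T% X) x)
    (hY : CMDiffAt ∞ (T% Y) x) : CMDiffAt ∞ (fun y ↦ (inner ℝ (X y) (Y y) : ℝ)) x :=
  ContMDiffAt.inner_bundle (IB := I) (F := E) (E := fun x : M ↦ TangentSpace I x)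
    (b := fun y ↦ y) hX hY

theorem contMDiffAt_sum_smul {ι : Type*} {s : Finset ι}
    {f : ι → M → ℝ} {Y : ι → Π x : M, TangentSpace I x} (hf : ∀ i, CMDiffAt ∞ (f i) x)
    (hY : ∀ i, CMDiffAt ∞ (T% (Y i)) x) :
    CMDiffAt ∞ (T% (∑ i ∈ s, f i • Y i)) x := by
  classical
  induction s using Finset.induction_on with
  | empty =>
    rw [Finset.sum_empty]
    exact (contMDiff_zeroSection ℝ (TangentSpace I : M → Type _)).contMDiffAt
  | insert i s his ih =>
    rw [Finset.sum_insert his]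
    exact ((hf i).smul_section (hY i)).add_section ih

theorem linearIndependent_constField {ι : Type*} (hx : x ∈ chartDom I x₀) (b : Module.Basis ι ℝ E) :
    LinearIndependent ℝ (fun i ↦ constField I x₀ (b i) x) := by
  have h := b.linearIndependent.map_injOn
    (((trivializationAt E (TangentSpace I) x₀).symmL ℝ x : E →L[ℝ] _) : E →ₗ[ℝ] TangentSpace I x) ?_
  · convert h using 2 with i
    exact constField_eq_symmL hx _
  · intro v _ w _ hvw
    have h2 := congrArg (chartCoord I x₀ x) hvw
    simp only [ContinuousLinearMap.coe_coe, ← constField_eq_symmL hx] at h2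
    rwa [chartCoord_constField hx, chartCoord_constField hx] at h2

/-- The expansion of a tangent vector in the coordinate fields. -/
theorem sum_coord_smul_constField (hx : x ∈ chartDom I x₀) {ι : Type*} [Fintype ι]
    (b : Module.Basis ι ℝ E) (v : TangentSpace I x) :
    ∑ i, b.coord i (chartCoord I x₀ x v) • constField I x₀ (b i) x = v := by
  have h1 := constField_chartCoord hx v
  rw [← b.sum_repr (chartCoord I x₀ x v), constField_sum _ hx] at h1
  refine Eq.trans (Finset.sum_congr rfl fun i _ ↦ ?_) h1
  rw [constField_smul hx]
  rfl

/-- A vector field is smooth if its inner products with the coordinate fields are. -/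
theorem contMDiffAt_of_inner_constField (hx : x ∈ chartDom I x₀) {Y : Π x : M, TangentSpace I x}
    (hY : ∀ a : E, CMDiffAt ∞ (fun y ↦ (inner ℝ (constField I x₀ a y) (Y y) : ℝ)) x) :
    CMDiffAt ∞ (T% Y) x := by
  set b := Module.finBasis ℝ E
  set c : M → Fin (Module.finrank ℝ E) → ℝ := fun y i ↦ b.coord i (chartCoord I x₀ y (Y y)) with hc
  have hYc : ∀ y ∈ chartDom I x₀, Y y = ∑ i, c y i • constField I x₀ (b i) y := by
    intro y hy
    have h1 := constField_chartCoord hy (Y y)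
    rw [← b.sum_repr (chartCoord I x₀ y (Y y)), constField_sum _ hy] at h1
    rw [← h1]
    exact Finset.sum_congr rfl fun i _ ↦ by rw [constField_smul hy]; simp [hc]
  have hcs : ∀ i, CMDiffAt ∞ (fun y ↦ c y i) x := by
    refine contMDiffAt_of_mulVec (A := fun y ↦ Matrix.gram ℝ fun i ↦ constField I x₀ (b i) y)
      (fun i j ↦ ?_) ?_ fun i ↦ ?_
    · simp only [Matrix.gram_apply]
      exact contMDiffAt_inner (contMDiffAt_constField hx _) (contMDiffAt_constField hx _)
    · exact Matrix.det_gram_ne_zero_iff_linearIndependent.2 (linearIndependent_constField hx b)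
    · refine (hY (b i)).congr_of_eventuallyEq ?_
      filter_upwards [chartDom_mem_nhds hx] with y hy
      rw [hYc y hy, inner_sum]
      simp [Matrix.mulVec, dotProduct, Matrix.gram_apply, inner_smul_right, mul_comm]
  refine (contMDiffAt_sum_smul (s := Finset.univ) (f := fun i y ↦ c y i)
    (Y := fun i ↦ constField I x₀ (b i)) hcs
    fun i ↦ contMDiffAt_constField hx _).congr_of_eventuallyEq ?_
  filter_upwards [chartDom_mem_nhds hx] with y hy
  rw [hYc y hy]
  simp

/-! ### Directional derivatives along the coordinate fields -/

variable [I.Boundaryless]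

theorem contDiffAt_comp_extChartAt_symm {F : Type*} [NormedAddCommGroup F] [NormedSpace ℝ F]
    {f : M → F} (hy : y ∈ chartDom I x₀) {n : ℕ∞} (hf : CMDiffAt n f y) :
    ContDiffAt ℝ n (f ∘ (extChartAt I x₀).symm) (extChartAt I x₀ y) := by
  have hy' : y ∈ (extChartAt I x₀).source := by rw [extChartAt_source]; exact hy
  rw [← contMDiffAt_iff_contDiffAt]
  have h1 : CMDiffAt n (extChartAt I x₀).symm (extChartAt I x₀ y) :=
    ((contMDiffOn_extChartAt_symm (n := ∞) x₀).contMDiffAt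
      (extChartAt_target_mem_nhds' ((extChartAt I x₀).map_source hy'))).of_le (mod_cast le_top)
  exact ContMDiffAt.comp_of_eq hf h1 ((extChartAt I x₀).left_inv hy')

/-- The derivative along a coordinate field is the partial derivative in the chart. -/
theorem mvfderiv_constField {F : Type*} [NormedAddCommGroup F] [NormedSpace ℝ F]
    {f : M → F} (hy : y ∈ chartDom I x₀) (hf : MDiffAt f y) (a : E) :
    d% f y (constField I x₀ a y) =
      fderiv ℝ (f ∘ (extChartAt I x₀).symm) (extChartAt I x₀ y) a := by
  have hy' : y ∈ (extChartAt I x₀).source := by rw [extChartAt_source]; exact hy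
  rw [constField_eq_symmL hy, TangentBundle.symmL_trivializationAt hy,
    ← mfderiv_eq_fderiv, I.range_eq_univ, mfderivWithin_univ]
  have h1 : MDiffAt (extChartAt I x₀).symm (extChartAt I x₀ y) :=
    ((contMDiffOn_extChartAt_symm (n := ∞) x₀).contMDiffAt
      (extChartAt_target_mem_nhds' ((extChartAt I x₀).map_source hy'))).mdifferentiableAt (by simp)
  rw [mfderiv_comp_of_eq hf h1 ((extChartAt I x₀).left_inv hy')]
  have h2 : (mfderiv% f ((extChartAt I x₀).symm (extChartAt I x₀ y)) : E →L[ℝ] F) =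
      mfderiv% f y := by
    rw [(extChartAt I x₀).left_inv hy']
  exact (congrArg (fun T : E →L[ℝ] F ↦ T (mfderiv% (extChartAt I x₀).symm (extChartAt I x₀ y) a))
    h2).symm

theorem contMDiffAt_mvfderiv_constField {F : Type*} [NormedAddCommGroup F] [NormedSpace ℝ F]
    {f : M → F} (hy : y ∈ chartDom I x₀) (hf : CMDiffAt ∞ f y) (a : E) :
    CMDiffAt ∞ (fun z ↦ d% f z (constField I x₀ a z)) y := by
  have h1 : ContDiffAt ℝ ∞ (fun p ↦ fderiv ℝ (f ∘ (extChartAt I x₀).symm) p a)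
      (extChartAt I x₀ y) :=
    ((contDiffAt_comp_extChartAt_symm hy hf).fderiv_right (by simp)).clm_apply contDiffAt_const
  have h2 : CMDiffAt ∞ (extChartAt I x₀) y := contMDiffAt_extChartAt' hy
  refine (h1.contMDiffAt.comp y h2).congr_of_eventuallyEq ?_
  have h3 : ∀ᶠ z in 𝓝 y, CMDiffAt 1 f z :=
    (contMDiffAt_iff_contMDiffAt_nhds (by simp)).1 (hf.of_le (by simp))
  filter_upwards [chartDom_mem_nhds hy, h3] with z hz hfz
  exact mvfderiv_constField hz (hfz.mdifferentiableAt (by simp)) a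

theorem contMDiffAt_mlieBracket {X Y : Π x : M, TangentSpace I x} (hX : CMDiffAt ∞ (T% X) x)
    (hY : CMDiffAt ∞ (T% Y) x) : CMDiffAt ∞ (T% (mlieBracket I X Y)) x :=
  haveI : IsManifold I (minSmoothness ℝ 2) M := IsManifold.of_le (n := ∞) (by
    rw [minSmoothness_of_isRCLikeNormedField]; exact ENat.LEInfty.out)
  haveI : IsManifold I (((⊤ : ℕ∞) : ℕ∞ω) + 1) M := IsManifold.of_le (n := ∞) (by simp)
  ContMDiffAt.mlieBracket_vectorField (m := ⊤) (n := ⊤) hX hY (by simp)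

theorem contMDiffAt_mvfderiv {f : M → ℝ} {X : Π x : M, TangentSpace I x} (hf : CMDiffAt ∞ f x)
    (hX : CMDiffAt ∞ (T% X) x) : CMDiffAt ∞ (fun y ↦ d% f y (X y)) x := by
  have hx : x ∈ chartDom I x := mem_chartDom_self
  set b := Module.finBasis ℝ E
  set L : Fin (Module.finrank ℝ E) → E →L[ℝ] ℝ := fun i ↦ LinearMap.toContinuousLinearMap (b.coord i)
  have hc := (contMDiffAt_iff_chartCoord hx X).1 hX
  have h : CMDiffAt ∞ (fun y ↦ ∑ i, L i (chartCoord I x y (X y)) *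
      d% f y (constField I x (b i) y)) x :=
    contMDiffAt_finsetSum fun i _ ↦ ((L i).contMDiff.contMDiffAt.comp x hc).mul
      (contMDiffAt_mvfderiv_constField hx hf (b i))
  refine h.congr_of_eventuallyEq ?_
  filter_upwards [chartDom_mem_nhds hx] with y hy
  conv_lhs => rw [← sum_coord_smul_constField hy b (X y), map_sum]
  refine Finset.sum_congr rfl fun i _ ↦ ?_
  rw [map_smul]
  rfl

theorem eventually_mdifferentiableAt {X : Π x : M, TangentSpace I x} (hX : CMDiffAt ∞ (T% X) x) :
    ∀ᶠ y in 𝓝 x, MDiffAt (T% X) y := by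
  have h : ∀ᶠ y in 𝓝 x, CMDiffAt 1 (T% X) y :=
    (contMDiffAt_iff_contMDiffAt_nhds (by simp)).1 (hX.of_le (by simp))
  exact h.mono fun y hy ↦ hy.mdifferentiableAt (by simp)

/-- The covariant derivative of a smooth field in the direction of a smooth field is smooth. -/
theorem contMDiffAt_leviCivita {X Y : Π x : M, TangentSpace I x} (hX : CMDiffAt ∞ (T% X) x)
    (hY : CMDiffAt ∞ (T% Y) x) : CMDiffAt ∞ (T% (fun y ↦ leviCivita Y y (X y))) x := by
  have hx : x ∈ chartDom I x := mem_chartDom_self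
  refine contMDiffAt_of_inner_constField hx fun d ↦ ?_
  have hZ := contMDiffAt_constField hx d
  have h : CMDiffAt ∞ (fun y ↦ koszul X Y (constField I x d) y) x := by
    unfold koszul
    exact contMDiffAt_const.mul ((((((contMDiffAt_mvfderiv (contMDiffAt_inner hY hZ) hX).add
      (contMDiffAt_mvfderiv (contMDiffAt_inner hX hZ) hY)).sub
      (contMDiffAt_mvfderiv (contMDiffAt_inner hX hY) hZ)).add
      (contMDiffAt_inner (contMDiffAt_mlieBracket hX hY) hZ)).sub
      (contMDiffAt_inner (contMDiffAt_mlieBracket hX hZ) hY)).sub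
      (contMDiffAt_inner (contMDiffAt_mlieBracket hY hZ) hX))
  refine h.congr_of_eventuallyEq ?_
  filter_upwards [chartDom_mem_nhds hx, eventually_mdifferentiableAt hX,
    eventually_mdifferentiableAt hY] with y hy hXy hYy
  rw [real_inner_comm, inner_leviCivita hXy hYy (mdifferentiableAt_constField hy _)]

end Geometry

section Geometry

variable {E : Type*} [NormedAddCommGroup E] [NormedSpace ℝ E]
  {H : Type*} [TopologicalSpace H] {I : ModelWithCorners ℝ E H}
  {M : Type*} [TopologicalSpace M] [ChartedSpace H M]
  [RiemannianBundle (fun x : M ↦ TangentSpace I x)]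
  [FiniteDimensional ℝ E] [CompleteSpace E] [IsManifold I ∞ M]
  [IsContMDiffRiemannianBundle I ∞ E (fun x : M ↦ TangentSpace I x)]
  {x₀ x y : M} {γ : ℝ → M} {s : Set ℝ}

set_option linter.unusedSectionVars false

/-! ### Smoothness of velocity and covariant derivative along a curve -/

theorem contDiffWithinAt_derivWithin {F : Type*} [NormedAddCommGroup F] [NormedSpace ℝ F]
    {f : ℝ → F} (hs : UniqueDiffOn ℝ s) {t : ℝ} (ht : t ∈ s) (hf : ContDiffWithinAt ℝ ∞ f s t) :
    ContDiffWithinAt ℝ ∞ (derivWithin f s) s t :=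
  (hf.fderivWithin_right (m := ∞) hs (by simp) ht).clm_apply contDiffWithinAt_const

theorem coord_velocity (hγ : ContMDiffOn 𝓘(ℝ, ℝ) I ∞ γ s) (hs : UniqueDiffOn ℝ s) (t : s)
    (hx : γ t ∈ chartDom I x₀) :
    (velocity I γ s).coord x₀ t = derivWithin (fun r ↦ extChartAt I x₀ (γ r)) s t := by
  have h1 : CMDiffAt ∞ (extChartAt I x₀) (γ t) := contMDiffAt_extChartAt' hx
  have h2 : MDiffAt (extChartAt I x₀) (γ t) := h1.mdifferentiableAt (by simp)
  rw [(hasDerivWithinAt_comp_curve t h2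
    ((hγ t t.2).mdifferentiableWithinAt (by simp))).derivWithin (hs t t.2),
    FieldAlong.coord_apply, chartCoord_eq_continuousLinearMapAt hx,
    TangentBundle.continuousLinearMapAt_trivializationAt hx]
  rfl

theorem isSmooth_velocity (hγ : ContMDiffOn 𝓘(ℝ, ℝ) I ∞ γ s) (hs : UniqueDiffOn ℝ s) :
    (velocity I γ s).IsSmooth := by
  intro t ht
  rw [FieldAlong.contMDiffWithinAt_lift_iff hγ _ ⟨t, ht⟩ mem_chartDom_self]
  have h1 : CMDiffAt ∞ (extChartAt I (γ t)) (γ t) := contMDiffAt_extChartAt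
  have h2 : ContDiffWithinAt ℝ ∞ (fun r ↦ extChartAt I (γ t) (γ r)) s t :=
    (h1.comp_contMDiffWithinAt t (hγ t ht)).contDiffWithinAt
  refine (contDiffWithinAt_derivWithin hs ht h2).congr_of_eventuallyEq ?_
    (coord_velocity hγ hs ⟨t, ht⟩ mem_chartDom_self)
  filter_upwards [eventually_mem_chartDom hγ ⟨t, ht⟩ mem_chartDom_self] with r hr
  exact coord_velocity hγ hs ⟨r, hr.1⟩ hr.2

variable [I.Boundaryless]

/-- The definition uses a chart that moves with the parameter. By `FieldAlong.covDeriv_eq` one fixed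
chart serves for all nearby parameters, and there the coefficients of `V'` are `v' + Γ(γ', v)` with
smooth Christoffel symbols. -/
theorem FieldAlong.IsSmooth.covDeriv (hγ : ContMDiffOn 𝓘(ℝ, ℝ) I ∞ γ s) (hs : UniqueDiffOn ℝ s)
    {V : FieldAlong I γ s} (hV : V.IsSmooth) : V.covDeriv.IsSmooth := by
  intro t ht
  set x := γ t with hxdef
  have hx : γ t ∈ chartDom I x := mem_chartDom_self
  rw [FieldAlong.contMDiffWithinAt_lift_iff hγ _ ⟨t, ht⟩ hx]
  set b := Module.finBasis ℝ E
  set L : Fin (Module.finrank ℝ E) → E →L[ℝ] ℝ := fun i ↦ LinearMap.toContinuousLinearMap (b.coord i)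
  set Γ : Fin (Module.finrank ℝ E) → Fin (Module.finrank ℝ E) → M → E := fun i k y ↦
    chartCoord I x y (leviCivita (constField I x (b i)) y (constField I x (b k) y))
  have hΓ : ∀ i k, CMDiffAt ∞ (Γ i k) x := fun i k ↦
    (contMDiffAt_iff_chartCoord hx _).1 (contMDiffAt_leviCivita
      (contMDiffAt_constField hx (b k)) (contMDiffAt_constField hx (b i)))
  have hΓγ : ∀ i k, ContDiffWithinAt ℝ ∞ (fun r ↦ Γ i k (γ r)) s t := fun i k ↦
    ((hΓ i k).comp_contMDiffWithinAt t (hγ t ht)).contDiffWithinAt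
  have hVc := hV.contDiffWithinAt_coord hγ ⟨t, ht⟩ hx
  have hvc := (isSmooth_velocity hγ hs).contDiffWithinAt_coord hγ ⟨t, ht⟩ hx
  have hmain : ContDiffWithinAt ℝ ∞ (fun r ↦ derivWithin (V.coord x) s r +
      ∑ i, L i (V.coord x r) • ∑ k, L k ((velocity I γ s).coord x r) • Γ i k (γ r)) s t := by
    refine (contDiffWithinAt_derivWithin hs ht hVc).add (ContDiffWithinAt.sum fun i _ ↦ ?_)
    refine ((L i).contDiff.contDiffAt.comp_contDiffWithinAt t hVc).smul
      (ContDiffWithinAt.sum fun k _ ↦ ?_)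
    exact ((L k).contDiff.contDiffAt.comp_contDiffWithinAt t hvc).smul (hΓγ i k)
  have heq : ∀ r : s, γ r ∈ chartDom I x → V.covDeriv.coord x r = derivWithin (V.coord x) s r +
      ∑ i, L i (V.coord x r) • ∑ k, L k ((velocity I γ s).coord x r) • Γ i k (γ r) := by
    intro r hr
    rw [FieldAlong.coord_apply, FieldAlong.covDeriv_eq V r hr
      ((hγ r r.2).mdifferentiableWithinAt (by simp)) (hs r r.2)
      (hV.differentiableWithinAt_coord hγ r hr), chartCoord_add hr, chartCoord_constField hr]
    congr 1
    conv_lhs => rw [← b.sum_repr (V.coord x r), leviCivita_constField_sum hr, chartCoord_sum _ hr]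
    refine Finset.sum_congr rfl fun i _ ↦ ?_
    rw [chartCoord_smul hr]
    congr 1
    conv_lhs => rw [← sum_coord_smul_constField hr b (velocity I γ s r), map_sum,
      chartCoord_sum _ hr]
    refine Finset.sum_congr rfl fun k _ ↦ ?_
    rw [map_smul, chartCoord_smul hr, FieldAlong.coord_apply]
    rfl
  refine hmain.congr_of_eventuallyEq ?_ (heq ⟨t, ht⟩ hx)
  filter_upwards [eventually_mem_chartDom hγ ⟨t, ht⟩ hx] with r hr using heq ⟨r, hr.1⟩ hr.2

end Geometry

section Geometry

variable {E : Type*} [NormedAddCommGroup E] [NormedSpace ℝ E]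
  {H : Type*} [TopologicalSpace H] {I : ModelWithCorners ℝ E H}
  {M : Type*} [TopologicalSpace M] [ChartedSpace H M]
  [RiemannianBundle (fun x : M ↦ TangentSpace I x)]
  [FiniteDimensional ℝ E] [CompleteSpace E] [IsManifold I ∞ M]
  [IsContMDiffRiemannianBundle I ∞ E (fun x : M ↦ TangentSpace I x)]
  {x₀ x y : M} [I.Boundaryless]

set_option linter.unusedSectionVars false

/-! ### The curvature is a tensor -/

/-- The curvature operator `∇_X ∇_Y W - ∇_Y ∇_X W - ∇_[X,Y] W` on vector fields. -/
def curvatureOp (X Y W : Π x : M, TangentSpace I x) (x : M) : TangentSpace I x :=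
  leviCivita (fun y ↦ leviCivita W y (Y y)) x (X x)
    - leviCivita (fun y ↦ leviCivita W y (X y)) x (Y x)
    - leviCivita W x (mlieBracket I X Y x)

theorem curvature_eq_curvatureOp (u v w : TangentSpace I x) :
    curvature u v w = curvatureOp (extend E u) (extend E v) (extend E w) x := by
  simp [curvature, curvatureOp]

theorem curvatureOp_swap (X Y W : Π x : M, TangentSpace I x) :
    curvatureOp X Y W x = -curvatureOp Y X W x := by
  rw [curvatureOp, curvatureOp, mlieBracket_swap_apply (V := X), map_neg]
  abel

theorem contMDiffAt_curvatureOp {X Y W : Π x : M, TangentSpace I x} (hX : CMDiffAt ∞ (T% X) x)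
    (hY : CMDiffAt ∞ (T% Y) x) (hW : CMDiffAt ∞ (T% W) x) :
    CMDiffAt ∞ (T% (curvatureOp X Y W)) x :=
  ((contMDiffAt_leviCivita hX (contMDiffAt_leviCivita hY hW)).sub_section
    (contMDiffAt_leviCivita hY (contMDiffAt_leviCivita hX hW))).sub_section
    (contMDiffAt_leviCivita (contMDiffAt_mlieBracket hX hY) hW)

/-- `TensorialAt` tests on fields that are merely differentiable, which `contMDiffAt_leviCivita`
does not cover. Expanding `X` in coordinate fields puts the weak regularity into scalar
coefficients. -/
theorem mdifferentiableAt_leviCivita {X W : Π x : M, TangentSpace I x} (hX : MDiffAt (T% X) x)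
    (hW : CMDiffAt ∞ (T% W) x) : MDiffAt (T% (fun y ↦ leviCivita W y (X y))) x := by
  have hx : x ∈ chartDom I x := mem_chartDom_self
  set b := Module.finBasis ℝ E
  set L : Fin (Module.finrank ℝ E) → E →L[ℝ] ℝ := fun i ↦ LinearMap.toContinuousLinearMap (b.coord i)
  have hc := mdifferentiableAt_chartCoord hx hX
  refine (mdifferentiableAt_sum_smul (s := Finset.univ)
    (f := fun i y ↦ L i (chartCoord I x y (X y)))
    (Y := fun i y ↦ leviCivita W y (constField I x (b i) y))
    (fun i ↦ (L i).mdifferentiableAt.comp x hc) fun i ↦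
    (contMDiffAt_leviCivita (contMDiffAt_constField hx (b i)) hW).mdifferentiableAt
      (by simp)).congr_of_eventuallyEq ?_
  filter_upwards [chartDom_mem_nhds hx] with y hy
  congr 1
  conv_lhs => rw [← sum_coord_smul_constField hy b (X y), map_sum]
  rw [Finset.sum_apply]
  refine Finset.sum_congr rfl fun i _ ↦ ?_
  rw [map_smul]
  rfl

/-- The term with the derivative of `f` along `Y` that comes from `∇_Y (f ∇_X W)` cancels against
the one from `[f X, Y]`. -/
theorem tensorialAt_curvatureOp {Y W : Π x : M, TangentSpace I x}
    (hW : CMDiffAt ∞ (T% W) x) : TensorialAt I E (curvatureOp · Y W x) x where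
  smul {f X} hf hX := by
    have h1 : (fun y ↦ leviCivita W y ((f • X) y)) = f • fun y ↦ leviCivita W y (X y) := by
      funext y; simp
    simp only [curvatureOp]
    rw [h1, leviCivita_smul (mdifferentiableAt_leviCivita hX hW) hf,
      mlieBracket_smul_left hf hX]
    simp only [Pi.smul_apply', map_smul, map_add, map_neg, neg_smul]
    module
  add {X X'} hX hX' := by
    have h1 : (fun y ↦ leviCivita W y ((X + X') y)) =
        (fun y ↦ leviCivita W y (X y)) + fun y ↦ leviCivita W y (X' y) := by
      funext y; simp
    simp only [curvatureOp]
    rw [h1, leviCivita_add (mdifferentiableAt_leviCivita hX hW)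
      (mdifferentiableAt_leviCivita hX' hW), mlieBracket_add_left hX hX']
    simp only [Pi.add_apply, map_add, add_apply]
    module

/-- Coordinate fields commute. -/
theorem mlieBracket_constField (a c : E) :
    mlieBracket I (constField I x a) (constField I x c) x = 0 := by
  have h : ∀ a : E, mpullbackWithin 𝓘(ℝ, E) I (extChartAt I x).symm (constField I x a)
      (Set.range I) =ᶠ[𝓝 (extChartAt I x x)] fun _ ↦ a := by
    intro a
    filter_upwards [extChartAt_target_mem_nhds x] with z hz
    have hy : (extChartAt I x).symm z ∈ chartDom I x := by
      have := (extChartAt I x).map_target hz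
      rwa [extChartAt_source] at this
    rw [mpullbackWithin_apply, constField_eq_symmL hy, TangentBundle.symmL_trivializationAt hy,
      (extChartAt I x).right_inv hz]
    exact (isInvertible_mfderivWithin_extChartAt_symm hz).inverse_apply_self a
  have h' : ∀ {V W : E → E} {p : E}, V =ᶠ[𝓝 p] (fun _ ↦ a) → W =ᶠ[𝓝 p] (fun _ ↦ c) →
      lieBracketWithin ℝ V W Set.univ p = 0 := by
    intro V W p hV hW
    rw [lieBracketWithin_univ, hV.lieBracket_vectorField_eq hW]
    simp [lieBracket]
  rw [← mlieBracketWithin_univ, mlieBracketWithin_apply, Set.preimage_univ, Set.univ_inter]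
  have h2 := h' (h a) (h c)
  rw [← I.range_eq_univ] at h2
  exact (congrArg _ h2).trans (map_zero _)

/-- The extensions have constant coefficients, so both sides are second derivatives of `f` read in
the chart at `x`, and these are symmetric. -/
theorem mvfderiv_mvfderiv_extend_comm {f : M → ℝ} (hf : CMDiffAt ∞ f x) (u v : TangentSpace I x) :
    d% (fun y ↦ d% f y (extend E v y)) x u = d% (fun y ↦ d% f y (extend E u y)) x v := by
  have hx : x ∈ chartDom I x := mem_chartDom_self
  have hF := contDiffAt_comp_extChartAt_symm hx hf
  have hF' : ContDiffAt ℝ ∞ (fderiv ℝ (f ∘ (extChartAt I x).symm)) (extChartAt I x x) :=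
    hF.fderiv_right (by simp)
  have key : ∀ u v : TangentSpace I x, d% (fun y ↦ d% f y (extend E v y)) x u =
      fderiv ℝ (fderiv ℝ (f ∘ (extChartAt I x).symm)) (extChartAt I x x)
        (chartCoord I x x u) (chartCoord I x x v) := by
    intro u v
    set c := chartCoord I x x v with hc
    rw [extend_eq_constField v, ← hc]
    have h1 := (contMDiffAt_mvfderiv_constField hx hf c).mdifferentiableAt (by simp)
    conv_lhs => rw [← constField_chartCoord hx u, mvfderiv_constField hx h1]
    have h2 : (fun y ↦ d% f y (constField I x c y)) ∘ (extChartAt I x).symm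
        =ᶠ[𝓝 (extChartAt I x x)] fun p ↦ fderiv ℝ (f ∘ (extChartAt I x).symm) p c := by
      have hcont : Filter.Tendsto (extChartAt I x).symm (𝓝 (extChartAt I x x)) (𝓝 x) := by
        have := continuousAt_extChartAt_symm (I := I) x
        rwa [ContinuousAt, extChartAt_to_inv] at this
      have h3 : ∀ᶠ z in 𝓝 x, CMDiffAt 1 f z :=
        (contMDiffAt_iff_contMDiffAt_nhds (by simp)).1 (hf.of_le (by simp))
      filter_upwards [extChartAt_target_mem_nhds x, hcont.eventually h3] with z hz hz'
      have hy : (extChartAt I x).symm z ∈ chartDom I x := by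
        have := (extChartAt I x).map_target hz
        rwa [extChartAt_source] at this
      rw [Function.comp_apply, mvfderiv_constField hy (hz'.mdifferentiableAt (by simp)),
        (extChartAt I x).right_inv hz]
    rw [h2.fderiv_eq, fderiv_clm_apply (hF'.differentiableAt (by simp)) (by fun_prop)]
    simp
  rw [key, key]
  exact hF.isSymmSndFDerivAt (by rw [minSmoothness_of_isRCLikeNormedField]; exact ENat.LEInfty.out)
    _ _

/-- The curvature is skew-symmetric with respect to the metric. -/
theorem inner_curvatureOp_extend {W Z : Π x : M, TangentSpace I x} (hW : CMDiffAt ∞ (T% W) x)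
    (hZ : CMDiffAt ∞ (T% Z) x) (u v : TangentSpace I x) :
    inner ℝ (curvatureOp (extend E u) (extend E v) W x) (Z x) =
      -inner ℝ (W x) (curvatureOp (extend E u) (extend E v) Z x) := by
  have hx : x ∈ chartDom I x := mem_chartDom_self
  have hext : ∀ u : TangentSpace I x, CMDiffAt ∞ (T% (extend E u)) x := fun u ↦
    contMDiffAt_constField hx _
  have hbr : mlieBracket I (extend E u) (extend E v) x = 0 := mlieBracket_constField _ _
  have hmd : ∀ {X : Π x : M, TangentSpace I x}, CMDiffAt ∞ (T% X) x → MDiffAt (T% X) x :=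
    fun h ↦ h.mdifferentiableAt (by simp)
  have hmf : ∀ {f : M → ℝ}, CMDiffAt ∞ f x → MDiffAt f x := fun h ↦ h.mdifferentiableAt (by simp)
  -- The two mixed terms together are symmetric in `u` and `v`. Comparing the two orders of
  -- differentiation of `⟨W, Z⟩` therefore leaves only the curvature terms.
  have key : ∀ u v : TangentSpace I x,
      d% (fun y ↦ d% (fun z ↦ inner ℝ (W z) (Z z)) y (extend E v y)) x u =
      inner ℝ (leviCivita (fun y ↦ leviCivita W y (extend E v y)) x u) (Z x)
      + inner ℝ (leviCivita W x v) (leviCivita Z x u)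
      + (inner ℝ (leviCivita W x u) (leviCivita Z x v)
      + inner ℝ (W x) (leviCivita (fun y ↦ leviCivita Z y (extend E v y)) x u)) := by
    intro u v
    have h1 : (fun y ↦ d% (fun z ↦ inner ℝ (W z) (Z z)) y (extend E v y)) =ᶠ[𝓝 x]
        fun y ↦ inner ℝ (leviCivita W y (extend E v y)) (Z y)
          + inner ℝ (W y) (leviCivita Z y (extend E v y)) := by
      filter_upwards [eventually_mdifferentiableAt (hext v), eventually_mdifferentiableAt hW,
        eventually_mdifferentiableAt hZ] with y hv hw hz using leviCivita_metric hv hw hz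
    have hWv := contMDiffAt_leviCivita (hext v) hW
    have hZv := contMDiffAt_leviCivita (hext v) hZ
    have h2 := leviCivita_metric (hmd (hext u)) (hmd hWv) (hmd hZ)
    have h3 := leviCivita_metric (hmd (hext u)) (hmd hW) (hmd hZv)
    have h4 := mvfderiv_fun_add (hmf (contMDiffAt_inner hWv hZ)) (hmf (contMDiffAt_inner hW hZv))
    have h5 : d% (fun y ↦ d% (fun z ↦ (inner ℝ (W z) (Z z) : ℝ)) y (extend E v y)) x =
        d% (fun y ↦ (inner ℝ (leviCivita W y (extend E v y)) (Z y) : ℝ)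
          + inner ℝ (W y) (leviCivita Z y (extend E v y))) x := by
      exact Filter.EventuallyEq.mfderiv_eq (I' := 𝓘(ℝ, ℝ)) h1
    rw [h5, h4]
    simp only [extend_apply_self] at h2 h3 ⊢
    rw [add_apply, h2, h3]
  have h := mvfderiv_mvfderiv_extend_comm (contMDiffAt_inner hW hZ) u v
  rw [key, key] at h
  simp only [curvatureOp, hbr, map_zero, sub_zero, extend_apply_self, inner_sub_left,
    inner_sub_right]
  linarith

/-- The curvature in terms of the curvature operator on the coordinate fields. -/
theorem curvature_eq_sum (hx : x ∈ chartDom I x₀) {ι : Type*} [Fintype ι]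
    (b : Module.Basis ι ℝ E) (u v w : TangentSpace I x) :
    curvature u v w = ∑ k, ∑ j, ∑ i, (b.coord k (chartCoord I x₀ x w) *
      (b.coord j (chartCoord I x₀ x v) * b.coord i (chartCoord I x₀ x u))) •
      curvatureOp (constField I x₀ (b i)) (constField I x₀ (b j)) (constField I x₀ (b k)) x := by
  set e : ι → Π x : M, TangentSpace I x := fun i ↦ constField I x₀ (b i)
  have he : ∀ i, CMDiffAt ∞ (T% (e i)) x := fun i ↦ contMDiffAt_constField hx _
  have hed : ∀ i, MDiffAt (T% (e i)) x := fun i ↦ mdifferentiableAt_constField hx _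
  have hext : ∀ u : TangentSpace I x, CMDiffAt ∞ (T% (extend E u)) x := fun u ↦
    contMDiffAt_constField mem_chartDom_self _
  -- In the last slot two derivatives fall on the field. Skew-symmetry moves them to the other
  -- factor of the inner product, where `w` enters only through its value and can be expanded; a
  -- second use moves them back to the coordinate fields.
  have hlast : curvature u v w = ∑ k, b.coord k (chartCoord I x₀ x w) •
      curvatureOp (extend E u) (extend E v) (e k) x := by
    refine ext_inner_right ℝ fun z ↦ ?_
    have h1 := inner_curvatureOp_extend (hext w) (hext z) u v
    rw [extend_apply_self, extend_apply_self] at h1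
    rw [curvature_eq_curvatureOp, h1, sum_inner]
    conv_lhs => rw [← sum_coord_smul_constField hx b w, sum_inner, ← Finset.sum_neg_distrib]
    refine Finset.sum_congr rfl fun k _ ↦ ?_
    have h2 := inner_curvatureOp_extend (he k) (hext z) u v
    rw [extend_apply_self] at h2
    rw [inner_smul_left, inner_smul_left, h2]
    simp [e]
  have hfirst : ∀ (Y W : Π x : M, TangentSpace I x), CMDiffAt ∞ (T% W) x →
      ∀ u : TangentSpace I x, curvatureOp (extend E u) Y W x =
        ∑ i, b.coord i (chartCoord I x₀ x u) • curvatureOp (e i) Y W x := by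
    intro Y W hW u
    have hT := tensorialAt_curvatureOp (Y := Y) hW
    have h1 := hT.mkHom_apply_eq_extend u
    rw [← h1]
    conv_lhs => rw [← sum_coord_smul_constField hx b u, map_sum]
    refine Finset.sum_congr rfl fun i _ ↦ ?_
    rw [map_smul]
    congr 1
    exact hT.mkHom_apply (hed i)
  rw [hlast]
  refine Finset.sum_congr rfl fun k _ ↦ ?_
  rw [curvatureOp_swap, hfirst _ _ (he k), ← Finset.sum_neg_distrib,
    Finset.smul_sum]
  refine Finset.sum_congr rfl fun j _ ↦ ?_
  rw [← smul_neg, ← curvatureOp_swap, hfirst _ _ (he k), Finset.smul_sum, Finset.smul_sum]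
  refine Finset.sum_congr rfl fun i _ ↦ ?_
  rw [smul_smul, smul_smul, mul_assoc]

/-- The curvature is locally bounded. -/
theorem exists_norm_curvature_le (x₀ : M) :
    ∃ C : ℝ, ∀ᶠ x in 𝓝 x₀, ∀ u v w : TangentSpace I x,
      ‖curvature u v w‖ ≤ C * ‖u‖ * ‖v‖ * ‖w‖ := by
  have hx₀ : x₀ ∈ chartDom I x₀ := mem_chartDom_self
  set b := Module.finBasis ℝ E
  set L : Fin (Module.finrank ℝ E) → E →L[ℝ] ℝ := fun i ↦ LinearMap.toContinuousLinearMap (b.coord i)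
  have : IsContinuousRiemannianBundle E (fun x : M ↦ TangentSpace I x) := by
    obtain ⟨g, hg, hg'⟩ := IsContMDiffRiemannianBundle.exists_contMDiff (IB := I) (n := ∞) (F := E)
      (E := fun x : M ↦ TangentSpace I x)
    exact ⟨g, hg.continuous, hg'⟩
  obtain ⟨A, hA, hAx⟩ := eventually_norm_trivializationAt_lt E (fun x : M ↦ TangentSpace I x) x₀
  set K : Fin (Module.finrank ℝ E) → Fin (Module.finrank ℝ E) → Fin (Module.finrank ℝ E) →
      Π x : M, TangentSpace I x := fun i j k ↦
    curvatureOp (constField I x₀ (b i)) (constField I x₀ (b j)) (constField I x₀ (b k))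
  have hK : ∀ i j k, ∀ᶠ x in 𝓝 x₀, ‖K i j k x‖ ≤ 1 + ‖K i j k x₀‖ := by
    intro i j k
    have hs : CMDiffAt ∞ (T% (K i j k)) x₀ := contMDiffAt_curvatureOp
      (contMDiffAt_constField hx₀ _) (contMDiffAt_constField hx₀ _) (contMDiffAt_constField hx₀ _)
    have hc : ContinuousAt (fun x ↦ ‖K i j k x‖) x₀ := by
      have := (contMDiffAt_inner hs hs).continuousAt.sqrt
      simpa [real_inner_self_eq_norm_sq, Real.sqrt_sq] using this
    have := hc.eventually (gt_mem_nhds (lt_one_add ‖K i j k x₀‖))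
    exact this.mono fun x hx ↦ le_of_lt hx
  refine ⟨∑ k, ∑ j, ∑ i, (‖L k‖ * A) * ((‖L j‖ * A) * (‖L i‖ * A)) * (1 + ‖K i j k x₀‖), ?_⟩
  have hK' := Filter.eventually_all.2 fun i ↦ Filter.eventually_all.2 fun j ↦
    Filter.eventually_all.2 fun k ↦ hK i j k
  filter_upwards [hAx, chartDom_mem_nhds hx₀, hK'] with x hAx hx hK u v w
  have hL : ∀ i (u : TangentSpace I x), |L i (chartCoord I x₀ x u)| ≤ ‖L i‖ * A * ‖u‖ := by
    intro i u
    rw [← Real.norm_eq_abs, mul_assoc]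
    refine (L i).le_opNorm_of_le ?_
    rw [chartCoord_eq_continuousLinearMapAt hx]
    exact (ContinuousLinearMap.le_opNorm _ _).trans
      (mul_le_mul_of_nonneg_right hAx.le (norm_nonneg _))
  rw [curvature_eq_sum hx b, Finset.sum_mul, Finset.sum_mul, Finset.sum_mul]
  refine norm_sum_le_of_le _ fun k _ ↦ ?_
  rw [Finset.sum_mul, Finset.sum_mul, Finset.sum_mul]
  refine norm_sum_le_of_le _ fun j _ ↦ ?_
  rw [Finset.sum_mul, Finset.sum_mul, Finset.sum_mul]
  refine norm_sum_le_of_le _ fun i _ ↦ ?_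
  rw [norm_smul, Real.norm_eq_abs, abs_mul, abs_mul]
  calc _ ≤ ((‖L k‖ * A * ‖w‖) * ((‖L j‖ * A * ‖v‖) * (‖L i‖ * A * ‖u‖))) * (1 + ‖K i j k x₀‖) := by
        gcongr
        · exact hL k w
        · exact hL j v
        · exact hL i u
        · exact hK i j k
    _ = _ := by ring

end Geometry

/-! ### Uniqueness of Jacobi fields -/

/-- Grönwall in both directions of time: `f * exp (-K r)` is nonincreasing, which handles parameters
after `t₀`, and `f * exp (K r)` is nondecreasing, which handles those before. -/
theorem eq_zero_of_abs_deriv_le_mul {f f' : ℝ → ℝ} {a b K t₀ : ℝ}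
    (hf : ∀ t ∈ Set.Icc a b, HasDerivWithinAt f (f' t) (Set.Icc a b) t)
    (hf' : ∀ t ∈ Set.Icc a b, |f' t| ≤ K * f t) (h0 : ∀ t ∈ Set.Icc a b, 0 ≤ f t)
    (ht₀ : t₀ ∈ Set.Icc a b) (hft₀ : f t₀ = 0) : ∀ t ∈ Set.Icc a b, f t = 0 := by
  have hexp : ∀ c t : ℝ, HasDerivAt (fun r ↦ Real.exp (c * r)) (Real.exp (c * t) * c) t :=
    fun c t ↦ by simpa using ((hasDerivAt_id t).const_mul c).exp
  have hd : ∀ c, ∀ t ∈ Set.Icc a b, HasDerivWithinAt (fun r ↦ f r * Real.exp (c * r))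
      (f' t * Real.exp (c * t) + f t * (Real.exp (c * t) * c)) (Set.Icc a b) t :=
    fun c t ht ↦ (hf t ht).mul (hexp c t).hasDerivWithinAt
  have hcont : ∀ c, ContinuousOn (fun r ↦ f r * Real.exp (c * r)) (Set.Icc a b) :=
    fun c t ht ↦ (hd c t ht).continuousWithinAt
  have hanti : AntitoneOn (fun r ↦ f r * Real.exp (-K * r)) (Set.Icc a b) := by
    refine antitoneOn_of_hasDerivWithinAt_nonpos (convex_Icc a b) (hcont _)
      (fun t ht ↦ (hd _ t (interior_subset ht)).mono interior_subset) fun t ht ↦ ?_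
    have := (abs_le.1 (hf' t (interior_subset ht))).2
    nlinarith [Real.exp_pos (-K * t)]
  have hmono : MonotoneOn (fun r ↦ f r * Real.exp (K * r)) (Set.Icc a b) := by
    refine monotoneOn_of_hasDerivWithinAt_nonneg (convex_Icc a b) (hcont _)
      (fun t ht ↦ (hd _ t (interior_subset ht)).mono interior_subset) fun t ht ↦ ?_
    have := (abs_le.1 (hf' t (interior_subset ht))).1
    nlinarith [Real.exp_pos (K * t)]
  intro t ht
  refine le_antisymm ?_ (h0 t ht)
  rcases le_total t₀ t with h | h
  · have := hanti ht₀ ht h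
    simp only [hft₀, zero_mul] at this
    exact nonpos_of_mul_nonpos_left this (Real.exp_pos _)
  · have := hmono ht ht₀ h
    simp only [hft₀, zero_mul] at this
    exact nonpos_of_mul_nonpos_left this (Real.exp_pos _)

section Geometry

variable {E : Type*} [NormedAddCommGroup E] [NormedSpace ℝ E]
  {H : Type*} [TopologicalSpace H] {I : ModelWithCorners ℝ E H}
  {M : Type*} [TopologicalSpace M] [ChartedSpace H M]
  [RiemannianBundle (fun x : M ↦ TangentSpace I x)]
  [FiniteDimensional ℝ E] [CompleteSpace E] [IsManifold I ∞ M]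
  [IsContMDiffRiemannianBundle I ∞ E (fun x : M ↦ TangentSpace I x)]
  [I.Boundaryless] {γ : ℝ → M} {a b : ℝ}

set_option linter.unusedSectionVars false

/-- The curvature is bounded along a curve of unit speed defined on a compact interval. -/
theorem exists_norm_curvature_velocity_le (hγ : ContMDiffOn 𝓘(ℝ, ℝ) I ∞ γ (Set.Icc a b))
    (hunit : ∀ t, ‖velocity I γ (Set.Icc a b) t‖ = 1) :
    ∃ C : ℝ, 0 ≤ C ∧ ∀ (t : Set.Icc a b) (u : TangentSpace I (γ t)),
      ‖curvature u (velocity I γ (Set.Icc a b) t) (velocity I γ (Set.Icc a b) t)‖ ≤ C * ‖u‖ := by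
  have h := isCompact_Icc.induction_on (s := Set.Icc a b)
    (p := fun K ↦ ∃ C : ℝ, 0 ≤ C ∧ ∀ (t : Set.Icc a b) (u : TangentSpace I (γ t)), (t : ℝ) ∈ K →
      ‖curvature u (velocity I γ (Set.Icc a b) t) (velocity I γ (Set.Icc a b) t)‖ ≤ C * ‖u‖)
    ⟨0, le_rfl, fun t u ht ↦ by simp at ht⟩ (fun K K' hK ⟨C, h0, hC⟩ ↦
      ⟨C, h0, fun t u ht ↦ hC t u (hK ht)⟩) ?_ ?_
  · obtain ⟨C, h0, hC⟩ := h
    exact ⟨C, h0, fun t u ↦ hC t u t.2⟩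
  · rintro K K' ⟨C, h0, hC⟩ ⟨C', h0', hC'⟩
    refine ⟨max C C', le_max_of_le_left h0, fun t u ht ↦ ?_⟩
    rcases ht with ht | ht
    · exact (hC t u ht).trans (mul_le_mul_of_nonneg_right (le_max_left _ _) (norm_nonneg _))
    · exact (hC' t u ht).trans (mul_le_mul_of_nonneg_right (le_max_right _ _) (norm_nonneg _))
  · intro t ht
    obtain ⟨C, hC⟩ := exists_norm_curvature_le (I := I) (γ t)
    refine ⟨_, (hγ t ht).continuousWithinAt.eventually hC, max C 0, le_max_right _ _,
      fun r u hr ↦ ?_⟩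
    have := hr u (velocity I γ (Set.Icc a b) r) (velocity I γ (Set.Icc a b) r)
    rw [hunit r, mul_one, mul_one] at this
    exact this.trans (mul_le_mul_of_nonneg_right (le_max_left _ _) (norm_nonneg _))

/-- A Jacobi field that vanishes at some parameter together with its derivative is zero. -/
theorem FieldAlong.IsJacobi.eq_zero (hab : a < b)
    (hγ : ContMDiffOn 𝓘(ℝ, ℝ) I ∞ γ (Set.Icc a b))
    (hunit : ∀ t, ‖velocity I γ (Set.Icc a b) t‖ = 1) {J : FieldAlong I γ (Set.Icc a b)}
    (hJ : J.IsJacobi) (t₀ : Set.Icc a b) (h0 : J t₀ = 0) (h0' : J.covDeriv t₀ = 0) : J = 0 := by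
  have hs : UniqueDiffOn ℝ (Set.Icc a b) := uniqueDiffOn_Icc hab
  obtain ⟨C, hC0, hC⟩ := exists_norm_curvature_velocity_le hγ hunit
  have hJ' := hJ.1.covDeriv hγ hs
  set f : ℝ → ℝ := fun r ↦ inner ℝ (J.ext r) (J.ext r)
    + inner ℝ (J.covDeriv.ext r) (J.covDeriv.ext r)
  set f' : ℝ → ℝ := fun r ↦ (inner ℝ (J.covDeriv.ext r) (J.ext r)
      + inner ℝ (J.ext r) (J.covDeriv.ext r))
    + (inner ℝ (J.covDeriv.covDeriv.ext r) (J.covDeriv.ext r)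
      + inner ℝ (J.covDeriv.ext r) (J.covDeriv.covDeriv.ext r))
  have hf : ∀ t ∈ Set.Icc a b, HasDerivWithinAt f (f' t) (Set.Icc a b) t := by
    intro t ht
    have h1 := FieldAlong.hasDerivWithinAt_inner hγ hs hJ.1 hJ.1 ⟨t, ht⟩
    have h2 := FieldAlong.hasDerivWithinAt_inner hγ hs hJ' hJ' ⟨t, ht⟩
    simp only [f', FieldAlong.ext_of_mem _ ht]
    exact h1.add h2
  have hfz : ∀ t ∈ Set.Icc a b, f t = 0 := by
    -- Here `|f'| ≤ 2 ‖J‖ ‖J'‖ + 2 ‖J'‖ ‖J''‖` and `‖J''‖ ≤ C ‖J‖` by the Jacobi equation, so `|f'|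
    -- ≤ (1 + C) * 2 ‖J‖ ‖J'‖ ≤ (1 + C) f`.
    refine eq_zero_of_abs_deriv_le_mul (K := 1 + C) hf (fun t ht ↦ ?_) (fun t ht ↦ ?_) t₀.2 ?_
    · have hR := hC ⟨t, ht⟩ (J ⟨t, ht⟩)
      have hJac := hJ.2 ⟨t, ht⟩
      have hnorm : ‖J.covDeriv.covDeriv ⟨t, ht⟩‖ ≤ C * ‖J ⟨t, ht⟩‖ := by
        rw [eq_neg_of_add_eq_zero_left hJac, norm_neg]
        exact hR
      simp only [f, f', FieldAlong.ext_of_mem _ ht]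
      set p := J ⟨t, ht⟩
      set q := J.covDeriv ⟨t, ht⟩
      set w := J.covDeriv.covDeriv ⟨t, ht⟩
      rw [real_inner_comm p q, real_inner_comm q w, real_inner_self_eq_norm_sq,
        real_inner_self_eq_norm_sq]
      have e1 := abs_real_inner_le_norm p q
      have e2 := abs_real_inner_le_norm q w
      have e3 : ‖q‖ * ‖w‖ ≤ ‖q‖ * (C * ‖p‖) := mul_le_mul_of_nonneg_left hnorm (norm_nonneg _)
      have e4 : 2 * (‖p‖ * ‖q‖) ≤ ‖p‖ ^ 2 + ‖q‖ ^ 2 := by nlinarith [sq_nonneg (‖p‖ - ‖q‖)]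
      have e5 := mul_le_mul_of_nonneg_left e4 hC0
      rw [abs_le] at e1 e2 ⊢
      constructor <;> nlinarith
    · exact add_nonneg real_inner_self_nonneg real_inner_self_nonneg
    · simp [f, FieldAlong.ext_apply, h0, h0']
  funext t
  have h := hfz t t.2
  simp only [f, FieldAlong.ext_apply] at h
  have h1 : inner ℝ (J t) (J t) = 0 := by
    have := real_inner_self_nonneg (x := J t)
    have := real_inner_self_nonneg (x := J.covDeriv t)
    linarith
  exact inner_self_eq_zero.1 h1

end Geometry

/-! ### Families of Jacobi fields as Riccati families -/

/-- A symmetric operator with eigenvalues at most `c` is bounded above by `c`. -/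
theorem inner_apply_le_of_hasEigenvalue_le {F : Type*} [NormedAddCommGroup F]
    [InnerProductSpace ℝ F] [FiniteDimensional ℝ F] {T : Module.End ℝ F} (hT : T.IsSymmetric)
    {c : ℝ} (hc : ∀ μ : ℝ, T.HasEigenvalue μ → μ ≤ c) (v : F) :
    inner ℝ (T v) v ≤ c * ‖v‖ ^ 2 := by
  set e := hT.eigenvectorBasis rfl
  have h1 : inner ℝ (T v) v = ∑ i, hT.eigenvalues rfl i * (e.repr v i) ^ 2 := by
    rw [← e.repr.inner_map_map, PiLp.inner_apply]
    refine Finset.sum_congr rfl fun i _ ↦ ?_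
    rw [hT.eigenvectorBasis_apply_self_apply rfl v i]
    simp only [RCLike.inner_apply, conj_trivial, RCLike.ofReal_real_eq_id, id]
    ring
  have h2 : ‖v‖ ^ 2 = ∑ i, (e.repr v i) ^ 2 := by
    rw [← e.repr.norm_map, EuclideanSpace.norm_sq_eq]
    simp
  rw [h1, h2, Finset.mul_sum]
  exact Finset.sum_le_sum fun i _ ↦
    mul_le_mul_of_nonneg_right (hc _ (hT.hasEigenvalue_eigenvalues rfl i)) (sq_nonneg _)

section Geometry

variable {E : Type*} [NormedAddCommGroup E] [NormedSpace ℝ E]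
  {H : Type*} [TopologicalSpace H] {I : ModelWithCorners ℝ E H}
  {M : Type*} [TopologicalSpace M] [ChartedSpace H M]
  [RiemannianBundle (fun x : M ↦ TangentSpace I x)]
  [FiniteDimensional ℝ E] [CompleteSpace E] [IsManifold I ∞ M]
  [IsContMDiffRiemannianBundle I ∞ E (fun x : M ↦ TangentSpace I x)]
  [I.Boundaryless] {γ : ℝ → M} {s : Set ℝ} {α : ℝ}

set_option linter.unusedSectionVars false

/-- Evaluation of the fields of a family at a parameter. -/
def evalMap (Λ : Submodule ℝ (FieldAlong I γ s)) (t : ℝ) : Λ →ₗ[ℝ] TangentSpace I (γ t) where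
  toFun J := (J : FieldAlong I γ s).ext t
  map_add' _ _ := FieldAlong.ext_add _ _ t
  map_smul' c _ := FieldAlong.ext_smul c _ t

/-- Evaluation of the covariant derivatives of the fields of a family at a parameter. -/
def evalDerivMap (hγ : ContMDiffOn 𝓘(ℝ, ℝ) I ∞ γ s) (hs : UniqueDiffOn ℝ s)
    {Λ : Submodule ℝ (FieldAlong I γ s)} (hΛ : ∀ J ∈ Λ, J.IsSmooth) (t : ℝ) :
    Λ →ₗ[ℝ] TangentSpace I (γ t) where
  toFun J := (J : FieldAlong I γ s).covDeriv.ext t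
  map_add' J K := by
    rw [← FieldAlong.ext_add, ← FieldAlong.covDeriv_add hγ hs (hΛ J J.2) (hΛ K K.2)]
    rfl
  map_smul' c J := by
    rw [RingHom.id_apply, ← FieldAlong.ext_smul, ← FieldAlong.covDeriv_smul hγ hs c (hΛ J J.2)]
    rfl

theorem evalMap_apply {Λ : Submodule ℝ (FieldAlong I γ s)} {t : ℝ} (ht : t ∈ s) (J : Λ) :
    evalMap Λ t J = (J : FieldAlong I γ s) ⟨t, ht⟩ :=
  FieldAlong.ext_of_mem _ ht

theorem evalDerivMap_apply (hγ : ContMDiffOn 𝓘(ℝ, ℝ) I ∞ γ s) (hs : UniqueDiffOn ℝ s)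
    {Λ : Submodule ℝ (FieldAlong I γ s)} (hΛ : ∀ J ∈ Λ, J.IsSmooth) {t : ℝ} (ht : t ∈ s) (J : Λ) :
    evalDerivMap hγ hs hΛ t J = (J : FieldAlong I γ s).covDeriv ⟨t, ht⟩ :=
  FieldAlong.ext_of_mem _ ht

/-- The derivative of a normal field along a geodesic is normal. -/
theorem FieldAlong.IsNormal.covDeriv (hγ : IsGeodesicOn I γ s) (hs : UniqueDiffOn ℝ s)
    {V : FieldAlong I γ s} (hV : V.IsSmooth) (hVn : V.IsNormal) : V.covDeriv.IsNormal := by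
  intro t
  have h1 := FieldAlong.hasDerivWithinAt_inner hγ.1 hs hV (isSmooth_velocity hγ.1 hs) t
  rw [hγ.2] at h1
  have h2 : HasDerivWithinAt (fun r ↦ (inner ℝ (V.ext r) ((velocity I γ s).ext r) : ℝ)) 0 s t := by
    refine (hasDerivWithinAt_const (t : ℝ) s (0 : ℝ)).congr_of_mem (fun r hr ↦ ?_) t.2
    rw [FieldAlong.ext_of_mem _ hr, FieldAlong.ext_of_mem _ hr]
    exact hVn ⟨r, hr⟩
  have h3 := (hs t t.2).eq_deriv _ h1 h2
  simpa using h3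

theorem mem_normalSpace_iff {t : s} {v : TangentSpace I (γ t)} :
    v ∈ normalSpace I γ s t ↔ inner ℝ v (velocity I γ s t) = 0 := by
  rw [normalSpace, Submodule.mem_orthogonal_singleton_iff_inner_left]

theorem finrank_normalSpace {t : s} (h : velocity I γ s t ≠ 0) :
    Module.finrank ℝ (normalSpace I γ s t) + 1 = Module.finrank ℝ E := by
  have h1 := Submodule.finrank_add_finrank_orthogonal (Submodule.span ℝ {velocity I γ s t})
  rw [finrank_span_singleton h, add_comm] at h1
  exact h1

/-- A lower bound on the sectional curvature bounds the curvature term of the Jacobi equation. -/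
theorem sq_norm_le_inner_curvature {x : M}
    (hsec : ∀ u v : TangentSpace I x, LinearIndependent ℝ ![u, v] → 1 ≤ sectionalCurvature u v)
    {u v : TangentSpace I x} (hv : ‖v‖ = 1) (huv : inner ℝ u v = 0) :
    ‖u‖ ^ 2 ≤ inner ℝ (curvature u v v) u := by
  rcases eq_or_ne u 0 with rfl | hu
  · simp
  have hv0 : v ≠ 0 := by rintro rfl; simp at hv
  have hind : LinearIndependent ℝ ![u, v] := by
    rw [LinearIndependent.pair_iff]
    intro a b hab
    have h1 : inner ℝ (a • u + b • v) u = 0 := by rw [hab, inner_zero_left]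
    have h2 : inner ℝ (a • u + b • v) v = 0 := by rw [hab, inner_zero_left]
    rw [inner_add_left, inner_smul_left, inner_smul_left, real_inner_comm u v, huv] at h1
    rw [inner_add_left, inner_smul_left, inner_smul_left, huv] at h2
    simp only [conj_trivial, mul_zero, add_zero, zero_add, mul_eq_zero, inner_self_eq_zero] at h1 h2
    exact ⟨h1.resolve_right hu, h2.resolve_right hv0⟩
  have h := hsec u v hind
  rw [sectionalCurvature, hv, huv] at h
  have hpos : 0 < ‖u‖ ^ 2 := by positivity
  rw [one_pow, mul_one, zero_pow two_ne_zero, sub_zero, le_div_iff₀ hpos, one_mul] at h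
  exact h

variable {Λ : Submodule ℝ (FieldAlong I γ (Set.Icc α Real.pi))}

/-- A space of Jacobi fields is finite dimensional, since Jacobi fields are determined by their
initial values. -/
theorem finiteDimensional_of_isJacobi (hα : α < Real.pi)
    (hγ : ContMDiffOn 𝓘(ℝ, ℝ) I ∞ γ (Set.Icc α Real.pi))
    (hunit : ∀ t, ‖velocity I γ (Set.Icc α Real.pi) t‖ = 1) (hΛ : ∀ J ∈ Λ, J.IsJacobi) :
    FiniteDimensional ℝ Λ := by
  have hs := uniqueDiffOn_Icc hα
  have hmem : α ∈ Set.Icc α Real.pi := Set.left_mem_Icc.2 hα.le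
  refine Module.Finite.of_injective
    ((evalMap Λ α).prod (evalDerivMap hγ hs (fun J hJ ↦ (hΛ J hJ).1) α))
    ((injective_iff_map_eq_zero _).2 fun J hJ ↦ ?_)
  replace hJ := Prod.mk_eq_zero.1 hJ
  rw [evalMap_apply hmem, evalDerivMap_apply hγ hs _ hmem] at hJ
  exact Subtype.ext ((hΛ J J.2).eq_zero hα hγ hunit ⟨α, hmem⟩ hJ.1 hJ.2)

/-- With `-⟨J'', K⟩` as curvature form, the derivative formulas are metric compatibility together
with self-adjointness. The Jacobi equation enters through `le_curv` and through uniqueness. The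
decomposition is a dimension count: the values at `t` and the derivatives of the fields vanishing at
`t` span orthogonal subspaces of `γ'^⊥`, with dimensions adding up to that of `Λ`. -/
theorem isRiccatiFamily (hα : α < Real.pi)
    (hsec : ∀ (x : M) (u v : TangentSpace I x),
      LinearIndependent ℝ ![u, v] → 1 ≤ sectionalCurvature u v)
    (hγ : IsGeodesicOn I γ (Set.Icc α Real.pi))
    (hunit : ∀ t, ‖velocity I γ (Set.Icc α Real.pi) t‖ = 1)
    (hΛ : ∀ J ∈ Λ, J.IsJacobi ∧ J.IsNormal)
    (hdim : Module.finrank ℝ Λ + 1 = Module.finrank ℝ E) (hself : RiccatiSelfAdjoint Λ) :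
    IsRiccatiFamily α (evalMap Λ)
      (evalDerivMap hγ.1 (uniqueDiffOn_Icc hα) fun J hJ ↦ (hΛ J hJ).1.1)
      (fun t J K ↦ -inner ℝ ((J : FieldAlong I γ (Set.Icc α Real.pi)).covDeriv.covDeriv.ext t) (evalMap Λ t K)) := by
  have hs := uniqueDiffOn_Icc hα
  have hsm : ∀ J ∈ Λ, J.IsSmooth := fun J hJ ↦ (hΛ J hJ).1.1
  have hself' : ∀ t ∈ Set.Icc α Real.pi, ∀ J K : Λ,
      inner ℝ (evalDerivMap hγ.1 hs hsm t J) (evalMap Λ t K) =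
        inner ℝ (evalMap Λ t J) (evalDerivMap hγ.1 hs hsm t K) := by
    intro t ht J K
    rw [evalMap_apply ht, evalMap_apply ht, evalDerivMap_apply _ _ _ ht,
      evalDerivMap_apply _ _ _ ht]
    exact hself J J.2 K K.2 ⟨t, ht⟩
  have hzero : ∀ t ∈ Set.Icc α Real.pi, ∀ J : Λ, evalMap Λ t J = 0 →
      evalDerivMap hγ.1 hs hsm t J = 0 → J = 0 := by
    intro t ht J h h'
    rw [evalMap_apply ht] at h
    rw [evalDerivMap_apply _ _ _ ht] at h'
    exact Subtype.ext ((hΛ J J.2).1.eq_zero hα hγ.1 hunit ⟨t, ht⟩ h h')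
  have := finiteDimensional_of_isJacobi hα hγ.1 hunit fun J hJ ↦ (hΛ J hJ).1
  refine
    { selfAdjoint := hself'
      hasDeriv_inner := fun t ht J K ↦ ?_
      hasDeriv_inner' := fun t ht J K ↦ ?_
      continuous_norm' := fun J t ht ↦ ?_
      le_curv := fun t ht J ↦ ?_
      curv_zero := fun t ht J hJ ↦ by simp only [hJ, inner_zero_right, neg_zero]
      eq_zero := hzero
      exists_decomp := fun t ht J ↦ ?_ }
  · refine (FieldAlong.hasDerivWithinAt_inner hγ.1 hs (hsm J J.2) (hsm K K.2)
      ⟨t, ht⟩).congr_deriv ?_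
    have := hself' t ht J K
    rw [evalMap_apply ht, evalMap_apply ht, evalDerivMap_apply _ _ _ ht,
      evalDerivMap_apply _ _ _ ht] at this
    rw [evalMap_apply ht, evalDerivMap_apply _ _ _ ht, ← this]
    ring
  · refine (FieldAlong.hasDerivWithinAt_inner hγ.1 hs ((hsm J J.2).covDeriv hγ.1 hs) (hsm K K.2)
      ⟨t, ht⟩).congr_deriv ?_
    rw [evalMap_apply ht, evalDerivMap_apply _ _ _ ht, evalDerivMap_apply _ _ _ ht,
      FieldAlong.ext_of_mem _ ht]
    ring
  · have h1 := (FieldAlong.hasDerivWithinAt_inner hγ.1 hs ((hsm J J.2).covDeriv hγ.1 hs)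
      ((hsm J J.2).covDeriv hγ.1 hs) ⟨t, ht⟩).continuousWithinAt
    simp only [real_inner_self_eq_norm_sq] at h1
    exact h1
  · simp only [evalMap_apply ht, FieldAlong.ext_of_mem _ ht]
    have hJ := hΛ J J.2
    rw [eq_neg_of_add_eq_zero_left (hJ.1.2 ⟨t, ht⟩), inner_neg_left, neg_neg]
    exact sq_norm_le_inner_curvature (hsec _) (hunit _) (hJ.2 ⟨t, ht⟩)
  · set A := LinearMap.range (evalMap Λ t)
    set Kr := LinearMap.ker (evalMap Λ t)
    set B := Kr.map (evalDerivMap hγ.1 hs hsm t)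
    set N := normalSpace I γ (Set.Icc α Real.pi) ⟨t, ht⟩
    have hDN : ∀ J : Λ, evalDerivMap hγ.1 hs hsm t J ∈ N := by
      intro J
      rw [evalDerivMap_apply _ _ _ ht]
      exact mem_normalSpace_iff.2 (FieldAlong.IsNormal.covDeriv hγ hs (hsm J J.2) (hΛ J J.2).2 _)
    have hAN : A ≤ N := by
      rintro _ ⟨J, rfl⟩
      rw [evalMap_apply ht]
      exact mem_normalSpace_iff.2 ((hΛ J J.2).2 _)
    have hBN : B ≤ N := by
      rintro _ ⟨J, _, rfl⟩
      exact hDN J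
    have hdisj : A ⊓ B = ⊥ := by
      rw [Submodule.eq_bot_iff]
      rintro _ ⟨⟨L, rfl⟩, ⟨K, hK, hKL⟩⟩
      have h1 := hself' t ht K L
      rw [show evalMap Λ t K = 0 from hK, inner_zero_left, hKL] at h1
      exact inner_self_eq_zero.1 h1
    have hfin : Module.finrank ℝ (A ⊔ B : Submodule ℝ (TangentSpace I (γ t)))
        = Module.finrank ℝ N := by
      have e1 := Submodule.finrank_sup_add_finrank_inf_eq A B
      rw [hdisj, finrank_bot, add_zero] at e1
      have e2 : Module.finrank ℝ A + Module.finrank ℝ Kr = Module.finrank ℝ Λ :=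
        LinearMap.finrank_range_add_finrank_ker _
      have e3 : Module.finrank ℝ B = Module.finrank ℝ Kr := by
        rw [show B = LinearMap.range ((evalDerivMap hγ.1 hs hsm t).domRestrict Kr) from
          (LinearMap.range_domRestrict _ _).symm]
        refine LinearMap.finrank_range_of_inj ((injective_iff_map_eq_zero _).2 fun K hK ↦ ?_)
        exact Subtype.ext (hzero t ht K K.2 hK)
      have e4 : Module.finrank ℝ N + 1 = Module.finrank ℝ E := finrank_normalSpace (I := I) (γ := γ) (t := ⟨t, ht⟩) (s := Set.Icc α Real.pi)
        (by intro h; have := hunit ⟨t, ht⟩; rw [h, norm_zero] at this; exact zero_ne_one this)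
      omega
    have hsup : A ⊔ B = N := Submodule.eq_of_le_of_finrank_eq (sup_le hAN hBN) hfin
    have hJ := hDN J
    rw [← hsup, Submodule.mem_sup] at hJ
    obtain ⟨_, ⟨L, rfl⟩, _, ⟨K, hK, rfl⟩, hLK⟩ := hJ
    exact ⟨L, K, hK, hLK.symm⟩

/-- The hypothesis on the Riccati operator at the left end of the interval. -/
theorem riccati_left (hα : α < Real.pi) (hγ : IsGeodesicOn I γ (Set.Icc α Real.pi))
    (hunit : ∀ t, ‖velocity I γ (Set.Icc α Real.pi) t‖ = 1)
    (hΛ : ∀ J ∈ Λ, J.IsJacobi ∧ J.IsNormal)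
    (hdim : Module.finrank ℝ Λ + 1 = Module.finrank ℝ E) (hself : RiccatiSelfAdjoint Λ) {c : ℝ}
    {S : Module.End ℝ (normalSpace I γ (Set.Icc α Real.pi) ⟨α, Set.left_mem_Icc.2 hα.le⟩)}
    (hS : IsRiccatiOperator Λ ⟨α, Set.left_mem_Icc.2 hα.le⟩ S)
    (hc : ∀ μ : ℝ, S.HasEigenvalue μ → μ ≤ c) :
    (∀ J : Λ, evalMap Λ α J = 0 → J = 0) ∧
      ∀ J : Λ, inner ℝ (evalDerivMap hγ.1 (uniqueDiffOn_Icc hα) (fun J hJ ↦ (hΛ J hJ).1.1) α J)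
        (evalMap Λ α J) ≤ c * ‖evalMap Λ α J‖ ^ 2 := by
  have hmem : α ∈ Set.Icc α Real.pi := Set.left_mem_Icc.2 hα.le
  have hinj : ∀ J : Λ, evalMap Λ α J = 0 → J = 0 := by
    intro J hJ
    rw [evalMap_apply hmem] at hJ
    have h1 := hS J J.2 0 hJ.symm
    rw [map_zero] at h1
    exact Subtype.ext ((hΛ J J.2).1.eq_zero hα hγ.1 hunit ⟨α, hmem⟩ hJ h1.symm)
  refine ⟨hinj, ?_⟩
  let N := normalSpace I γ (Set.Icc α Real.pi) ⟨α, hmem⟩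
  have hAN : ∀ J : Λ, (J : FieldAlong I γ (Set.Icc α Real.pi)) ⟨α, hmem⟩ ∈ N := fun J ↦
    mem_normalSpace_iff.2 ((hΛ J J.2).2 _)
  -- Self-adjointness is known only on values of fields in `Λ`. By dimension these fill the normal
  -- space, so `S` is symmetric and the spectral theorem applies.
  have hsurj : ∀ v : N, ∃ J : Λ, (v : TangentSpace I (γ α)) = (J : FieldAlong I γ (Set.Icc α Real.pi)) ⟨α, hmem⟩ := by
    have h1 : LinearMap.range (evalMap Λ α) = N := by
      refine Submodule.eq_of_le_of_finrank_eq ?_ ?_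
      · rintro _ ⟨J, rfl⟩
        rw [evalMap_apply hmem]
        exact hAN J
      · have e1 := LinearMap.finrank_range_of_inj ((injective_iff_map_eq_zero _).2 hinj)
        have e4 : Module.finrank ℝ N + 1 = Module.finrank ℝ E := finrank_normalSpace (I := I) (γ := γ) (t := ⟨α, hmem⟩) (s := Set.Icc α Real.pi)
          (by intro h; have := hunit ⟨α, hmem⟩; rw [h, norm_zero] at this; exact zero_ne_one this)
        exact e1.trans (Nat.add_right_cancel (hdim.trans e4.symm))
    intro v
    have h2 : (v : TangentSpace I (γ α)) ∈ LinearMap.range (evalMap Λ α) := by rw [h1]; exact v.2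
    obtain ⟨J, hJ⟩ := h2
    exact ⟨J, by rw [← hJ, evalMap_apply hmem]⟩
  have hsymm : S.IsSymmetric := by
    intro v w
    obtain ⟨J, hJ⟩ := hsurj v
    obtain ⟨K, hK⟩ := hsurj w
    rw [Submodule.coe_inner, Submodule.coe_inner, hS J J.2 v hJ, hS K K.2 w hK, hJ, hK]
    exact hself J J.2 K K.2 _
  intro J
  have h := inner_apply_le_of_hasEigenvalue_le hsymm hc ⟨_, hAN J⟩
  rw [Submodule.coe_inner, hS J J.2 ⟨_, hAN J⟩ rfl] at h
  rw [evalMap_apply hmem, evalDerivMap_apply _ _ _ hmem]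
  exact h

end Geometry

/-! ### The splitting -/

section Geometry

variable {E : Type*} [NormedAddCommGroup E] [NormedSpace ℝ E]
  {H : Type*} [TopologicalSpace H] {I : ModelWithCorners ℝ E H}
  {M : Type*} [TopologicalSpace M] [ChartedSpace H M]
  [RiemannianBundle (fun x : M ↦ TangentSpace I x)]
  [FiniteDimensional ℝ E] [CompleteSpace E] [IsManifold I ∞ M]
  [IsContMDiffRiemannianBundle I ∞ E (fun x : M ↦ TangentSpace I x)]
  [I.Boundaryless] {γ : ℝ → M} {s : Set ℝ} {α : ℝ}

set_option linter.unusedSectionVars false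

theorem isSmooth_zero (hγ : ContMDiffOn 𝓘(ℝ, ℝ) I ∞ γ s) (hs : UniqueDiffOn ℝ s) :
    (0 : FieldAlong I γ s).IsSmooth := by
  have h := (isSmooth_velocity hγ hs).mulBy hγ (contDiff_const (c := (0 : ℝ)))
  rwa [FieldAlong.mulBy_const, zero_smul] at h

theorem covDeriv_zero (hγ : ContMDiffOn 𝓘(ℝ, ℝ) I ∞ γ s) (hs : UniqueDiffOn ℝ s) :
    (0 : FieldAlong I γ s).covDeriv = 0 := by
  have h := FieldAlong.covDeriv_smul hγ hs 0 (isSmooth_zero hγ hs)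
  rwa [zero_smul, zero_smul] at h

theorem eqOn_Icc_of_eqOn_Ioo {f g : ℝ → ℝ} {a b : ℝ} (hab : a < b)
    (hf : ContinuousOn f (Set.Icc a b)) (hg : ContinuousOn g (Set.Icc a b))
    (h : Set.EqOn f g (Set.Ioo a b)) : Set.EqOn f g (Set.Icc a b) :=
  h.of_subset_closure hf hg Set.Ioo_subset_Icc_self (closure_Ioo hab.ne).ge

/-- A smooth field along a curve that vanishes in the interior of the interval is zero. -/
theorem FieldAlong.IsSmooth.eq_zero_of_Ioo {a b : ℝ} (hab : a < b)
    (hγ : ContMDiffOn 𝓘(ℝ, ℝ) I ∞ γ (Set.Icc a b)) {V : FieldAlong I γ (Set.Icc a b)}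
    (hV : V.IsSmooth) (h : ∀ t : Set.Icc a b, (t : ℝ) ∈ Set.Ioo a b → V t = 0) : V = 0 := by
  have hc : ContinuousOn (fun r ↦ (inner ℝ (V.ext r) (V.ext r) : ℝ)) (Set.Icc a b) := fun r hr ↦
    (FieldAlong.hasDerivWithinAt_inner hγ (uniqueDiffOn_Icc hab) hV hV ⟨r, hr⟩).continuousWithinAt
  have h0 := eqOn_Icc_of_eqOn_Ioo hab hc (g := fun _ ↦ 0) continuousOn_const fun r hr ↦ by
    simp only [FieldAlong.ext_of_mem V (Set.Ioo_subset_Icc_self hr),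
      h ⟨r, Set.Ioo_subset_Icc_self hr⟩ hr, inner_zero_left]
  funext t
  have h1 := h0 t.2
  simp only [FieldAlong.ext_apply] at h1
  exact inner_self_eq_zero.1 h1

theorem sin_pos_of_mem_Ioo (hα : 0 ≤ α) {t : ℝ} (ht : t ∈ Set.Ioo α Real.pi) : 0 < Real.sin t :=
  Real.sin_pos_of_pos_of_lt_pi (hα.trans_lt ht.1) ht.2

/-- A field whose logarithmic derivative is the cotangent is the product of the sine and a parallel
field. -/
theorem exists_parallel_of_cot (hα : α ∈ Set.Ico 0 Real.pi)
    (hγ : ContMDiffOn 𝓘(ℝ, ℝ) I ∞ γ (Set.Icc α Real.pi))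
    {J : FieldAlong I γ (Set.Icc α Real.pi)} (hJ : J.IsSmooth)
    (hcot : ∀ t : Set.Icc α Real.pi, (t : ℝ) ∈ Set.Ioo α Real.pi →
      J.covDeriv t = Real.cot t • J t) :
    ∃ F : FieldAlong I γ (Set.Icc α Real.pi), F.IsParallel ∧ ∀ t, J t = Real.sin t • F t := by
  have hs := uniqueDiffOn_Icc hα.2
  have hsin : ContDiff ℝ ∞ Real.sin := Real.contDiff_sin
  have hcos : ContDiff ℝ ∞ Real.cos := Real.contDiff_cos
  have hncos : ∀ r, HasDerivAt (fun r ↦ -Real.cos r) (Real.sin r) r := fun r ↦ by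
    have := (Real.hasDerivAt_cos r).neg
    rwa [neg_neg] at this
  have hJ' := hJ.covDeriv hγ hs
  have hJ'' := hJ'.covDeriv hγ hs
  have hcot' : ∀ t : Set.Icc α Real.pi, (t : ℝ) ∈ Set.Ioo α Real.pi →
      Real.sin t • J.covDeriv t = Real.cos t • J t := by
    intro t ht
    rw [hcot t ht, smul_smul, Real.cot_eq_cos_div_sin,
      mul_div_cancel₀ _ (sin_pos_of_mem_Ioo hα.1 ht).ne']
  have hG : J.covDeriv.mulBy Real.sin + J.mulBy (fun r ↦ -Real.cos r) = 0 := by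
    refine ((hJ'.mulBy hγ hsin).add hγ (hJ.mulBy hγ hcos.neg)).eq_zero_of_Ioo hα.2 hγ fun t ht ↦ ?_
    simp only [Pi.add_apply, FieldAlong.mulBy, hcot' t ht]
    module
  -- Differentiating `sin • J' - cos • J = 0` gives `sin • (J'' + J) = 0`.
  have hJac : J.covDeriv.covDeriv + J = 0 := by
    refine (hJ''.add hγ hJ).eq_zero_of_Ioo hα.2 hγ fun t ht ↦ ?_
    have h1 := FieldAlong.covDeriv_add hγ hs (hJ'.mulBy hγ hsin) (hJ.mulBy hγ hcos.neg)
    rw [hG, covDeriv_zero hγ hs, FieldAlong.covDeriv_mulBy hγ hs Real.hasDerivAt_sin hJ',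
      FieldAlong.covDeriv_mulBy hγ hs hncos hJ] at h1
    have h2 := congrFun h1 t
    simp only [Pi.add_apply, FieldAlong.mulBy, Pi.zero_apply] at h2
    have h3 : Real.sin t • (J.covDeriv.covDeriv + J) t = 0 := by
      rw [Pi.add_apply, h2]
      module
    exact (smul_eq_zero.1 h3).resolve_left (sin_pos_of_mem_Ioo hα.1 ht).ne'
  -- If `J = sin • F` with `F` parallel then `J' = cos • F`, so `F = sin • J + cos • J'`. Unlike `J
  -- / sin`, this is visibly smooth at end points where the sine vanishes.
  have hF : (J.mulBy Real.sin + J.covDeriv.mulBy Real.cos).IsSmooth :=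
    (hJ.mulBy hγ hsin).add hγ (hJ'.mulBy hγ hcos)
  refine ⟨J.mulBy Real.sin + J.covDeriv.mulBy Real.cos, ⟨hF, ?_⟩, ?_⟩
  · rw [FieldAlong.covDeriv_add hγ hs (hJ.mulBy hγ hsin) (hJ'.mulBy hγ hcos),
      FieldAlong.covDeriv_mulBy hγ hs Real.hasDerivAt_sin hJ,
      FieldAlong.covDeriv_mulBy hγ hs Real.hasDerivAt_cos hJ']
    funext t
    have h1 := congrFun hJac t
    simp only [Pi.add_apply, Pi.zero_apply] at h1
    simp only [Pi.add_apply, FieldAlong.mulBy, eq_neg_of_add_eq_zero_left h1, Pi.zero_apply]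
    module
  · have h0 : J + (J.mulBy Real.sin + J.covDeriv.mulBy Real.cos).mulBy (fun r ↦ -Real.sin r)
        = 0 := by
      refine (hJ.add hγ (hF.mulBy hγ hsin.neg)).eq_zero_of_Ioo hα.2 hγ fun t ht ↦ ?_
      simp only [Pi.add_apply, FieldAlong.mulBy, smul_add]
      rw [smul_smul (-Real.sin t) (Real.cos t), neg_mul, mul_comm (Real.sin t) (Real.cos t),
        neg_smul (Real.cos t * Real.sin t), mul_smul, hcot' t ht]
      have : (1 - Real.sin t ^ 2 - Real.cos t ^ 2) • J t = 0 := by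
        rw [← Real.cos_sq' t, sub_self, zero_smul]
      rw [← this]
      module
    intro t
    have h1 := congrFun h0 t
    simp only [Pi.add_apply, Pi.zero_apply] at h1
    rw [eq_neg_of_add_eq_zero_left h1]
    simp only [FieldAlong.mulBy, Pi.add_apply]
    module

/-- The fields of a family that are products of the sine and a parallel field. -/
def sineFields (hγ : ContMDiffOn 𝓘(ℝ, ℝ) I ∞ γ s) (hs : UniqueDiffOn ℝ s)
    (Λ : Submodule ℝ (FieldAlong I γ s)) : Submodule ℝ (FieldAlong I γ s) where
  carrier := {J | J ∈ Λ ∧ ∃ F : FieldAlong I γ s, F.IsParallel ∧ ∀ t, J t = Real.sin t • F t}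
  add_mem' := by
    rintro J K ⟨hJ, F, hF, hJF⟩ ⟨hK, G, hG, hKG⟩
    refine ⟨Λ.add_mem hJ hK, F + G, ⟨hF.1.add hγ hG.1, ?_⟩, fun t ↦ ?_⟩
    · rw [FieldAlong.covDeriv_add hγ hs hF.1 hG.1, hF.2, hG.2, add_zero]
    · rw [Pi.add_apply, Pi.add_apply, hJF, hKG, smul_add]
  zero_mem' := ⟨Λ.zero_mem, 0, ⟨isSmooth_zero hγ hs, covDeriv_zero hγ hs⟩, fun t ↦ by simp⟩
  smul_mem' := by
    rintro c J ⟨hJ, F, hF, hJF⟩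
    refine ⟨Λ.smul_mem c hJ, c • F, ⟨?_, ?_⟩, fun t ↦ ?_⟩
    · exact hF.1.mulBy hγ (contDiff_const (c := c))
    · rw [FieldAlong.covDeriv_smul hγ hs c hF.1, hF.2, smul_zero]
    · rw [Pi.smul_apply, Pi.smul_apply, hJF, smul_comm]

/-- A field of the family with a zero is orthogonal to the products of the sine and a parallel
field. -/
theorem inner_eq_zero_of_parallel (hα : α ∈ Set.Ico 0 Real.pi)
    (hγ : ContMDiffOn 𝓘(ℝ, ℝ) I ∞ γ (Set.Icc α Real.pi))
    {J K F : FieldAlong I γ (Set.Icc α Real.pi)} (hJ : J.IsSmooth) (hF : F.IsParallel)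
    (hKF : ∀ t, K t = Real.sin t • F t)
    (hself : ∀ t, inner ℝ (J.covDeriv t) (K t) = inner ℝ (J t) (K.covDeriv t))
    {t₀ : Set.Icc α Real.pi} (ht₀ : (t₀ : ℝ) ∈ Set.Ioo α Real.pi) (hJt₀ : J t₀ = 0)
    (t : Set.Icc α Real.pi) : inner ℝ (J t) (K t) = 0 := by
  have hs := uniqueDiffOn_Icc hα.2
  have hK : K = F.mulBy Real.sin := funext hKF
  have hK' : ∀ t, K.covDeriv t = Real.cos t • F t := by
    intro t
    rw [hK, FieldAlong.covDeriv_mulBy hγ hs Real.hasDerivAt_sin hF.1, hF.2]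
    simp [FieldAlong.mulBy]
  set φ : ℝ → ℝ := fun r ↦ inner ℝ (J.ext r) (F.ext r)
  have hd : ∀ t : Set.Icc α Real.pi, HasDerivWithinAt φ (inner ℝ (J.covDeriv t) (F t))
      (Set.Icc α Real.pi) t := fun t ↦ by
    have := FieldAlong.hasDerivWithinAt_inner hγ hs hJ hF.1 t
    rwa [hF.2, Pi.zero_apply, inner_zero_right, add_zero] at this
  -- Self-adjointness for `K = sin • F`, `K' = cos • F` is the equation `φ' sin = φ cos`, which
  -- makes `φ / sin` constant.
  have hode : ∀ t : Set.Icc α Real.pi,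
      inner ℝ (J.covDeriv t) (F t) * Real.sin t = φ t * Real.cos t := by
    intro t
    have h1 := hself t
    rw [hKF, hK', inner_smul_right, inner_smul_right] at h1
    simp only [φ, FieldAlong.ext_apply]
    linarith
  have hq : ∀ r ∈ Set.Ioo α Real.pi, HasDerivAt (fun r ↦ φ r / Real.sin r) 0 r := by
    intro r hr
    have hr' := Set.Ioo_subset_Icc_self hr
    have h1 := (hd ⟨r, hr'⟩).hasDerivAt (Icc_mem_nhds hr.1 hr.2)
    refine (h1.div (Real.hasDerivAt_sin r) (sin_pos_of_mem_Ioo hα.1 hr).ne').congr_deriv ?_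
    rw [hode ⟨r, hr'⟩, sub_self, zero_div]
  have hφ : Set.EqOn φ (fun _ ↦ 0) (Set.Icc α Real.pi) := by
    refine eqOn_Icc_of_eqOn_Ioo hα.2 (fun r hr ↦ (hd ⟨r, hr⟩).continuousWithinAt)
      continuousOn_const fun r hr ↦ ?_
    have h1 := isOpen_Ioo.is_const_of_deriv_eq_zero isPreconnected_Ioo
      (fun r hr ↦ (hq r hr).differentiableAt.differentiableWithinAt) (fun r hr ↦ (hq r hr).deriv)
      hr ht₀
    have h2 : φ t₀ = 0 := by simp only [φ, FieldAlong.ext_apply, hJt₀, inner_zero_left]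
    simp only [h2, zero_div] at h1
    exact (div_eq_zero_iff.1 h1).resolve_right (sin_pos_of_mem_Ioo hα.1 hr).ne'
  have h3 := hφ t.2
  simp only [φ, FieldAlong.ext_apply] at h3
  rw [hKF, inner_smul_right, h3, mul_zero]

end Geometry

end JacobiSplitting

end

/-! ### The splitting theorem -/

open Bundle FiberBundle VectorField
open scoped Manifold ContDiff Topology
open JacobiSplitting in
theorem theoremB {n : ℕ} {M : Type*} [EMetricSpace M]
    [ChartedSpace (EuclideanSpace ℝ (Fin n)) M] [IsManifold (𝓡 n) ∞ M]
    [RiemannianBundle (fun x : M ↦ TangentSpace (𝓡 n) x)]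
    [IsContMDiffRiemannianBundle (𝓡 n) ∞ (EuclideanSpace ℝ (Fin n))
      (fun x : M ↦ TangentSpace (𝓡 n) x)]
    [IsRiemannianManifold (𝓡 n) M] [CompleteSpace M]
    (hsec : ∀ (x : M) (u v : TangentSpace (𝓡 n) x),
      LinearIndependent ℝ ![u, v] → 1 ≤ sectionalCurvature u v)
    {α : ℝ} (hα : α ∈ Set.Ico 0 Real.pi)
    (γ : ℝ → M) (hγ : IsGeodesicOn (𝓡 n) γ (Set.Icc α Real.pi))
    (hγ_unit : ∀ t, ‖velocity (𝓡 n) γ (Set.Icc α Real.pi) t‖ = 1)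
    (Λ : Submodule ℝ (FieldAlong (𝓡 n) γ (Set.Icc α Real.pi)))
    (hΛ : ∀ J ∈ Λ, J.IsJacobi ∧ J.IsNormal)
    (hdim : Module.finrank ℝ Λ + 1 = n)
    (hself : RiccatiSelfAdjoint Λ)
    -- for `α = 0` the bound is `cot 0 = ∞` and there is no condition
    (hbound : 0 < α →
      ∃ S : Module.End ℝ
          (normalSpace (𝓡 n) γ (Set.Icc α Real.pi) ⟨α, Set.left_mem_Icc.2 hα.2.le⟩),
        IsRiccatiOperator Λ ⟨α, Set.left_mem_Icc.2 hα.2.le⟩ S ∧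
          ∀ μ : ℝ, S.HasEigenvalue μ → μ ≤ Real.cot α) :
    ∃ Z P : Submodule ℝ (FieldAlong (𝓡 n) γ (Set.Icc α Real.pi)),
      Z = Submodule.span ℝ
        {J | J ∈ Λ ∧ ∃ t : Set.Icc α Real.pi, (t : ℝ) ∈ Set.Ioo α Real.pi ∧ J t = 0} ∧
      (P : Set (FieldAlong (𝓡 n) γ (Set.Icc α Real.pi))) =
        {J | J ∈ Λ ∧ ∃ F : FieldAlong (𝓡 n) γ (Set.Icc α Real.pi),
          F.IsParallel ∧ ∀ t, J t = Real.sin t • F t} ∧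
      Z ⊔ P = Λ ∧ Disjoint Z P ∧
      ∀ J ∈ Z, ∀ K ∈ P, ∀ t, inner ℝ (J t) (K t) = 0 := by
  have hs := uniqueDiffOn_Icc hα.2
  have hdim' : Module.finrank ℝ Λ + 1 = Module.finrank ℝ (EuclideanSpace ℝ (Fin n)) := by
    rw [hdim, finrank_euclideanSpace_fin]
  have hfin := finiteDimensional_of_isJacobi hα.2 hγ.1 hγ_unit fun J hJ ↦ (hΛ J hJ).1
  have hR := isRiccatiFamily hα.2 hsec hγ hγ_unit hΛ hdim' hself
  set Z := Submodule.span ℝ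
    {J | J ∈ Λ ∧ ∃ t : Set.Icc α Real.pi, (t : ℝ) ∈ Set.Ioo α Real.pi ∧ J t = 0} with hZ
  set P := sineFields hγ.1 hs Λ
  have hZΛ : Z ≤ Λ := Submodule.span_le.2 fun J hJ ↦ hJ.1
  have hPΛ : P ≤ Λ := fun J hJ ↦ hJ.1
  have horth : ∀ J ∈ Z, ∀ K ∈ P, ∀ t, inner ℝ (J t) (K t) = 0 := by
    intro J hJ K hK t
    obtain ⟨hKΛ, F, hF, hKF⟩ := hK
    induction hJ using Submodule.span_induction with
    | mem J hJ =>
      obtain ⟨hJΛ, t₀, ht₀, hJt₀⟩ := hJ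
      exact inner_eq_zero_of_parallel hα hγ.1 (hΛ J hJΛ).1.1 hF hKF (hself J hJΛ K hKΛ) ht₀ hJt₀ t
    | zero => rw [Pi.zero_apply, inner_zero_left]
    | add J L _ _ hJ hL => rw [Pi.add_apply, inner_add_left, hJ, hL, add_zero]
    | smul c J _ hJ => rw [Pi.smul_apply, inner_smul_left, hJ, mul_zero]
  refine ⟨Z, P, rfl, rfl, le_antisymm (sup_le hZΛ hPΛ) ?_, ?_, horth⟩
  · by_contra hnot
    have hlt : (Z ⊔ P).comap Λ.subtype < ⊤ := by
      rw [lt_top_iff_ne_top]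
      exact fun h ↦ hnot fun J hJ ↦ (h ▸ Submodule.mem_top : (⟨J, hJ⟩ : Λ) ∈ _)
    -- Vanishing on `Z` is what the comparison requires of `lam`. Vanishing on `P` contradicts the
    -- field with `lam J = 1` that it produces.
    obtain ⟨lam, hlam, hker⟩ := Submodule.exists_le_ker_of_lt_top _ hlt
    obtain ⟨J, hJ1, hJcot⟩ := hR.exists_cot hα (fun hα0 ↦ by
      obtain ⟨S, hS, hμ⟩ := hbound hα0
      exact riccati_left hα.2 hγ hγ_unit hΛ hdim' hself hS hμ) hlam (fun t ht J hJ ↦ by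
      rw [evalMap_apply (Set.Ioo_subset_Icc_self ht)] at hJ
      exact hker (show (J : FieldAlong _ _ _) ∈ Z ⊔ P from
        Submodule.mem_sup_left (Submodule.subset_span ⟨J.2, _, ht, hJ⟩)))
    have hJP : (J : FieldAlong (𝓡 n) γ (Set.Icc α Real.pi)) ∈ P := by
      refine ⟨J.2, exists_parallel_of_cot hα hγ.1 (hΛ J J.2).1.1 fun t ht ↦ ?_⟩
      have h := hJcot t ht
      rwa [evalMap_apply t.2, evalDerivMap_apply _ _ _ t.2] at h
    have h0 : lam J = 0 := hker (show (J : FieldAlong _ _ _) ∈ Z ⊔ P from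
      Submodule.mem_sup_right hJP)
    rw [hJ1] at h0
    exact one_ne_zero h0
  · rw [Submodule.disjoint_def]
    intro K hKZ hKP
    funext t
    exact inner_self_eq_zero.1 (horth K hKZ K hKP t)
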